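/- Let $\mu>0$, $M>0$ and $\phi(x)=\frac{\mu}{2}|x|^2$ on $\mathbb R^2$, and let $G_2(x)=-\frac1{2\pi}\log|x|$ be the Green function of $-\Delta$ in $\mathbb R^2$; write $(-\Delta)^{-1}\rho:=G_2*\rho$. Let $(n_\infty,c_\infty)$ be the stationary solution of mass $M$ of the Poisson--Nernst--Planck system with confinement potential $\phi$, i.e. the classical solution of $$-\Delta c_\infty=n_\infty=M\,\frac{e^{-c_\infty-\phi}}{\int_{\mathbb R^2}e^{-c_\infty-\phi}\,dx}\,,\qquad c_\infty=(-\Delta)^{-1}n_\infty\,.$$ Let $\mathrm H^1(\mathbb R^2,n_\infty dx)$ be the space of the functions $f\in \mathrm L^2(\mathbb R^2,n_\infty dx)$ whose distributional gradient is in $\mathrm L^2(\mathbb R^2,n_\infty dx)$. For $f\in \mathrm H^1(\mathbb R^2,n_\infty dx)$ with $\int_{\mathbb R^2} f\,n_\infty\,dx=0$, set $\psi_f:=(-\Delta)^{-1}(f\,n_\infty)$ and $$Q_1[f]:=\int_{\mathbb R^2}f^2\,n_\infty\,dx+\int_{\mathbb R^2}|\nabla\psi_f|^2\,dx\,,\qquad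 Q_2[f]:=\int_{\mathbb R^2}|\nabla(f+\psi_f)|^2\,n_\infty\,dx\,.$$ Then, for every such $f$, the quantities $Q_1[f]$ and $Q_2[f]$ are well defined and finite, and $$Q_2[f]\ge\mu\,Q_1[f]\,.$$ Moreover, $\mu$ is optimal: it is the largest constant $C$ such that $Q_2[f]\ge C\,Q_1[f]$ for every $f\in \mathrm H^1(\mathbb R^2,n_\infty dx)$ with $\int_{\mathbb R^2} f\,n_\infty\,dx=0$. -/

import Mathlib

open MeasureTheory
open scoped ContDiff ENNReal

noncomputable section

namespace PNP

/-- The Euclidean plane. -/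
abbrev Plane : Type := EuclideanSpace ℝ (Fin 2)

/-- The Green function `G₂(x) = -(1 / 2π) log |x|` of `-Δ` in the plane. -/
def green (x : Plane) : ℝ := -(1 / (2 * Real.pi)) * Real.log ‖x‖

/-- The inverse Laplacian `(-Δ)⁻¹ ρ = G₂ * ρ` in the plane. -/
def invLaplacian (ρ : Plane → ℝ) (x : Plane) : ℝ := ∫ y, green (x - y) * ρ y

/-- The harmonic confinement potential `φ(x) = (μ / 2) |x|²`. -/
def harmonicPotential (μ : ℝ) (x : Plane) : ℝ := μ / 2 * ‖x‖ ^ 2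

/-- `(n, c)` is a (classical) solution of the Poisson–Boltzmann equation
`-Δ c = n = M e^{-c-φ} / ∫ e^{-c-φ}` with `c = (-Δ)⁻¹ n = G₂ * n`: a stationary solution of mass `M`
of the Poisson–Nernst–Planck system with confinement potential `φ`. -/
structure IsStationary (M : ℝ) (φ n c : Plane → ℝ) : Prop where
  contDiff : ContDiff ℝ 2 c
  poisson : ∀ x, -Laplacian.laplacian c x = n x
  integrable : Integrable fun x => Real.exp (-c x - φ x)
  boltzmann : ∀ x, n x = M * (Real.exp (-c x - φ x) / ∫ y, Real.exp (-c y - φ y))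
  integrable_green : ∀ x, Integrable fun y => green (x - y) * n y
  eq_invLaplacian : c = invLaplacian n

/-- `v` is the gradient of `u` in the sense of distributions; both are locally integrable. -/
structure HasWeakGradient (u : Plane → ℝ) (v : Plane → Plane) : Prop where
  locallyIntegrable : LocallyIntegrable u
  locallyIntegrable_grad : LocallyIntegrable v
  integral_eq : ∀ η : Plane → ℝ, ContDiff ℝ ∞ η → HasCompactSupport η →
    ∫ x, u x • gradient η x = -∫ x, η x • v x

open scoped Classical in
/-- The distributional gradient of `u` (unique almost everywhere), when it is a locally integrable
function; `0` otherwise. -/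
def weakGradient (u : Plane → ℝ) : Plane → Plane :=
  if h : ∃ v, HasWeakGradient u v then h.choose else 0

/-- The measure `n dx`. -/
def weighted (n : Plane → ℝ) : Measure Plane :=
  volume.withDensity fun x => ENNReal.ofReal (n x)

/-- The weighted Sobolev space `H¹(ℝ², n dx)`. -/
def MemH1 (n f : Plane → ℝ) : Prop :=
  MemLp f 2 (weighted n) ∧ (∃ v, HasWeakGradient f v) ∧ MemLp (weakGradient f) 2 (weighted n)

/-- The functions `f ∈ H¹(ℝ², n dx)` such that `∫ f n dx = 0`. -/
def Admissible (n f : Plane → ℝ) : Prop :=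
  MemH1 n f ∧ ∫ x, f x * n x = 0

/-- The potential `g c_∞ = (-Δ)⁻¹ (f n)` generated by the perturbation `f n`. -/
def perturbedPotential (n f : Plane → ℝ) : Plane → ℝ :=
  invLaplacian fun y => f y * n y

/-- The quadratic form `Q₁[f] = ∫ f² n dx + ∫ |∇ (-Δ)⁻¹ (f n)|² dx`. -/
def Q₁ (n f : Plane → ℝ) : ℝ :=
  (∫ x, f x ^ 2 * n x) + ∫ x, ‖weakGradient (perturbedPotential n f) x‖ ^ 2

/-- The quadratic form `Q₂[f] = ∫ |∇ (f + (-Δ)⁻¹ (f n))|² n dx`. -/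
def Q₂ (n f : Plane → ℝ) : ℝ :=
  ∫ x, ‖weakGradient (fun z => f z + perturbedPotential n f z) x‖ ^ 2 * n x

/-- All the integrals and gradients that enter `Q₁[f]` and `Q₂[f]` make sense and are finite. -/
structure WellDefined (n f : Plane → ℝ) : Prop where
  integrable_green : ∀ x, Integrable fun y => green (x - y) * (f y * n y)
  exists_grad_potential : ∃ v, HasWeakGradient (perturbedPotential n f) v
  exists_grad_sum : ∃ v, HasWeakGradient (fun z => f z + perturbedPotential n f z) v
  integrable_sq : Integrable fun x => f x ^ 2 * n x
  integrable_field : Integrable fun x => ‖weakGradient (perturbedPotential n f) x‖ ^ 2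
  integrable_fisher :
    Integrable fun x => ‖weakGradient (fun z => f z + perturbedPotential n f z) x‖ ^ 2 * n x

end PNP

end

/-!
Write `∂ₑ` for the derivative in a direction `e`, `ψ = (-Δ)⁻¹ (f n)` for the potential of a
perturbation `f`, and `V = c + (μ / 2) |x|²`, so that `n` is a multiple of `exp (-V)`. The
inequality is proved by separation of variables in polar coordinates and an explicit
one-dimensional identity for each angular mode; the constant is attained, in sum, by the two
functions `∂ₑ log n`.

*The stationary solution.* The confinement dominates the logarithmic potential, so `n` decays
rapidly. At infinity `c` is asymptotic to the potential of a point mass, so the difference of `c`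
and its image under an isometry tends to `0`; as `-Δ c` is a decreasing function of `c` on each
circle, the maximum principle gives the radial symmetry (`IsStationary.potential_eq_of_norm_eq`).
At a maximum of `log n`, `0 ≥ Δ log n = n - 2 μ`, hence `n ≤ 2 μ` everywhere
(`IsStationary.density_le`). With `m r = ∫₀ʳ n s ds` it follows that `m ≤ μ r²`, i.e. that the
drift `V' = μ r - m / r` is nonnegative. This is the only property of the profile, besides its
differential equations, that the inequality needs (`RadialProfile`, `IsStationary.radialProfile`).

*The inequality for one mode.* If `a` and `b` are the angular modes of frequency `k` of `f` and
`ψ`, then `r b'' + b' - k² b / r = -r n a`. After subtraction of the derivative of a suitable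
quadratic form in `a`, `b` and `b'`, which vanishes at the origin and at infinity, the difference
of the integrands of `Q₂` and `μ Q₁` is a sum of squares with nonnegative coefficients; for
`k ≥ 1` one of these coefficients contains the factor `V'` (`AngularMode.spectral_gap`). For
smooth compactly supported `f`, Parseval's identity on circles sums these inequalities over all
modes (`IsStationary.spectral_gap_of_hasCompactSupport`).

*The weighted Sobolev space.* The distributional gradient of `ψ` is the convolution `field` of
`f n` with the gradient of the Green function (`hasWeakGradient_invLaplacian`). Its kernel decays
only like `1 / |x|`, which is not square integrable, but the vanishing mean of `f n` permits the
subtraction of a monopole, and a Schur test then bounds the energy of the field by the norm of `f`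
in `L²(n dx)`. Hence both forms are finite and continuous for the norm of `H¹(n dx)`. Truncation,
mollification and a correction of the mean show that smooth compactly supported functions of mean
zero are dense (`IsPerturbation.exists_smooth_approx`), which gives the inequality in general
(`IsStationary.spectral_gap`).

*Optimality.* For `f = ∂ₑ log n` one has `f n = ∂ₑ n`, so `ψ = ∂ₑ c` and `f + ψ = -μ ⟨x, e⟩`.
Hence `Q₂ = μ² M` (`IsStationary.integral_fisher_logDeriv`). The sum of `Q₁` over two orthonormal
directions is a radial integral that differs from `2 μ M` by a total derivative, so it equals
`2 μ M` (`IsStationary.integral_logDeriv`). Adding `C Q₁ ≤ Q₂` over the two directions gives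
`C ≤ μ`.
-/

namespace PNP

open Set Filter Topology

/-! ### The spectral gap for a single angular mode -/

section

/-- Comparison of two integrals over `(0, ∞)` whose integrands differ by at least the derivative of
a function that vanishes at both ends. -/
lemma setIntegral_Ioi_le_of_deriv_le {F₁ F₂ P P' : ℝ → ℝ}
    (h₁ : IntegrableOn F₁ (Ioi 0)) (h₂ : IntegrableOn F₂ (Ioi 0))
    (hP : ∀ r, 0 < r → HasDerivAt P (P' r) r) (hle : ∀ r, 0 < r → P' r ≤ F₂ r - F₁ r)
    (h0 : Tendsto P (𝓝[>] 0) (𝓝 0)) (hinf : Tendsto P atTop (𝓝 0)) :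
    ∫ r in Ioi 0, F₁ r ≤ ∫ r in Ioi 0, F₂ r := by
  have hu : Tendsto (fun n : ℕ => ((n : ℝ) + 1)⁻¹) atTop (𝓝[>] 0) := by
    refine tendsto_nhdsWithin_iff.2 ⟨?_, Eventually.of_forall fun n => ?_⟩
    · simpa using tendsto_one_div_add_atTop_nhds_zero_nat (𝕜 := ℝ)
    · exact mem_Ioi.2 (by positivity)
  have hv : Tendsto (fun n : ℕ => (n : ℝ) + 1) atTop atTop :=
    tendsto_atTop_add_const_right _ _ tendsto_natCast_atTop_atTop
  have hint := (h₂.sub h₁)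
  have hlim' : Tendsto (fun n : ℕ => ∫ x in ((n : ℝ) + 1)⁻¹..((n : ℝ) + 1), (F₂ x - F₁ x)) atTop
      (𝓝 (∫ x in Ioi 0, (F₂ x - F₁ x))) := by
    have hc : AECover (volume.restrict (Ioi (0 : ℝ))) atTop
        fun n : ℕ => Ioc ((n : ℝ) + 1)⁻¹ ((n : ℝ) + 1) := by
      refine ⟨?_, fun n => measurableSet_Ioc⟩
      filter_upwards [ae_restrict_mem measurableSet_Ioi] with x hx
      filter_upwards [(hu.mono_right nhdsWithin_le_nhds).eventually (gt_mem_nhds (mem_Ioi.1 hx)),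
        hv.eventually (eventually_ge_atTop x)] with n h1 h2
      exact ⟨h1, h2⟩
    have := hc.integral_tendsto_of_countably_generated hint
    refine this.congr fun n => ?_
    have hn : ((n : ℝ) + 1)⁻¹ ≤ (n : ℝ) + 1 :=
      (inv_le_one_of_one_le₀ (by linarith [n.cast_nonneg (α := ℝ)])).trans
        (by linarith [n.cast_nonneg (α := ℝ)])
    rw [intervalIntegral.integral_of_le hn, Measure.restrict_restrict measurableSet_Ioc,
      inter_eq_left.2]
    · rfl
    · intro x hx
      exact lt_trans (by positivity) hx.1
  have hdiff : Tendsto (fun n : ℕ => P ((n : ℝ) + 1) - P ((n : ℝ) + 1)⁻¹) atTop (𝓝 (0 - 0)) :=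
    (hinf.comp hv).sub (h0.comp hu)
  have key : (0 : ℝ) - 0 ≤ ∫ x in Ioi 0, (F₂ x - F₁ x) := by
    refine le_of_tendsto_of_tendsto' hdiff hlim' fun n => ?_
    have hpos : (0 : ℝ) < ((n : ℝ) + 1)⁻¹ := by positivity
    have hn : ((n : ℝ) + 1)⁻¹ ≤ (n : ℝ) + 1 :=
      (inv_le_one_of_one_le₀ (by linarith [n.cast_nonneg (α := ℝ)])).trans
        (by linarith [n.cast_nonneg (α := ℝ)])
    refine intervalIntegral.sub_le_integral_of_hasDeriv_right_of_le hn
      (fun x hx => (hP x (hpos.trans_le hx.1)).continuousAt.continuousWithinAt)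
      (fun x hx => (hP x (hpos.trans hx.1)).hasDerivWithinAt)
      (hint.mono_set fun x hx => hpos.trans_le hx.1)
      (fun x hx => hle x (hpos.trans hx.1))
  rw [integral_sub h₂ h₁] at key
  linarith

/-- The radial profile `n` of a stationary density together with `m r = ∫₀ʳ n s ds`
(the mass of the disc of radius `r` divided by `2π`): the drift is `V' r = μ r - m r / r ≥ 0`. -/
structure RadialProfile (μ : ℝ) (n m : ℝ → ℝ) : Prop where
  pos : ∀ r, 0 < r → 0 < n r
  mass_pos : ∀ r, 0 < r → 0 < m r
  hasDerivAt_mass : ∀ r, 0 < r → HasDerivAt m (n r * r) r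
  hasDerivAt : ∀ r, 0 < r → HasDerivAt n (-(μ * r - m r / r) * n r) r
  mass_le : ∀ r, 0 < r → m r ≤ μ * r ^ 2
  limit : ∃ n₀, 0 < n₀ ∧ Tendsto n (𝓝[>] 0) (𝓝 n₀)
  limit_mass : ∃ ρ₀, 0 < ρ₀ ∧ Tendsto (fun r => m r / r ^ 2) (𝓝[>] 0) (𝓝 ρ₀)

/-- The `k`-th angular mode `a` of a perturbation `f` and the mode `b` of its potential, with
derivatives `a'` and `b'`: the radial form of `-Δ ψ = f n`, and the behaviour at the origin and
outside a disc that contains the support of `f`. -/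
structure AngularMode (n : ℝ → ℝ) (k : ℕ) (a a' b b' : ℝ → ℝ) : Prop where
  hasDerivAt_density : ∀ r, 0 < r → HasDerivAt a (a' r) r
  hasDerivAt_potential : ∀ r, 0 < r → HasDerivAt b (b' r) r
  poisson : ∀ r, 0 < r → HasDerivAt b' (-b' r / r + k ^ 2 * b r / r ^ 2 - n r * a r) r
  limit_density : ∃ a₀, Tendsto a (𝓝[>] 0) (𝓝 a₀) ∧ (k ≠ 0 → a₀ = 0)
  limit_potential : ∃ b₀, Tendsto b (𝓝[>] 0) (𝓝 b₀) ∧ (k ≠ 0 → b₀ = 0)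
  limit_deriv : ∃ b₁, Tendsto b' (𝓝[>] 0) (𝓝 b₁) ∧ (k = 0 → b₁ = 0)
  support : ∃ R, ∀ r, R < r → a r = 0
  energy : IntegrableOn (fun r => r * b' r ^ 2 + k ^ 2 * b r ^ 2 / r) (Ioi 0)

variable {μ : ℝ} {n m : ℝ → ℝ} {k : ℕ} {a a' b b' : ℝ → ℝ}

/-- Outside the support of `f`, the finite-energy solution of `r b'' + b' = k² b / r` is the
decaying one, `b = C r⁻ᵏ`. -/
lemma AngularMode.exterior (h : AngularMode n k a a' b b') :
    ∃ R, 0 < R ∧ (∀ r, R < r → a r = 0) ∧ ∀ r, R < r → r * b' r + k * b r = 0 := by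
  obtain ⟨R₀, hR₀⟩ := h.support
  set R := max R₀ 1
  have hR1 : 1 ≤ R := le_max_right _ _
  have hRpos : 0 < R := by linarith
  have ha : ∀ r, R < r → a r = 0 := fun r hr => hR₀ r ((le_max_left _ _).trans_lt hr)
  refine ⟨R, hRpos, ha, ?_⟩
  -- `z = r b' + k b` solves `r z' = k z`, so that `z / r ^ k` is constant
  set y : ℝ → ℝ := fun r => (r * b' r + k * b r) / r ^ k with hy
  have hyd : ∀ r, R < r → HasDerivAt y 0 r := by
    intro r hr
    have hr0 : 0 < r := hRpos.trans hr
    have h1 := (((hasDerivAt_id r).mul (h.poisson r hr0)).add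
      ((h.hasDerivAt_potential r hr0).const_mul (k : ℝ))).div (hasDerivAt_pow k r)
      (pow_ne_zero k hr0.ne')
    refine h1.congr_deriv ?_
    rw [ha r hr]
    rcases Nat.eq_zero_or_pos k with hk | hk
    · subst hk; simp; field_simp; simp
    · obtain ⟨j, rfl⟩ := Nat.exists_eq_succ_of_ne_zero hk.ne'
      simp only [Nat.succ_eq_add_one, Nat.add_sub_cancel, Nat.cast_add, Nat.cast_one, id,
        Pi.add_apply, Pi.mul_apply]
      field_simp
      ring
  have hconst : ∀ r, R < r → ∀ s, R < s → y r = y s := by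
    intro r hr s hs
    refine IsOpen.is_const_of_deriv_eq_zero (s := Ioi R) isOpen_Ioi isPreconnected_Ioi
      (fun x hx => (hyd x hx).differentiableAt.differentiableWithinAt)
      (fun x hx => (hyd x hx).deriv) hr hs
  set β := y (R + 1)
  have hz : ∀ r, R < r → r * b' r + k * b r = β * r ^ k := by
    intro r hr
    have hr0 : 0 < r := hRpos.trans hr
    have h1 : y r = β := hconst r hr (R + 1) (by linarith)
    rw [← h1, hy]
    field_simp
  suffices hβ : β = 0 by
    intro r hr
    rw [hz r hr, hβ, zero_mul]
  by_contra hβ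
  -- otherwise the energy density would dominate `β² / (2 r)`
  have hbd : IntegrableOn (fun r : ℝ => r⁻¹) (Ioi R) := by
    refine Integrable.mono' ((h.energy.mono_set (Ioi_subset_Ioi hRpos.le)).const_mul (2 / β ^ 2))
      (by fun_prop) ?_
    filter_upwards [ae_restrict_mem measurableSet_Ioi] with r hr
    have hr0 : 0 < r := hRpos.trans hr
    have h1 : 1 ≤ r ^ k := one_le_pow₀ (hR1.trans (le_of_lt hr))
    have h2 : β ^ 2 ≤ (r * b' r + k * b r) ^ 2 := by
      rw [hz r hr, mul_pow]
      exact le_mul_of_one_le_right (sq_nonneg _) (one_le_pow₀ h1)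
    have h3 : (r * b' r + k * b r) ^ 2 ≤ 2 * (r * (r * b' r ^ 2 + k ^ 2 * b r ^ 2 / r)) := by
      have : r * (r * b' r ^ 2 + k ^ 2 * b r ^ 2 / r) = (r * b' r) ^ 2 + (k * b r) ^ 2 := by
        field_simp
      rw [this]
      nlinarith [sq_nonneg (r * b' r - k * b r)]
    rw [Real.norm_of_nonneg (inv_nonneg.2 hr0.le), inv_eq_one_div, div_le_iff₀ hr0]
    have h4 : 0 < β ^ 2 := by positivity
    rw [div_mul_eq_mul_div, div_mul_eq_mul_div, le_div_iff₀ h4]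
    linarith
  exact not_integrableOn_Ioi_inv hbd

/-- The radial case of the spectral gap inequality. With the flux `Φ = r b'`, which satisfies
`Φ' = -n a r`, the difference of the two integrands is a sum of squares plus the derivative of
`2 μ Φ a + μ (2 - r V') Φ² / (n r²)`, and `Φ` vanishes at both ends. -/
lemma AngularMode.spectral_gap_zero (hμ : 0 < μ) (hp : RadialProfile μ n m)
    (h : AngularMode n 0 a a' b b')
    (h₁ : IntegrableOn (fun r => a r ^ 2 * (n r * r) + (r * b' r ^ 2 + (0 : ℕ) ^ 2 * b r ^ 2 / r))
      (Ioi 0))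
    (h₂ : IntegrableOn (fun r => n r * (r * (a' r + b' r) ^ 2
      + (0 : ℕ) ^ 2 * (a r + b r) ^ 2 / r)) (Ioi 0)) :
    μ * ∫ r in Ioi 0, (a r ^ 2 * (n r * r) + (r * b' r ^ 2 + (0 : ℕ) ^ 2 * b r ^ 2 / r)) ≤
      ∫ r in Ioi 0, n r * (r * (a' r + b' r) ^ 2 + (0 : ℕ) ^ 2 * (a r + b r) ^ 2 / r) := by
  rw [← integral_const_mul]
  obtain ⟨R, hR, haR, hbR⟩ := h.exterior
  obtain ⟨n₀, hn₀, hn⟩ := hp.limit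
  obtain ⟨ρ₀, hρ₀, hρ⟩ := hp.limit_mass
  obtain ⟨a₀, ha, -⟩ := h.limit_density
  obtain ⟨b₁, hb', hb₁⟩ := h.limit_deriv
  have hr : Tendsto (fun r : ℝ => r) (𝓝[>] 0) (𝓝 0) := tendsto_id.mono_left nhdsWithin_le_nhds
  obtain rfl : b₁ = 0 := hb₁ rfl
  have hP : ∀ r, 0 < r → HasDerivAt
      (fun r => 2 * μ * (r * b' r) * a r + μ * ((2 - r * (μ * r - m r / r)) / r) * (r * b' r) ^ 2 /
        (n r * r))
      (2 * μ * ((-a r * n r * r) * a r + (r * b' r) * a' r)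
        + μ * (((-2 * μ * r + n r * r) * r - (2 - r * (μ * r - m r / r))) / r ^ 2 * (r * b' r) ^ 2 /
            (n r * r)
          + ((2 - r * (μ * r - m r / r)) / r) * (2 * (r * b' r) * (-a r * n r * r)) / (n r * r)
          - ((2 - r * (μ * r - m r / r)) / r) * (r * b' r) ^ 2 *
            (-(μ * r - m r / r) * n r * r + n r) / (n r * r) ^ 2)) r := by
    intro r hr
    have hnr := (hp.pos r hr).ne'
    have dΦ := (hasDerivAt_id r).mul (h.poisson r hr)
    have dV := ((hasDerivAt_id r).const_mul μ).sub ((hp.hasDerivAt_mass r hr).div (hasDerivAt_id r)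
      hr.ne')
    have dβ := (((hasDerivAt_id r).mul dV).const_sub 2).div (hasDerivAt_id r) hr.ne'
    have d := ((dΦ.const_mul (2 * μ)).mul (h.hasDerivAt_density r hr)).add
      (((dβ.const_mul μ).mul (dΦ.pow 2)).div ((hp.hasDerivAt r hr).mul (hasDerivAt_id r))
        (mul_ne_zero hnr hr.ne'))
    refine d.congr_deriv ?_
    simp only [id, Pi.mul_apply, Pi.sub_apply, Pi.div_apply, Pi.pow_apply]
    field_simp
    ring
  refine setIntegral_Ioi_le_of_deriv_le (h₁.const_mul μ) h₂ hP ?_ ?_ ?_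
  · intro r hr
    have hnr := (hp.pos r hr)
    have hS : 0 ≤ n r * r * (a' r + b' r - μ * b' r / n r) ^ 2
        + μ * ((-a r * n r * r - (2 - r * (μ * r - m r / r)) * b' r) ^ 2 / (n r * r)
          + μ * r * b' r ^ 2 / n r) := by positivity
    refine le_of_sub_nonneg (hS.trans_eq ?_)
    push_cast
    field_simp
    ring
  · have hlim := ((((hr.mul hb').const_mul (2 * μ)).mul ha).add
      ((((hr.pow 2).const_mul μ).sub ((hr.pow 2).mul hρ)).const_sub 2 |>.mul (hb'.pow 2) |>.div hn
        hn₀.ne' |>.const_mul μ))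
    simp only [mul_zero, zero_mul, ne_eq, OfNat.ofNat_ne_zero, not_false_eq_true, zero_pow,
      sub_zero,
      zero_div, add_zero, Pi.div_def] at hlim
    refine hlim.congr' ?_
    filter_upwards [self_mem_nhdsWithin] with r hr
    have hr : 0 < r := hr
    have hnr := (hp.pos r hr).ne'
    field_simp
  · refine tendsto_const_nhds.congr' ?_
    filter_upwards [eventually_gt_atTop R] with r hr
    have := hbR r hr
    have h0 : r * b' r = 0 := by simpa using this
    rw [h0]; simp

/-- The non-radial modes. The difference of the two integrands is a sum of squares plus the
derivative of a quadratic form in `a`, `b`, `b'` that vanishes at the origin and at infinity. The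
coefficient of the last square is nonnegative because of the bound `m ≤ μ r²`, i.e. `V' ≥ 0`. All
squares vanish at the optimal mode `k = 1`, `a = m / r - μ r`, `b = -m / r`. -/
lemma AngularMode.spectral_gap_pos (hp : RadialProfile μ n m) (hk : k ≠ 0)
    (h : AngularMode n k a a' b b')
    (h₁ : IntegrableOn (fun r => a r ^ 2 * (n r * r) + (r * b' r ^ 2 + k ^ 2 * b r ^ 2 / r))
      (Ioi 0))
    (h₂ : IntegrableOn (fun r => n r * (r * (a' r + b' r) ^ 2
      + k ^ 2 * (a r + b r) ^ 2 / r)) (Ioi 0)) :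
    μ * ∫ r in Ioi 0, (a r ^ 2 * (n r * r) + (r * b' r ^ 2 + k ^ 2 * b r ^ 2 / r)) ≤
      ∫ r in Ioi 0, n r * (r * (a' r + b' r) ^ 2 + k ^ 2 * (a r + b r) ^ 2 / r) := by
  rw [← integral_const_mul]
  obtain ⟨R, hR, haR, hbR⟩ := h.exterior
  obtain ⟨n₀, hn₀, hn⟩ := hp.limit
  obtain ⟨ρ₀, hρ₀, hρ⟩ := hp.limit_mass
  obtain ⟨a₀, ha, ha₀⟩ := h.limit_density
  obtain ⟨b₀, hb, hb₀⟩ := h.limit_potential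
  obtain ⟨b₁, hb', -⟩ := h.limit_deriv
  have hr : Tendsto (fun r : ℝ => r) (𝓝[>] 0) (𝓝 0) := tendsto_id.mono_left nhdsWithin_le_nhds
  obtain rfl := hb₀ hk
  obtain rfl := ha₀ hk
  have hk1 : (1 : ℝ) ≤ k := by exact_mod_cast Nat.one_le_iff_ne_zero.2 hk
  -- `q` vanishes at the optimal mode, where `k = 1` and `b = -m / r`
  set q : ℝ → ℝ := fun r => m r * (b' r + k * b r / r) - n r * r * b r with hq
  set q' : ℝ → ℝ := fun r => n r * r * (b' r + k * b r / r)
    + m r * (-b' r / r + k ^ 2 * b r / r ^ 2 - n r * a r + (k * b' r * r - k * b r) / r ^ 2)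
    - ((-(μ * r - m r / r) * n r * r + n r) * b r + n r * r * b' r) with hq'
  have dq : ∀ r, 0 < r → HasDerivAt q (q' r) r := by
    intro r hr
    have d := ((hp.hasDerivAt_mass r hr).mul ((h.poisson r hr).add
      (((h.hasDerivAt_potential r hr).const_mul (k : ℝ)).div (hasDerivAt_id r) hr.ne'))).sub
      (((hp.hasDerivAt r hr).mul (hasDerivAt_id r)).mul (h.hasDerivAt_potential r hr))
    refine d.congr_deriv ?_
    simp only [id, Pi.mul_apply, Pi.div_apply, Pi.add_apply, hq']
    field_simp
  have hP : ∀ r, 0 < r → HasDerivAt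
      (fun r => n r * (a r + b r) ^ 2 + 2 * (q r * (a r + b r) / r)
        - 2 * μ * (r * q r * b r / m r) + k * μ * b r ^ 2 - μ * (n r * r ^ 2 * b r ^ 2 / m r)
        - (μ * r - m r / r) * q r ^ 2 / (n r * r * m r))
      (-(μ * r - m r / r) * n r * (a r + b r) ^ 2 + n r * (2 * (a r + b r) * (a' r + b' r))
        + 2 * (((q' r * (a r + b r) + q r * (a' r + b' r)) * r - q r * (a r + b r)) / r ^ 2)
        - 2 * μ * ((((q r + r * q' r) * b r + r * q r * b' r) * m r - r * q r * b r * (n r * r))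
          / m r ^ 2)
        + k * μ * (2 * b r * b' r)
        - μ * ((((-(μ * r - m r / r) * n r * r ^ 2 + n r * (2 * r)) * b r ^ 2
            + n r * r ^ 2 * (2 * b r * b' r)) * m r - n r * r ^ 2 * b r ^ 2 * (n r * r))
            / m r ^ 2)
        - (((μ - (n r * r * r - m r) / r ^ 2) * q r ^ 2 + (μ * r - m r / r) * (2 * q r * q' r))
            * (n r * r * m r)
          - (μ * r - m r / r) * q r ^ 2 * ((-(μ * r - m r / r) * n r * r + n r) * m r
            + n r * r * (n r * r))) / (n r * r * m r) ^ 2) r := by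
    intro r hr
    have hnr := (hp.pos r hr).ne'
    have hmr := (hp.mass_pos r hr).ne'
    have dr := hasDerivAt_id r
    have dn := hp.hasDerivAt r hr
    have dm := hp.hasDerivAt_mass r hr
    have db := h.hasDerivAt_potential r hr
    have dg := (h.hasDerivAt_density r hr).add db
    have dV := (dr.const_mul μ).sub (dm.div dr hr.ne')
    have d := (((((dn.mul (dg.pow 2)).add ((((dq r hr).mul dg).div dr hr.ne').const_mul 2)).sub
      ((((dr.mul (dq r hr)).mul db).div dm hmr).const_mul (2 * μ))).add
      ((db.pow 2).const_mul (k * μ))).sub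
      ((((dn.mul (dr.pow 2)).mul (db.pow 2)).div dm hmr).const_mul μ)).sub
      ((dV.mul ((dq r hr).pow 2)).div ((dn.mul dr).mul dm)
        (mul_ne_zero (mul_ne_zero hnr hr.ne') hmr))
    refine d.congr_deriv ?_
    simp only [id, Pi.mul_apply, Pi.sub_apply, Pi.div_apply, Pi.pow_apply, Pi.add_apply]
    push_cast
    ring
  refine setIntegral_Ioi_le_of_deriv_le (h₁.const_mul μ) h₂ hP ?_ ?_ ?_
  · intro r hr
    have hnr := hp.pos r hr
    have hmr := hp.mass_pos r hr
    have hV : 0 ≤ μ * r ^ 2 - m r := sub_nonneg.2 (hp.mass_le r hr)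
    have hk0 : (0 : ℝ) ≤ k - 1 := by linarith
    have hS : 0 ≤ r ^ 3 * n r * ((a' r + b' r) / r - (a r + b r) / r ^ 2 - q r / (r ^ 3 * n r)) ^ 2
        + (k - 1) / ((k + 1) * n r * r) *
          ((k + 1) * n r * (a r + b r) - q r / r - 2 * n r * b r) ^ 2
        + (q' r - (k - 1) * q r / r - 2 * (k - 1) * n r * b r + (μ * r - m r / r) * q r) ^ 2
          / (n r * r * m r)
        + (2 / (k + 1) * (q r / r - (k - 1) * n r * b r) ^ 2
          + 2 * ((μ * r ^ 2 - m r) / m r) * (k - 1) * (q r / r + n r * b r) ^ 2) / (n r * r) := by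
      have : (0 : ℝ) < k + 1 := by linarith
      positivity
    refine le_of_sub_nonneg (hS.trans_eq ?_)
    have : (k : ℝ) + 1 ≠ 0 := by positivity
    simp only [hq, hq']
    field_simp
    ring
  · have hqr : Tendsto (fun r => m r / r ^ 2 * (r * b' r + k * b r) - n r * b r)
        (𝓝[>] 0) (𝓝 0) := by
      simpa using (hρ.mul ((hr.mul hb').add (hb.const_mul (k : ℝ)))).sub (hn.mul hb)
    have hg := ha.add hb
    have hlim := (((((hn.mul (hg.pow 2)).add ((hqr.mul hg).const_mul 2)).sub
      (((hqr.mul hb).div hρ hρ₀.ne').const_mul (2 * μ))).add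
      ((hb.pow 2).const_mul (k * μ))).sub
      (((hn.mul (hb.pow 2)).div hρ hρ₀.ne').const_mul μ)).sub
      ((((hρ.const_sub μ).mul (hqr.pow 2)).div (hn.mul hρ)
        (mul_ne_zero hn₀.ne' hρ₀.ne')))
    simp only [mul_zero, ne_eq, OfNat.ofNat_ne_zero, not_false_eq_true, zero_pow, sub_zero,
      zero_div, add_zero, Pi.div_def] at hlim
    refine hlim.congr' ?_
    filter_upwards [self_mem_nhdsWithin] with r hr
    have hr : 0 < r := hr
    have hnr := (hp.pos r hr).ne'
    have hmr := (hp.mass_pos r hr).ne'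
    simp only [hq]
    field_simp
  · -- outside the support, the boundary form reduces to `k μ b²`, where `b = C r⁻ᵏ`
    have hbk : ∀ r, R < r → HasDerivAt (fun r => r ^ k * b r) 0 r := by
      intro r hr
      have hr0 := hR.trans hr
      refine ((hasDerivAt_pow k r).mul (h.hasDerivAt_potential r hr0)).congr_deriv ?_
      have h1 := hbR r hr
      obtain ⟨j, rfl⟩ := Nat.exists_eq_succ_of_ne_zero hk
      simp only [Nat.succ_eq_add_one, Nat.add_sub_cancel] at h1 ⊢
      linear_combination r ^ j * h1
    have hconst : ∀ r, R < r → r ^ k * b r = (R + 1) ^ k * b (R + 1) := by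
      intro r hr
      exact IsOpen.is_const_of_deriv_eq_zero (s := Ioi R) isOpen_Ioi isPreconnected_Ioi
        (fun x hx => (hbk x hx).differentiableAt.differentiableWithinAt)
        (fun x hx => (hbk x hx).deriv) hr (mem_Ioi.2 (by linarith))
    have hlim : Tendsto (fun r : ℝ => k * μ * ((R + 1) ^ k * b (R + 1) / r ^ k) ^ 2) atTop
        (𝓝 (k * μ * 0 ^ 2)) :=
      ((tendsto_const_nhds.div_atTop (tendsto_pow_atTop hk)).pow 2).const_mul _
    rw [zero_pow two_ne_zero, mul_zero] at hlim
    refine hlim.congr' ?_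
    filter_upwards [eventually_gt_atTop R] with r hr
    have hr0 := hR.trans hr
    have hnr := (hp.pos r hr0).ne'
    have hmr := (hp.mass_pos r hr0).ne'
    rw [← hconst r hr, mul_div_cancel_left₀ _ (pow_ne_zero k hr0.ne')]
    have hb'r : b' r = -(k * b r) / r := by
      field_simp
      linarith [hbR r hr]
    have hqr : q r = -(n r * r * b r) := by
      simp only [hq]; rw [hb'r]; field_simp; ring
    rw [hqr, haR r hr]
    field_simp
    ring

/-- The spectral gap inequality for a single angular mode. -/
lemma AngularMode.spectral_gap (hμ : 0 < μ) (hp : RadialProfile μ n m)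
    (h : AngularMode n k a a' b b')
    (h₁ : IntegrableOn (fun r => a r ^ 2 * (n r * r) + (r * b' r ^ 2 + k ^ 2 * b r ^ 2 / r))
      (Ioi 0))
    (h₂ : IntegrableOn (fun r => n r * (r * (a' r + b' r) ^ 2
      + k ^ 2 * (a r + b r) ^ 2 / r)) (Ioi 0)) :
    μ * ∫ r in Ioi 0, (a r ^ 2 * (n r * r) + (r * b' r ^ 2 + k ^ 2 * b r ^ 2 / r)) ≤
      ∫ r in Ioi 0, n r * (r * (a' r + b' r) ^ 2 + k ^ 2 * (a r + b r) ^ 2 / r) := by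
  rcases eq_or_ne k 0 with rfl | hk
  · exact h.spectral_gap_zero hμ hp h₁ h₂
  · exact h.spectral_gap_pos hp hk h₁ h₂

end

/-! ### The Green function and its gradient -/

section

/-- The gradient `-(1 / 2π) x / |x|²` of the Green function. -/
noncomputable def greenGrad (x : Plane) : Plane := (-(1 / (2 * Real.pi)) * (‖x‖ ^ 2)⁻¹) • x

lemma one_div_two_pi_le_one : 1 / (2 * Real.pi) ≤ 1 := by
  rw [div_le_one (by positivity)]
  linarith [Real.two_le_pi]

lemma norm_greenGrad_le (x : Plane) : ‖greenGrad x‖ ≤ ‖x‖⁻¹ := by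
  rcases eq_or_ne x 0 with rfl | hx
  · simp [greenGrad]
  have hx' : 0 < ‖x‖ := norm_pos_iff.2 hx
  rw [greenGrad, norm_smul, norm_mul, norm_neg, Real.norm_of_nonneg (by positivity),
    Real.norm_of_nonneg (by positivity)]
  calc 1 / (2 * Real.pi) * (‖x‖ ^ 2)⁻¹ * ‖x‖ = 1 / (2 * Real.pi) * ‖x‖⁻¹ := by field_simp
    _ ≤ 1 * ‖x‖⁻¹ := by gcongr; exact one_div_two_pi_le_one
    _ = _ := one_mul _

lemma abs_log_le_add_inv {t : ℝ} (ht : 0 ≤ t) : |Real.log t| ≤ t + t⁻¹ := by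
  rcases ht.eq_or_lt with rfl | ht
  · simp
  · have h1 := Real.log_le_sub_one_of_pos ht
    have h2 := Real.log_le_sub_one_of_pos (inv_pos.2 ht)
    rw [Real.log_inv] at h2
    have := inv_pos.2 ht
    rw [abs_le]
    constructor <;> linarith

lemma abs_green_le (x : Plane) : |green x| ≤ ‖x‖ + ‖x‖⁻¹ := by
  rw [green, abs_mul, abs_neg, abs_of_nonneg (by positivity : 0 ≤ 1 / (2 * Real.pi))]
  calc _ ≤ 1 * |Real.log ‖x‖| := by gcongr; exact one_div_two_pi_le_one
    _ ≤ _ := by rw [one_mul]; exact abs_log_le_add_inv (norm_nonneg _)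

@[fun_prop]
lemma measurable_green : Measurable green := by unfold green; fun_prop

@[fun_prop]
lemma measurable_greenGrad : Measurable greenGrad := by unfold greenGrad; fun_prop

lemma integrableOn_inv_norm_ball (r : ℝ) :
    IntegrableOn (fun x : Plane => ‖x‖⁻¹) (Metric.ball 0 r) := by
  rw [integrableOn_fun_norm_addHaar volume (f := fun t : ℝ => t⁻¹)]
  have : IntegrableOn (fun _ : ℝ => (1 : ℝ)) (Ioo 0 r) := by simp
  refine this.congr_fun (fun y hy => ?_) measurableSet_Ioo
  have : y ≠ 0 := hy.1.ne'
  simp [this]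

lemma integrable_one_add_norm_pow : Integrable fun x : Plane => ((1 + ‖x‖)⁻¹) ^ 3 := by
  have := integrable_one_add_norm (E := Plane) (μ := volume) (r := 3) (by simp; norm_num)
  refine this.congr (Eventually.of_forall fun x => ?_)
  simp only
  rw [Real.rpow_neg (by positivity), inv_pow]
  norm_cast

lemma japanese_div_le (y z : Plane) : (1 + ‖y‖ ^ 2)⁻¹ * ‖z‖⁻¹ ≤
    (Metric.ball (0 : Plane) 1).indicator (fun z => ‖z‖⁻¹) z
      + (4 * ((1 + ‖y‖)⁻¹) ^ 3 + 4 * ((1 + ‖z‖)⁻¹) ^ 3) := by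
  have hy := norm_nonneg y
  have h1 : (1 + ‖y‖ ^ 2)⁻¹ ≤ 1 := inv_le_one_of_one_le₀ (by nlinarith)
  by_cases hz : z ∈ Metric.ball (0 : Plane) 1
  · rw [indicator_of_mem hz]
    have := mul_le_mul_of_nonneg_right h1 (inv_nonneg.2 (norm_nonneg z))
    have : (0 : ℝ) ≤ 4 * ((1 + ‖y‖)⁻¹) ^ 3 + 4 * ((1 + ‖z‖)⁻¹) ^ 3 := by positivity
    linarith
  · rw [indicator_of_notMem hz, zero_add]
    have hz1 : 1 ≤ ‖z‖ := by simpa using hz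
    set p := (1 + ‖y‖)⁻¹ with hp
    set q := (1 + ‖z‖)⁻¹ with hq
    have hp0 : 0 ≤ p := by positivity
    have hq0 : 0 ≤ q := by positivity
    have h2 : (1 + ‖y‖ ^ 2)⁻¹ ≤ 2 * p ^ 2 := by
      rw [hp, inv_pow, ← div_eq_mul_inv, le_div_iff₀ (by positivity),
        inv_mul_le_iff₀ (by positivity)]
      nlinarith [sq_nonneg (‖y‖ - 1)]
    have h3 : ‖z‖⁻¹ ≤ 2 * q := by
      rw [hq, ← div_eq_mul_inv, le_div_iff₀ (by positivity), inv_mul_le_iff₀ (by positivity)]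
      linarith
    have h4 : (1 + ‖y‖ ^ 2)⁻¹ * ‖z‖⁻¹ ≤ 2 * p ^ 2 * (2 * q) := by gcongr
    have h5 : p ^ 2 * q ≤ p ^ 3 + q ^ 3 := by
      rcases le_total p q with h | h
      · nlinarith [mul_le_mul_of_nonneg_right (pow_le_pow_left₀ hp0 h 2) hq0, pow_nonneg hp0 3]
      · nlinarith [mul_le_mul_of_nonneg_left h (pow_nonneg hp0 2), pow_nonneg hq0 3]
    linarith

lemma integrable_japanese_dominator (x : Plane) : Integrable fun y : Plane =>
    (Metric.ball (0 : Plane) 1).indicator (fun z => ‖z‖⁻¹) (x - y)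
      + (4 * ((1 + ‖y‖)⁻¹) ^ 3 + 4 * ((1 + ‖x - y‖)⁻¹) ^ 3) := by
  have h1 : Integrable ((Metric.ball (0 : Plane) 1).indicator fun z : Plane => ‖z‖⁻¹) :=
    (integrable_indicator_iff measurableSet_ball).2 (integrableOn_inv_norm_ball 1)
  exact (h1.comp_sub_left x).add ((integrable_one_add_norm_pow.const_mul 4).add
    ((integrable_one_add_norm_pow.const_mul 4).comp_sub_left x))

lemma integrable_japanese_div (x : Plane) :
    Integrable fun y : Plane => (1 + ‖y‖ ^ 2)⁻¹ * ‖x - y‖⁻¹ := by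
  refine (integrable_japanese_dominator x).mono' (by fun_prop) (Eventually.of_forall fun y => ?_)
  rw [Real.norm_of_nonneg (by positivity)]
  exact japanese_div_le y (x - y)

/-- The kernel `1 / |x - y|` is uniformly integrable against the weight `1 / (1 + |y|²)`. -/
lemma exists_integral_japanese_div_le :
    ∃ C : ℝ, 0 < C ∧ ∀ x : Plane, ∫ y : Plane, (1 + ‖y‖ ^ 2)⁻¹ * ‖x - y‖⁻¹ ≤ C := by
  have h1 : Integrable ((Metric.ball (0 : Plane) 1).indicator fun z : Plane => ‖z‖⁻¹) :=
    (integrable_indicator_iff measurableSet_ball).2 (integrableOn_inv_norm_ball 1)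
  have h3 := integrable_one_add_norm_pow
  set I := ∫ y, (Metric.ball (0 : Plane) 1).indicator (fun z : Plane => ‖z‖⁻¹) y
  set J := ∫ y : Plane, 4 * ((1 + ‖y‖)⁻¹) ^ 3
  have hI : 0 ≤ I := integral_nonneg fun z => indicator_nonneg (fun z _ => by positivity) z
  have hJ : 0 ≤ J := integral_nonneg fun z => by positivity
  refine ⟨I + (J + J) + 1, by positivity, fun x => ?_⟩
  refine (integral_mono (integrable_japanese_div x) (integrable_japanese_dominator x)
    fun y => japanese_div_le y (x - y)).trans ?_
  have h4 : Integrable fun y : Plane => 4 * ((1 + ‖y‖)⁻¹) ^ 3 + 4 * ((1 + ‖x - y‖)⁻¹) ^ 3 :=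
    (h3.const_mul 4).add ((h3.const_mul 4).comp_sub_left x)
  rw [integral_add (h1.comp_sub_left x) h4,
    integral_add (h3.const_mul 4) ((h3.const_mul 4).comp_sub_left x),
    integral_sub_left_eq_self (fun y => (Metric.ball (0 : Plane) 1).indicator
      (fun z : Plane => ‖z‖⁻¹) y) volume x,
    integral_sub_left_eq_self (fun y : Plane => 4 * ((1 + ‖y‖)⁻¹) ^ 3) volume x]
  linarith

/-- Subtracting the monopole `x / (1 + |x|²)` from the kernel of the field gains one power of
decay. -/
lemma norm_greenGrad_sub_le {x y : Plane} (hxy : x ≠ y) :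
    ‖greenGrad (x - y) - (-(1 / (2 * Real.pi)) * (1 + ‖x‖ ^ 2)⁻¹) • x‖ ^ 2 ≤
      (1 + ‖y‖ ^ 2) * (1 + ‖x‖ ^ 2)⁻¹ * (‖x - y‖⁻¹) ^ 2 := by
  have hz : 0 < ‖x - y‖ := norm_pos_iff.2 (sub_ne_zero.2 hxy)
  have h1 : greenGrad (x - y) - (-(1 / (2 * Real.pi)) * (1 + ‖x‖ ^ 2)⁻¹) • x =
      (-(1 / (2 * Real.pi))) • ((‖x - y‖ ^ 2)⁻¹ • (x - y) - (1 + ‖x‖ ^ 2)⁻¹ • x) := by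
    rw [greenGrad, mul_smul, mul_smul, ← smul_sub]
  have h2 : ‖(‖x - y‖ ^ 2)⁻¹ • (x - y) - (1 + ‖x‖ ^ 2)⁻¹ • x‖ ^ 2 =
      ((1 + ‖x‖ ^ 2) * (1 + ‖y‖ ^ 2) - ‖x - y‖ ^ 2) / (‖x - y‖ ^ 2 * (1 + ‖x‖ ^ 2) ^ 2) := by
    have h3 : ‖y‖ ^ 2 = ‖x‖ ^ 2 - 2 * inner ℝ (x - y) x + ‖x - y‖ ^ 2 := by
      have : y = x - (x - y) := by abel
      conv_lhs => rw [this, norm_sub_sq_real, real_inner_comm]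
    rw [norm_sub_sq_real, norm_smul, norm_smul, real_inner_smul_left, real_inner_smul_right, h3,
      Real.norm_of_nonneg (by positivity), Real.norm_of_nonneg (by positivity)]
    field_simp
    ring
  rw [h1, norm_smul, mul_pow, h2, norm_neg, Real.norm_of_nonneg (by positivity)]
  have h4 : (1 / (2 * Real.pi)) ^ 2 ≤ 1 := pow_le_one₀ (by positivity) one_div_two_pi_le_one
  calc _ ≤ 1 * ((1 + ‖x‖ ^ 2) * (1 + ‖y‖ ^ 2) / (‖x - y‖ ^ 2 * (1 + ‖x‖ ^ 2) ^ 2)) := by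
        rw [← h2]
        gcongr
        rw [h2]
        gcongr
        linarith [sq_nonneg ‖x - y‖]
    _ = _ := by field_simp

/-- Kernels with at most a `1 / |x|` singularity are locally integrable in the plane. -/
lemma locallyIntegrable_of_norm_le {E : Type*} [NormedAddCommGroup E] {f : Plane → E}
    (hf : AEStronglyMeasurable f) (h : ∀ x, ‖f x‖ ≤ ‖x‖ + ‖x‖⁻¹) : LocallyIntegrable f := by
  rw [locallyIntegrable_iff]
  intro K hK
  obtain ⟨r, hr⟩ := hK.isBounded.subset_ball 0
  have hb : IntegrableOn (fun x : Plane => ‖x‖ + ‖x‖⁻¹) (Metric.ball 0 r) :=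
    ((continuous_norm.locallyIntegrable.integrableOn_isCompact
      (isCompact_closedBall (0 : Plane) r)).mono_set Metric.ball_subset_closedBall).add
      (integrableOn_inv_norm_ball r)
  have hI : IntegrableOn f (Metric.ball 0 r) := hb.mono' hf.restrict (Eventually.of_forall h)
  exact hI.mono_set hr

lemma locallyIntegrable_green : LocallyIntegrable green :=
  locallyIntegrable_of_norm_le measurable_green.aestronglyMeasurable abs_green_le

/-- The regularization `-(1 / 4π) log (|x|² + ε)` of the Green function. -/
noncomputable def greenReg (ε : ℝ) (x : Plane) : ℝ :=
  -(1 / (2 * Real.pi)) * (Real.log (‖x‖ ^ 2 + ε) / 2)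

lemma hasFDerivAt_greenReg {ε : ℝ} (hε : 0 < ε) (x : Plane) :
    HasFDerivAt (greenReg ε)
      ((-(1 / (2 * Real.pi)) * (‖x‖ ^ 2 + ε)⁻¹) • innerSL ℝ x) x := by
  have h1 : HasFDerivAt (fun x : Plane => ‖x‖ ^ 2 + ε) (2 • innerSL ℝ x) x :=
    (hasStrictFDerivAt_norm_sq x).hasFDerivAt.add_const ε
  have h2 := ((h1.log (by positivity)).mul_const (2 : ℝ)⁻¹).const_mul (-(1 / (2 * Real.pi)))
  refine h2.congr_fderiv ?_
  ext v
  simp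
  ring

lemma abs_greenReg_le {ε : ℝ} (hε : 0 < ε) (hε1 : ε ≤ 1) {x : Plane} (hx : x ≠ 0) :
    |greenReg ε x| ≤ ‖x‖ ^ 2 + 1 + ‖x‖⁻¹ := by
  have hx' : 0 < ‖x‖ := norm_pos_iff.2 hx
  rw [greenReg, abs_mul, abs_neg, abs_of_nonneg (by positivity : 0 ≤ 1 / (2 * Real.pi))]
  have h1 : Real.log (‖x‖ ^ 2 + ε) ≤ ‖x‖ ^ 2 + ε - 1 := Real.log_le_sub_one_of_pos (by positivity)
  have h2 : Real.log (‖x‖ ^ 2) ≤ Real.log (‖x‖ ^ 2 + ε) :=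
    Real.log_le_log (by positivity) (by linarith)
  have h3 := Real.log_le_sub_one_of_pos (inv_pos.2 hx')
  rw [Real.log_inv] at h3
  rw [Real.log_pow] at h2
  push_cast at h2
  have h4 : |Real.log (‖x‖ ^ 2 + ε) / 2| ≤ ‖x‖ ^ 2 + 1 + ‖x‖⁻¹ := by
    have := inv_pos.2 hx'
    have := sq_nonneg ‖x‖
    rw [abs_le]
    constructor <;> linarith
  calc _ ≤ 1 * |Real.log (‖x‖ ^ 2 + ε) / 2| := by gcongr; exact one_div_two_pi_le_one
    _ ≤ _ := by rw [one_mul]; exact h4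

/-- The distributional gradient of the Green function is `greenGrad`. -/
lemma integral_green_mul_fderiv {η : Plane → ℝ} (hη : ContDiff ℝ 1 η) (hc : HasCompactSupport η)
    (v : Plane) :
    ∫ x, green x * fderiv ℝ η x v = -∫ x, inner ℝ (greenGrad x) v * η x := by
  have hη' : Continuous fun x => fderiv ℝ η x v := (hη.continuous_fderiv one_ne_zero).clm_apply
    continuous_const
  have hc' : HasCompactSupport fun x => fderiv ℝ η x v := by
    have := hc.fderiv (𝕜 := ℝ)
    exact this.comp_left (g := fun L : Plane →L[ℝ] ℝ => L v) (by simp)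
  set ε : ℕ → ℝ := fun k => 1 / ((k : ℝ) + 1) with hε
  have hεpos : ∀ k, 0 < ε k := fun k => by positivity
  have hε1 : ∀ k, ε k ≤ 1 := fun k => by
    rw [hε]; simp only; rw [div_le_one (by positivity)]; linarith [k.cast_nonneg (α := ℝ)]
  have hε0 : Tendsto ε atTop (𝓝 0) := tendsto_one_div_add_atTop_nhds_zero_nat
  have hne : ∀ᵐ x : Plane, x ≠ 0 := by simp [ae_iff]
  have hcontReg : ∀ k, Continuous (greenReg (ε k)) := fun k =>
    continuous_iff_continuousAt.2 fun x => (hasFDerivAt_greenReg (hεpos k) x).continuousAt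
  have hcontD : ∀ k, Continuous fun x : Plane =>
      (-(1 / (2 * Real.pi)) * (‖x‖ ^ 2 + ε k)⁻¹) * inner ℝ x v := fun k => by
    have : ∀ x : Plane, ‖x‖ ^ 2 + ε k ≠ 0 := fun x => by have := hεpos k; positivity
    fun_prop (disch := exact this _)
  have hstep : ∀ k, ∫ x, greenReg (ε k) x * fderiv ℝ η x v =
      -∫ x, (-(1 / (2 * Real.pi)) * (‖x‖ ^ 2 + ε k)⁻¹ * inner ℝ x v) * η x := by
    intro k
    have hf : ∀ x, fderiv ℝ (greenReg (ε k)) x v =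
        -(1 / (2 * Real.pi)) * (‖x‖ ^ 2 + ε k)⁻¹ * inner ℝ x v := fun x => by
      rw [(hasFDerivAt_greenReg (hεpos k) x).fderiv]; simp
    rw [integral_mul_fderiv_eq_neg_fderiv_mul_of_integrable]
    · simp_rw [hf]
    · simp_rw [hf]
      exact ((hcontD k).mul hη.continuous).integrable_of_hasCompactSupport hc.mul_left
    · exact ((hcontReg k).mul hη').integrable_of_hasCompactSupport hc'.mul_left
    · exact ((hcontReg k).mul hη.continuous).integrable_of_hasCompactSupport hc.mul_left
    · exact fun x _ => (hasFDerivAt_greenReg (hεpos k) x).differentiableAt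
    · exact fun x _ => (hη.differentiable one_ne_zero) x
  have hlim1 : Tendsto (fun k => ∫ x, greenReg (ε k) x * fderiv ℝ η x v) atTop
      (𝓝 (∫ x, green x * fderiv ℝ η x v)) := by
    have hloc : LocallyIntegrable fun x : Plane => (‖x‖ ^ 2 + 1) + ‖x‖⁻¹ := by
      refine (Continuous.locallyIntegrable (by fun_prop)).add ?_
      exact locallyIntegrable_of_norm_le (by fun_prop) fun x => by simp
    refine tendsto_integral_of_dominated_convergence
      (fun x => ‖fderiv ℝ η x v • (‖x‖ ^ 2 + 1 + ‖x‖⁻¹)‖)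
      (fun k => ((hcontReg k).mul hη').aestronglyMeasurable)
      (hloc.integrable_smul_left_of_hasCompactSupport hη' hc').norm (fun k => ?_) ?_
    · filter_upwards [hne] with x hx
      rw [norm_mul, norm_smul, mul_comm]
      gcongr
      exact (abs_greenReg_le (hεpos k) (hε1 k) hx).trans (le_abs_self _)
    · filter_upwards [hne] with x hx
      have hx' : 0 < ‖x‖ := norm_pos_iff.2 hx
      have h1 : Tendsto (fun k => greenReg (ε k) x) atTop (𝓝 (greenReg 0 x)) := by
        have : ‖x‖ ^ 2 + 0 ≠ 0 := by positivity
        exact (((tendsto_const_nhds.add hε0).log this).div_const 2).const_mul _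
      have h2 : greenReg 0 x = green x := by
        simp [greenReg, green, Real.log_pow]
      rw [h2] at h1
      exact h1.mul_const _
  have hlim2 : Tendsto (fun k => ∫ x,
    (-(1 / (2 * Real.pi)) * (‖x‖ ^ 2 + ε k)⁻¹ * inner ℝ x v) * η x)
      atTop (𝓝 (∫ x, inner ℝ (greenGrad x) v * η x)) := by
    have hloc : LocallyIntegrable fun x : Plane => ‖x‖⁻¹ * ‖v‖ := by
      have : LocallyIntegrable fun x : Plane => ‖v‖ • ‖x‖⁻¹ :=
        (locallyIntegrable_of_norm_le (by fun_prop) fun x => by simp).smul ‖v‖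
      refine this.congr (Eventually.of_forall fun x => ?_)
      simp [mul_comm]
    refine tendsto_integral_of_dominated_convergence (fun x => ‖η x • (‖x‖⁻¹ * ‖v‖)‖)
      (fun k => ((hcontD k).mul hη.continuous).aestronglyMeasurable)
      (hloc.integrable_smul_left_of_hasCompactSupport hη.continuous hc).norm (fun k => ?_) ?_
    · filter_upwards [hne] with x hx
      have hx' : 0 < ‖x‖ := norm_pos_iff.2 hx
      rw [norm_mul, norm_smul, mul_comm]
      gcongr
      have hk := hεpos k
      have h1 : 0 ≤ 1 / (2 * Real.pi) := by positivity
      have h2 : 0 ≤ (‖x‖ ^ 2 + ε k)⁻¹ := by positivity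
      have h3 : 0 ≤ ‖x‖⁻¹ * ‖v‖ := by positivity
      rw [norm_mul, norm_mul, norm_neg, Real.norm_of_nonneg h1, Real.norm_of_nonneg h2,
        Real.norm_of_nonneg h3]
      calc _ ≤ 1 * (‖x‖ ^ 2)⁻¹ * (‖x‖ * ‖v‖) := by
            refine mul_le_mul (mul_le_mul one_div_two_pi_le_one ?_ h2 zero_le_one)
              (norm_inner_le_norm x v) (norm_nonneg _) (by positivity)
            exact inv_anti₀ (by positivity) (by linarith)
        _ = _ := by field_simp
    · filter_upwards [hne] with x hx
      have hx' : 0 < ‖x‖ := norm_pos_iff.2 hx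
      have : ‖x‖ ^ 2 + 0 ≠ 0 := by positivity
      have h1 := (((tendsto_const_nhds (x := ‖x‖ ^ 2)).add hε0).inv₀ this).const_mul
        (-(1 / (2 * Real.pi)))
      have h2 := (h1.mul_const (inner ℝ x v)).mul_const (η x)
      rw [add_zero] at h2
      rw [greenGrad, real_inner_smul_left]
      exact h2
  refine tendsto_nhds_unique hlim1 ?_
  simp_rw [hstep]
  exact hlim2.neg

end

/-! ### Weak gradients and the field of a density -/

section

lemma HasWeakGradient.of_forall_inner {u : Plane → ℝ} {v : Plane → Plane}
    (hu : LocallyIntegrable u) (hv : LocallyIntegrable v)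
    (h : ∀ η : Plane → ℝ, ContDiff ℝ ∞ η → HasCompactSupport η → ∀ e : Plane,
      ∫ x, u x * fderiv ℝ η x e = -∫ x, inner ℝ (v x) e * η x) : HasWeakGradient u v := by
  refine ⟨hu, hv, fun η hη hc => ?_⟩
  have hg : Continuous (gradient η) :=
    (InnerProductSpace.toDual ℝ Plane).symm.continuous.comp (hη.continuous_fderiv (by simp))
  have hgc : HasCompactSupport (gradient η) :=
    (hc.fderiv (𝕜 := ℝ)).comp_left (g := (InnerProductSpace.toDual ℝ Plane).symm) (by simp)
  have i1 : Integrable fun x => u x • gradient η x :=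
    hu.integrable_smul_right_of_hasCompactSupport hg hgc
  have i2 : Integrable fun x => η x • v x :=
    hv.integrable_smul_left_of_hasCompactSupport hη.continuous hc
  refine ext_inner_right ℝ fun e => ?_
  rw [real_inner_comm, ← integral_inner i1, real_inner_comm, inner_neg_right, ← integral_inner i2]
  refine Eq.trans (integral_congr_ae (Eventually.of_forall fun x => ?_)) ((h η hη hc e).trans ?_)
  · simp only [inner_smul_right]
    rw [real_inner_comm, gradient, InnerProductSpace.toDual_symm_apply]
  · congr 1
    refine integral_congr_ae (Eventually.of_forall fun x => ?_)
    simp only [inner_smul_right]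
    rw [real_inner_comm, mul_comm]

lemma HasWeakGradient.integral_fderiv {u : Plane → ℝ} {v : Plane → Plane}
    (h : HasWeakGradient u v) {η : Plane → ℝ} (hη : ContDiff ℝ ∞ η) (hc : HasCompactSupport η)
    (e : Plane) : ∫ x, u x * fderiv ℝ η x e = -∫ x, inner ℝ (v x) e * η x := by
  have hg : Continuous (gradient η) :=
    (InnerProductSpace.toDual ℝ Plane).symm.continuous.comp (hη.continuous_fderiv (by simp))
  have hgc : HasCompactSupport (gradient η) :=
    (hc.fderiv (𝕜 := ℝ)).comp_left (g := (InnerProductSpace.toDual ℝ Plane).symm) (by simp)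
  have i1 : Integrable fun x => u x • gradient η x :=
    h.locallyIntegrable.integrable_smul_right_of_hasCompactSupport hg hgc
  have i2 : Integrable fun x => η x • v x :=
    h.locallyIntegrable_grad.integrable_smul_left_of_hasCompactSupport hη.continuous hc
  have := congrArg (inner ℝ e) (h.integral_eq η hη hc)
  rw [inner_neg_right, ← integral_inner i1, ← integral_inner i2] at this
  refine Eq.trans (integral_congr_ae (Eventually.of_forall fun x => ?_)) (this.trans ?_)
  · simp only [inner_smul_right]
    rw [real_inner_comm, gradient, InnerProductSpace.toDual_symm_apply]
  · congr 1
    refine integral_congr_ae (Eventually.of_forall fun x => ?_)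
    simp only [inner_smul_right]
    rw [real_inner_comm, mul_comm]

lemma HasWeakGradient.ae_unique {u : Plane → ℝ} {v w : Plane → Plane}
    (hv : HasWeakGradient u v) (hw : HasWeakGradient u w) : v =ᵐ[volume] w := by
  refine ae_eq_of_integral_contDiff_smul_eq hv.locallyIntegrable_grad hw.locallyIntegrable_grad
    fun η hη hc => ?_
  rw [← neg_inj, ← hv.integral_eq η hη hc, ← hw.integral_eq η hη hc]

lemma hasWeakGradient_weakGradient {u : Plane → ℝ} (h : ∃ v, HasWeakGradient u v) :
    HasWeakGradient u (weakGradient u) := by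
  rw [weakGradient, dif_pos h]
  exact h.choose_spec

lemma HasWeakGradient.weakGradient_ae_eq {u : Plane → ℝ} {v : Plane → Plane}
    (h : HasWeakGradient u v) : weakGradient u =ᵐ[volume] v :=
  (hasWeakGradient_weakGradient ⟨v, h⟩).ae_unique h

lemma HasWeakGradient.congr_ae {u u' : Plane → ℝ} {v v' : Plane → Plane}
    (h : HasWeakGradient u v) (hu : u =ᵐ[volume] u') (hv : v =ᵐ[volume] v') :
    HasWeakGradient u' v' := by
  refine ⟨h.locallyIntegrable.congr hu, h.locallyIntegrable_grad.congr hv, fun η hη hc => ?_⟩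
  rw [← integral_congr_ae (hu.mono fun x hx => by simp only [hx] : (fun x => u x • gradient η x)
    =ᵐ[volume] fun x => u' x • gradient η x), h.integral_eq η hη hc]
  congr 1
  exact integral_congr_ae (hv.mono fun x hx => by simp only [hx])

lemma HasWeakGradient.add {u u' : Plane → ℝ} {v v' : Plane → Plane}
    (h : HasWeakGradient u v) (h' : HasWeakGradient u' v') :
    HasWeakGradient (fun x => u x + u' x) (fun x => v x + v' x) := by
  refine ⟨h.locallyIntegrable.add h'.locallyIntegrable,
    h.locallyIntegrable_grad.add h'.locallyIntegrable_grad, fun η hη hc => ?_⟩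
  have hg : Continuous (gradient η) :=
    (InnerProductSpace.toDual ℝ Plane).symm.continuous.comp (hη.continuous_fderiv (by simp))
  have hgc : HasCompactSupport (gradient η) :=
    (hc.fderiv (𝕜 := ℝ)).comp_left (g := (InnerProductSpace.toDual ℝ Plane).symm) (by simp)
  simp_rw [add_smul, smul_add]
  rw [integral_add (h.locallyIntegrable.integrable_smul_right_of_hasCompactSupport hg hgc)
    (h'.locallyIntegrable.integrable_smul_right_of_hasCompactSupport hg hgc),
    integral_add
      (h.locallyIntegrable_grad.integrable_smul_left_of_hasCompactSupport hη.continuous hc)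
      (h'.locallyIntegrable_grad.integrable_smul_left_of_hasCompactSupport hη.continuous hc),
    h.integral_eq η hη hc, h'.integral_eq η hη hc, neg_add]

lemma HasWeakGradient.const_mul {u : Plane → ℝ} {v : Plane → Plane} (c : ℝ)
    (h : HasWeakGradient u v) : HasWeakGradient (fun x => c * u x) (fun x => c • v x) := by
  refine ⟨h.locallyIntegrable.smul c, h.locallyIntegrable_grad.smul c, fun η hη hc => ?_⟩
  simp_rw [mul_smul, smul_comm _ c, integral_smul, h.integral_eq η hη hc, smul_neg]

lemma HasWeakGradient.sub {u u' : Plane → ℝ} {v v' : Plane → Plane}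
    (h : HasWeakGradient u v) (h' : HasWeakGradient u' v') :
    HasWeakGradient (fun x => u x - u' x) (fun x => v x - v' x) :=
  (h.add (h'.const_mul (-1))).congr_ae (Eventually.of_forall fun x => by ring)
    (Eventually.of_forall fun x => by simp [sub_eq_add_neg])

lemma inner_gradient_left (u : Plane → ℝ) (x e : Plane) :
    inner ℝ (gradient u x) e = fderiv ℝ u x e := by
  rw [gradient, InnerProductSpace.toDual_symm_apply]

lemma continuous_gradient {u : Plane → ℝ} (hu : ContDiff ℝ 1 u) : Continuous (gradient u) :=
  (InnerProductSpace.toDual ℝ Plane).symm.continuous.comp (hu.continuous_fderiv one_ne_zero)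

lemma hasWeakGradient_gradient {u : Plane → ℝ} (hu : ContDiff ℝ 1 u) :
    HasWeakGradient u (gradient u) := by
  refine .of_forall_inner hu.continuous.locallyIntegrable
    (continuous_gradient hu).locallyIntegrable fun η hη hc e => ?_
  simp_rw [inner_gradient_left]
  have hc' : HasCompactSupport fun x => fderiv ℝ η x e :=
    (hc.fderiv (𝕜 := ℝ)).comp_left (g := fun L : Plane →L[ℝ] ℝ => L e) (by simp)
  have hu' : Continuous fun x => fderiv ℝ u x e :=
    (hu.continuous_fderiv one_ne_zero).clm_apply continuous_const
  have hη' : Continuous fun x => fderiv ℝ η x e :=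
    (hη.continuous_fderiv (by simp)).clm_apply continuous_const
  exact integral_mul_fderiv_eq_neg_fderiv_mul_of_integrable
    ((hu'.mul hη.continuous).integrable_of_hasCompactSupport hc.mul_left)
    ((hu.continuous.mul hη').integrable_of_hasCompactSupport hc'.mul_left)
    ((hu.continuous.mul hη.continuous).integrable_of_hasCompactSupport hc.mul_left)
    (fun x _ => hu.differentiable one_ne_zero x) (fun x _ => hη.differentiable (by simp) x)

/-- The field `∇ (-Δ)⁻¹ ρ`, as the convolution of `ρ` with the gradient of the Green function. -/
noncomputable def field (ρ : Plane → ℝ) (x : Plane) : Plane := ∫ y, ρ y • greenGrad (x - y)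

/-- Fubini integrability for a logarithmic or `1 / |z|` kernel, a density with a finite first moment
and a rapidly decaying test function. -/
lemma integrable_prod_kernel {F : Type*} [NormedAddCommGroup F] [NormedSpace ℝ F]
    {g : Plane → F} (hg : StronglyMeasurable g)
    (hgb : ∀ z, ‖g z‖ ≤ ‖z‖ + ‖z‖⁻¹) {ρ h : Plane → ℝ} (hρ : Integrable fun y => (1 + ‖y‖) * ρ y)
    (hh : AEStronglyMeasurable h) {A : ℝ} (hA : ∀ x, |h x| ≤ A * ((1 + ‖x‖ ^ 2)⁻¹) ^ 2) :
    Integrable (fun p : Plane × Plane => (ρ p.2 * h p.1) • g (p.1 - p.2))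
      (volume.prod volume) := by
  have hρm : AEStronglyMeasurable ρ := by
    have := hρ.aestronglyMeasurable.mul
      (by fun_prop : AEStronglyMeasurable fun y : Plane => (1 + ‖y‖)⁻¹)
    refine this.congr (Eventually.of_forall fun y => ?_)
    have : (1 + ‖y‖) ≠ 0 := by positivity
    simp only [Pi.mul_apply]
    field_simp
  have hA0 : 0 ≤ A := by
    have := (abs_nonneg _).trans (hA 0)
    simpa using this
  have hmeas : AEStronglyMeasurable (fun p : Plane × Plane => (ρ p.2 * h p.1) • g (p.1 - p.2))
      (volume.prod volume) :=
    ((hρm.comp_snd).mul hh.comp_fst).smul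
      (hg.comp_measurable (measurable_fst.sub measurable_snd)).aestronglyMeasurable
  obtain ⟨C, hC, hCb⟩ := exists_integral_japanese_div_le
  -- the integral in `x` is bounded by a multiple of `1 + |y|`
  set J := ∫ x : Plane, ((1 + ‖x‖)⁻¹) ^ 3
  have hmajor : ∀ x y : Plane, |h x| * ‖g (x - y)‖ ≤
      A * ((1 + ‖y‖) * (4 * ((1 + ‖x‖)⁻¹) ^ 3) + (1 + ‖x‖ ^ 2)⁻¹ * ‖y - x‖⁻¹) := by
    intro x y
    have h1 : ‖g (x - y)‖ ≤ (‖x‖ + ‖y‖) + ‖y - x‖⁻¹ := by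
      rw [norm_sub_rev y x]
      exact (hgb _).trans (by gcongr; exact norm_sub_le _ _)
    have hx := norm_nonneg x
    have hy := norm_nonneg y
    set w := (1 + ‖x‖ ^ 2)⁻¹ with hw
    have hw0 : 0 ≤ w := by positivity
    have hw1 : w ≤ 1 := inv_le_one_of_one_le₀ (by nlinarith)
    have hw2 : w ≤ 2 * ((1 + ‖x‖)⁻¹) ^ 2 := by
      rw [hw, inv_pow, ← div_eq_mul_inv, le_div_iff₀ (by positivity),
        inv_mul_le_iff₀ (by positivity)]
      nlinarith [sq_nonneg (‖x‖ - 1)]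
    have hs : (1 + ‖x‖)⁻¹ * (1 + ‖x‖) = 1 := inv_mul_cancel₀ (by positivity)
    set s := (1 + ‖x‖)⁻¹
    have hs0 : 0 ≤ s := by positivity
    have h2 : w ^ 2 * (‖x‖ + ‖y‖) ≤ (1 + ‖y‖) * (4 * s ^ 3) := by
      have h3 : ‖x‖ + ‖y‖ ≤ (1 + ‖x‖) * (1 + ‖y‖) := by nlinarith
      calc w ^ 2 * (‖x‖ + ‖y‖) ≤ (2 * s ^ 2) ^ 2 * ((1 + ‖x‖) * (1 + ‖y‖)) := by gcongr
        _ = (1 + ‖y‖) * (4 * s ^ 3) * (s * (1 + ‖x‖)) := by ring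
        _ = _ := by rw [hs, mul_one]
    calc |h x| * ‖g (x - y)‖ ≤ (A * w ^ 2) * ((‖x‖ + ‖y‖) + ‖y - x‖⁻¹) := by
          gcongr
          exact hA x
      _ = A * (w ^ 2 * (‖x‖ + ‖y‖) + w * (w * ‖y - x‖⁻¹)) := by ring
      _ ≤ A * ((1 + ‖y‖) * (4 * s ^ 3) + 1 * (w * ‖y - x‖⁻¹)) := by gcongr
      _ = _ := by rw [one_mul]
  have hmint : ∀ y : Plane, Integrable fun x : Plane =>
      A * ((1 + ‖y‖) * (4 * ((1 + ‖x‖)⁻¹) ^ 3) + (1 + ‖x‖ ^ 2)⁻¹ * ‖y - x‖⁻¹) := fun y =>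
    (((integrable_one_add_norm_pow.const_mul 4).const_mul _).add
      (integrable_japanese_div y)).const_mul A
  have hint : ∀ y, Integrable fun x => |h x| * ‖g (x - y)‖ := fun y =>
    (hmint y).mono' (hh.norm.mul
      (hg.comp_measurable (measurable_id.sub_const y)).aestronglyMeasurable.norm)
      (Eventually.of_forall fun x => by
        rw [Real.norm_of_nonneg (by positivity)]; exact hmajor x y)
  have hbound : ∀ y, ∫ x, |h x| * ‖g (x - y)‖ ≤ A * (4 * J + C) * (1 + ‖y‖) := by
    intro y
    refine (integral_mono (hint y) (hmint y) fun x => hmajor x y).trans ?_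
    rw [integral_const_mul, integral_add
      ((integrable_one_add_norm_pow.const_mul 4).const_mul _) (integrable_japanese_div y),
      integral_const_mul, integral_const_mul]
    have := hCb y
    have hy := norm_nonneg y
    rw [mul_assoc]
    gcongr
    nlinarith
  rw [integrable_prod_iff' hmeas]
  constructor
  · refine Eventually.of_forall fun y => ?_
    have hm : AEStronglyMeasurable fun x => h x • g (x - y) :=
      hh.smul (hg.comp_measurable (measurable_id.sub_const y)).aestronglyMeasurable
    have : Integrable fun x => h x • g (x - y) := by
      refine (hint y).mono' hm (Eventually.of_forall fun x => ?_)
      rw [norm_smul, Real.norm_eq_abs]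
    simp_rw [mul_smul]
    exact this.smul (ρ y)
  · have h1 : ∀ y, ∫ x, ‖(ρ y * h x) • g (x - y)‖ = |ρ y| * ∫ x, |h x| * ‖g (x - y)‖ := fun y => by
      rw [← integral_const_mul]
      refine integral_congr_ae (Eventually.of_forall fun x => ?_)
      simp only [norm_smul, norm_mul, Real.norm_eq_abs]
      ring
    refine (hρ.norm.const_mul (A * (4 * J + C))).mono' ?_ (Eventually.of_forall fun y => ?_)
    · exact hmeas.prod_swap.norm.integral_prod_right'
    · dsimp only
      rw [h1, Real.norm_of_nonneg (by positivity), norm_mul, Real.norm_of_nonneg (by positivity),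
        Real.norm_eq_abs]
      calc |ρ y| * ∫ x, |h x| * ‖g (x - y)‖ ≤ |ρ y| * (A * (4 * J + C) * (1 + ‖y‖)) := by
            gcongr; exact hbound y
        _ = _ := by ring

lemma exists_le_japanese_of_hasCompactSupport {h : Plane → ℝ} (hc : Continuous h)
    (hs : HasCompactSupport h) (N : ℕ) : ∃ A, ∀ x, |h x| ≤ A * ((1 + ‖x‖ ^ 2)⁻¹) ^ N := by
  obtain ⟨A, hA⟩ :=
    (hs.mul_left (f := fun x : Plane => (1 + ‖x‖ ^ 2) ^ N)).exists_bound_of_continuous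
    (by fun_prop)
  refine ⟨A, fun x => ?_⟩
  have := hA x
  rw [Pi.mul_apply, Real.norm_eq_abs, abs_mul, abs_of_nonneg (by positivity)] at this
  rw [inv_pow, ← div_eq_mul_inv, le_div_iff₀ (by positivity)]
  simpa [mul_comm] using this

/-- A smooth cutoff, equal to `1` on the disc of radius `r`. -/
lemma exists_contDiff_hasCompactSupport_eq_one (r : ℝ) : ∃ χ : Plane → ℝ, ContDiff ℝ ∞ χ ∧
    (HasCompactSupport χ ∧ ∀ x, ‖x‖ ≤ r → χ x = 1) ∧ ∀ x, 0 ≤ χ x ∧ χ x ≤ 1 := by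
  have hr : 0 < max r 1 := by positivity
  let φ : ContDiffBump (0 : Plane) := ⟨max r 1, max r 1 + 1, hr, by linarith⟩
  refine ⟨φ, φ.contDiff, ⟨φ.hasCompactSupport, fun x hx => ?_⟩, fun x => ⟨φ.nonneg, φ.le_one⟩⟩
  refine φ.one_of_mem_closedBall ?_
  rw [mem_closedBall_zero_iff]
  exact hx.trans (le_max_left _ _)

/-- A convolution with a locally integrable kernel is locally integrable. -/
lemma locallyIntegrable_convolution_kernel {F : Type*} [NormedAddCommGroup F] [NormedSpace ℝ F]
    {g : Plane → F} (hg : StronglyMeasurable g)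
    (hgb : ∀ z, ‖g z‖ ≤ ‖z‖ + ‖z‖⁻¹) {ρ : Plane → ℝ} (hρ : Integrable fun y => (1 + ‖y‖) * ρ y) :
    LocallyIntegrable fun x => ∫ y, ρ y • g (x - y) := by
  rw [locallyIntegrable_iff]
  intro K hK
  obtain ⟨r, hr⟩ := hK.isBounded.subset_ball 0
  have h1 : ∀ x : Plane, |(Metric.ball (0 : Plane) r).indicator (fun _ => (1 : ℝ)) x| ≤
      (1 + r ^ 2) ^ 2 * ((1 + ‖x‖ ^ 2)⁻¹) ^ 2 := by
    intro x
    by_cases hx : x ∈ Metric.ball (0 : Plane) r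
    · rw [indicator_of_mem hx, abs_one, inv_pow, ← div_eq_mul_inv, le_div_iff₀ (by positivity),
        one_mul]
      have : ‖x‖ ≤ r := by simpa using (mem_ball_zero_iff.1 hx).le
      gcongr
    · rw [indicator_of_notMem hx, abs_zero]; positivity
  have h2 := (integrable_prod_kernel hg hgb hρ
    (aestronglyMeasurable_const.indicator Metric.isOpen_ball.measurableSet) h1).integral_prod_left
  have h3 : IntegrableOn (fun x => ∫ y, ρ y • g (x - y)) (Metric.ball 0 r) := by
    refine h2.integrableOn.congr_fun (fun x hx => ?_) Metric.isOpen_ball.measurableSet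
    simp only [indicator_of_mem hx, mul_one]
  exact h3.mono_set hr

lemma invLaplacian_eq (ρ : Plane → ℝ) (x : Plane) :
    invLaplacian ρ x = ∫ y, ρ y • green (x - y) := by
  simp [invLaplacian, mul_comm]

/-- The distributional gradient of a potential is the field. -/
lemma hasWeakGradient_invLaplacian {ρ : Plane → ℝ} (hρ : Integrable fun y => (1 + ‖y‖) * ρ y) :
    HasWeakGradient (invLaplacian ρ) (field ρ) := by
  have hG : StronglyMeasurable green := measurable_green.stronglyMeasurable
  have hK : StronglyMeasurable greenGrad := measurable_greenGrad.stronglyMeasurable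
  have hKb : ∀ z, ‖greenGrad z‖ ≤ ‖z‖ + ‖z‖⁻¹ := fun z =>
    (norm_greenGrad_le z).trans (le_add_of_nonneg_left (norm_nonneg z))
  refine .of_forall_inner ?_ (locallyIntegrable_convolution_kernel hK hKb hρ)
    fun η hη hc e => ?_
  · simp_rw [funext (invLaplacian_eq ρ)]
    exact locallyIntegrable_convolution_kernel hG abs_green_le hρ
  have hc' : HasCompactSupport fun x => fderiv ℝ η x e :=
    (hc.fderiv (𝕜 := ℝ)).comp_left (g := fun L : Plane →L[ℝ] ℝ => L e) (by simp)
  have hη' : Continuous fun x => fderiv ℝ η x e :=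
    (hη.continuous_fderiv (by simp)).clm_apply continuous_const
  obtain ⟨A, hA⟩ := exists_le_japanese_of_hasCompactSupport hη' hc' 2
  obtain ⟨B, hB⟩ := exists_le_japanese_of_hasCompactSupport hη.continuous hc 2
  have i1 := integrable_prod_kernel hG abs_green_le hρ hη'.aestronglyMeasurable hA
  have i2 := integrable_prod_kernel hK hKb hρ hη.continuous.aestronglyMeasurable hB
  have i3 : Integrable (Function.uncurry fun x y => ρ y * (inner ℝ (greenGrad (x - y)) e * η x))
      (volume.prod volume) := by
    refine (i2.inner_const e).congr (Eventually.of_forall fun p => ?_)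
    simp only [Function.uncurry, real_inner_smul_left]
    ring
  calc ∫ x, invLaplacian ρ x * fderiv ℝ η x e
      = ∫ x, ∫ y, (ρ y * fderiv ℝ η x e) • green (x - y) := by
        refine integral_congr_ae (Eventually.of_forall fun x => ?_)
        simp only [invLaplacian_eq]
        rw [← integral_mul_const]
        refine integral_congr_ae (Eventually.of_forall fun y => ?_)
        simp only [smul_eq_mul]
        ring
    _ = ∫ y, ∫ x, (ρ y * fderiv ℝ η x e) • green (x - y) := integral_integral_swap i1
    _ = ∫ y, ρ y * -∫ x, inner ℝ (greenGrad (x - y)) e * η x := by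
        refine integral_congr_ae (Eventually.of_forall fun y => ?_)
        simp only
        have hs : HasCompactSupport fun x => η (x + y) := hc.comp_homeomorph (Homeomorph.addRight y)
        have hd : ContDiff ℝ 1 fun x => η (x + y) :=
          (hη.of_le (by simp)).comp (contDiff_id.add contDiff_const)
        have h1 := integral_green_mul_fderiv hd hs e
        rw [← integral_sub_right_eq_self _ y, ← integral_sub_right_eq_self
          (fun x => inner ℝ (greenGrad x) e * η (x + y)) y] at h1
        simp only [fderiv_comp_add_right, sub_add_cancel] at h1
        rw [← h1, ← integral_const_mul]
        refine integral_congr_ae (Eventually.of_forall fun x => ?_)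
        simp only [smul_eq_mul]
        ring
    _ = -∫ y, ∫ x, ρ y * (inner ℝ (greenGrad (x - y)) e * η x) := by
        rw [← integral_neg]
        refine integral_congr_ae (Eventually.of_forall fun y => ?_)
        simp only
        rw [integral_const_mul, mul_neg]
    _ = -∫ x, ∫ y, ρ y * (inner ℝ (greenGrad (x - y)) e * η x) := by
        rw [integral_integral_swap i3]
    _ = -∫ x, inner ℝ (field ρ x) e * η x := by
        congr 1
        refine integral_congr_ae ?_
        -- where the field is given by a convergent integral, the inner product may be exchanged
        have i4 : ∀ r : ℝ, ∀ᵐ x, x ∈ Metric.ball (0 : Plane) r →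
            Integrable fun y => ρ y • greenGrad (x - y) := by
          intro r
          obtain ⟨χ, hχ1, hχs, -⟩ := exists_contDiff_hasCompactSupport_eq_one r
          obtain ⟨D, hD⟩ := exists_le_japanese_of_hasCompactSupport hχ1.continuous hχs.1 2
          have := (integrable_prod_kernel hK hKb hρ hχ1.continuous.aestronglyMeasurable
            hD).prod_right_ae
          filter_upwards [this] with x hx hxr
          simpa [hχs.2 x (mem_ball_zero_iff.1 hxr).le] using hx
        have i5 : ∀ᵐ x, Integrable fun y => ρ y • greenGrad (x - y) := by
          filter_upwards [ae_all_iff.2 fun k : ℕ => i4 k] with x hx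
          obtain ⟨k, hk⟩ := exists_nat_gt ‖x‖
          exact hx k (mem_ball_zero_iff.2 hk)
        filter_upwards [i5] with x hx
        rw [field, real_inner_comm, ← integral_inner hx, ← integral_mul_const]
        refine integral_congr_ae (Eventually.of_forall fun y => ?_)
        simp only [inner_smul_right]
        rw [real_inner_comm]
        ring

end

/-! ### Rapidly decaying weights -/

section

/-- A positive continuous weight that decays faster than any power. -/
structure IsRapidWeight (n : Plane → ℝ) : Prop where
  continuous : Continuous n
  pos : ∀ x, 0 < n x
  decay : ∀ N : ℕ, ∃ C, 0 ≤ C ∧ ∀ x, n x ≤ C * ((1 + ‖x‖ ^ 2)⁻¹) ^ N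

variable {n : Plane → ℝ}

lemma IsRapidWeight.measurable_ofReal (hn : IsRapidWeight n) :
    Measurable fun x => ENNReal.ofReal (n x) :=
  hn.continuous.measurable.ennreal_ofReal

lemma IsRapidWeight.volume_absolutelyContinuous (hn : IsRapidWeight n) :
    (volume : Measure Plane) ≪ weighted n :=
  withDensity_absolutelyContinuous' hn.measurable_ofReal.aemeasurable
    (Eventually.of_forall fun x => by simpa using hn.pos x)

lemma weighted_absolutelyContinuous (n : Plane → ℝ) : weighted n ≪ (volume : Measure Plane) :=
  withDensity_absolutelyContinuous _ _

lemma IsRapidWeight.integrable_weighted (hn : IsRapidWeight n) {E : Type*} [NormedAddCommGroup E]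
    [NormedSpace ℝ E] {g : Plane → E} :
    Integrable g (weighted n) ↔ Integrable fun x => n x • g x := by
  rw [weighted, integrable_withDensity_iff_integrable_smul' hn.measurable_ofReal
    (Eventually.of_forall fun x => ENNReal.ofReal_lt_top)]
  simp_rw [ENNReal.toReal_ofReal (hn.pos _).le]

lemma IsRapidWeight.memLp_two (hn : IsRapidWeight n) {E : Type*} [NormedAddCommGroup E]
    {g : Plane → E} :
    MemLp g 2 (weighted n) ↔ AEStronglyMeasurable g ∧ Integrable fun x => ‖g x‖ ^ 2 * n x := by
  constructor
  · intro h
    have hm := h.1.mono_ac hn.volume_absolutelyContinuous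
    refine ⟨hm, ?_⟩
    have := (memLp_two_iff_integrable_sq_norm h.1).1 h
    rw [hn.integrable_weighted] at this
    simpa [mul_comm] using this
  · rintro ⟨hm, hi⟩
    rw [memLp_two_iff_integrable_sq_norm (hm.mono_ac (weighted_absolutelyContinuous n)),
      hn.integrable_weighted]
    simpa [mul_comm] using hi

lemma IsRapidWeight.integrable_pow (hn : IsRapidWeight n) (N : ℕ) :
    Integrable fun x => (1 + ‖x‖ ^ 2) ^ N * n x := by
  obtain ⟨C, hC, h⟩ := hn.decay (N + 2)
  refine (integrable_one_add_norm_pow.const_mul (4 * C)).mono' ?_ (Eventually.of_forall fun x => ?_)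
  · exact (((continuous_const.add (continuous_norm.pow 2)).pow N).mul
      hn.continuous).aestronglyMeasurable
  · rw [Real.norm_of_nonneg (mul_nonneg (by positivity) (hn.pos x).le)]
    have hx := norm_nonneg x
    have hw : (1 + ‖x‖ ^ 2)⁻¹ ≤ 2 * ((1 + ‖x‖)⁻¹) ^ 2 := by
      rw [inv_pow, ← div_eq_mul_inv, le_div_iff₀ (by positivity), inv_mul_le_iff₀ (by positivity)]
      nlinarith [sq_nonneg (‖x‖ - 1)]
    have h1 : (1 + ‖x‖)⁻¹ ≤ 1 := inv_le_one_of_one_le₀ (by linarith)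
    have h2 : (1 + ‖x‖ ^ 2) ^ N * ((1 + ‖x‖ ^ 2)⁻¹) ^ N = 1 := by
      rw [← mul_pow, mul_inv_cancel₀ (by positivity), one_pow]
    calc (1 + ‖x‖ ^ 2) ^ N * n x ≤ (1 + ‖x‖ ^ 2) ^ N * (C * ((1 + ‖x‖ ^ 2)⁻¹) ^ (N + 2)) := by
          gcongr; exact h x
      _ = C * ((1 + ‖x‖ ^ 2)⁻¹) ^ 2 * ((1 + ‖x‖ ^ 2) ^ N * ((1 + ‖x‖ ^ 2)⁻¹) ^ N) := by ring
      _ = C * ((1 + ‖x‖ ^ 2)⁻¹) ^ 2 := by rw [h2, mul_one]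
      _ ≤ C * (2 * ((1 + ‖x‖)⁻¹) ^ 2) ^ 2 := by gcongr
      _ = 4 * C * ((1 + ‖x‖)⁻¹ ^ 3 * (1 + ‖x‖)⁻¹) := by ring
      _ ≤ 4 * C * ((1 + ‖x‖)⁻¹ ^ 3 * 1) := by gcongr
      _ = _ := by rw [mul_one]

lemma IsRapidWeight.integrable (hn : IsRapidWeight n) : Integrable n := by
  simpa using hn.integrable_pow 0

lemma IsRapidWeight.bounded (hn : IsRapidWeight n) : ∃ C, 0 ≤ C ∧ ∀ x, n x ≤ C := by
  obtain ⟨C, hC, h⟩ := hn.decay 0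
  exact ⟨C, hC, by simpa using h⟩

/-- Cauchy–Schwarz in `L²(n dx)`. -/
lemma IsRapidWeight.integrable_mul (hn : IsRapidWeight n) {h f : Plane → ℝ}
    (hhm : AEStronglyMeasurable h) (hfm : AEStronglyMeasurable f)
    (hh : Integrable fun x => h x ^ 2 * n x) (hf : Integrable fun x => f x ^ 2 * n x) :
    Integrable fun x => h x * (f x * n x) := by
  refine (hh.add hf).mono' (hhm.mul (hfm.mul hn.continuous.aestronglyMeasurable))
    (Eventually.of_forall fun x => ?_)
  have := (hn.pos x).le
  rw [norm_mul, norm_mul, Real.norm_of_nonneg this, Real.norm_eq_abs, Real.norm_eq_abs,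
    Pi.add_apply]
  calc |h x| * (|f x| * n x) = (|h x| * |f x|) * n x := by ring
    _ ≤ (h x ^ 2 + f x ^ 2) * n x := by
        gcongr
        rw [← sq_abs (h x), ← sq_abs (f x)]
        nlinarith [sq_nonneg (|h x| - |f x|), sq_nonneg (|h x|), sq_nonneg (|f x|)]
    _ = _ := by ring

lemma green_sq_le (x : Plane) : green x ^ 2 ≤ ‖x‖ ^ 2 + 4 * ‖x‖⁻¹ := by
  have h0 : green x ^ 2 ≤ Real.log ‖x‖ ^ 2 := by
    rw [green, mul_pow, neg_sq]
    exact mul_le_of_le_one_left (sq_nonneg _) (pow_le_one₀ (by positivity) one_div_two_pi_le_one)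
  refine h0.trans ?_
  rcases eq_or_ne x 0 with rfl | hx
  · simp
  have hx' : 0 < ‖x‖ := norm_pos_iff.2 hx
  set t := ‖x‖
  rcases le_total 1 t with h | h
  · have h1 := Real.log_nonneg h
    have h2 := Real.log_le_sub_one_of_pos hx'
    have : Real.log t ^ 2 ≤ t ^ 2 := pow_le_pow_left₀ h1 (by linarith) 2
    have : 0 ≤ 4 * t⁻¹ := by positivity
    linarith
  · have h1 : -Real.log t ≤ 2 * Real.sqrt t⁻¹ := by
      have := Real.log_le_sub_one_of_pos (Real.sqrt_pos.2 (inv_pos.2 hx'))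
      rw [Real.log_sqrt (inv_pos.2 hx').le, Real.log_inv] at this
      linarith
    have h2 : 0 ≤ -Real.log t := by linarith [Real.log_nonpos hx'.le h]
    have h3 := pow_le_pow_left₀ h2 h1 2
    rw [mul_pow, Real.sq_sqrt (inv_pos.2 hx').le, neg_sq] at h3
    nlinarith [sq_nonneg t]

lemma IsRapidWeight.integrable_green_sq (hn : IsRapidWeight n) (x : Plane) :
    Integrable fun y => green (x - y) ^ 2 * n y := by
  obtain ⟨C, hC, h⟩ := hn.decay 1
  have h1 := ((hn.integrable_pow 1).const_mul (2 * (1 + ‖x‖ ^ 2))).add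
    ((integrable_japanese_div x).const_mul (4 * C))
  have hg : Measurable fun y => green (x - y) :=
    measurable_green.comp (measurable_const.sub measurable_id)
  refine h1.mono' ((hg.pow_const 2).mul hn.continuous.measurable).aestronglyMeasurable
    (Eventually.of_forall fun y => ?_)
  have hny := (hn.pos y).le
  rw [Real.norm_of_nonneg (by positivity), Pi.add_apply, pow_one]
  have h2 : ‖x - y‖ ^ 2 ≤ 2 * (1 + ‖x‖ ^ 2) * (1 + ‖y‖ ^ 2) := by
    have := norm_sub_le x y
    have h3 : ‖x - y‖ ^ 2 ≤ (‖x‖ + ‖y‖) ^ 2 := by gcongr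
    nlinarith [sq_nonneg (‖x‖ - ‖y‖), mul_nonneg (sq_nonneg ‖x‖) (sq_nonneg ‖y‖)]
  calc green (x - y) ^ 2 * n y ≤ (‖x - y‖ ^ 2 + 4 * ‖x - y‖⁻¹) * n y := by
        gcongr; exact green_sq_le _
    _ = ‖x - y‖ ^ 2 * n y + 4 * ‖x - y‖⁻¹ * n y := by ring
    _ ≤ 2 * (1 + ‖x‖ ^ 2) * (1 + ‖y‖ ^ 2) * n y
        + 4 * ‖x - y‖⁻¹ * (C * ((1 + ‖y‖ ^ 2)⁻¹) ^ 1) := by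
        gcongr
        exact h y
    _ = _ := by ring

/-- The density `f n` of a perturbation is integrable against the Green function. -/
lemma IsRapidWeight.integrable_green_mul (hn : IsRapidWeight n) {f : Plane → ℝ}
    (hfm : AEStronglyMeasurable f) (hf : Integrable fun x => f x ^ 2 * n x) (x : Plane) :
    Integrable fun y => green (x - y) * (f y * n y) :=
  hn.integrable_mul
    (measurable_green.comp (measurable_const.sub measurable_id)).aestronglyMeasurable
    hfm (hn.integrable_green_sq x) hf

lemma IsRapidWeight.integrable_moment (hn : IsRapidWeight n) {f : Plane → ℝ}
    (hfm : AEStronglyMeasurable f) (hf : Integrable fun x => f x ^ 2 * n x) :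
    Integrable fun y => (1 + ‖y‖) * (f y * n y) := by
  refine hn.integrable_mul (by fun_prop) hfm ?_ hf
  refine ((hn.integrable_pow 1).const_mul 2).mono' (by have := hn.continuous; fun_prop)
    (Eventually.of_forall fun y => ?_)
  have hny := (hn.pos y).le
  rw [Real.norm_of_nonneg (by positivity), pow_one, ← mul_assoc]
  gcongr
  nlinarith [sq_nonneg (‖y‖ - 1)]

lemma IsRapidWeight.integrable_mul_weight (hn : IsRapidWeight n) {f : Plane → ℝ}
    (hfm : AEStronglyMeasurable f) (hf : Integrable fun x => f x ^ 2 * n x) :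
    Integrable fun y => f y * n y := by
  simpa using hn.integrable_mul (h := fun _ => 1) aestronglyMeasurable_const hfm
    (by simpa using hn.integrable) hf

/-- Cauchy–Schwarz for lower Lebesgue integrals. -/
lemma lintegral_mul_sq_le {α : Type*} [MeasurableSpace α] {ν : Measure α} {f g : α → ℝ≥0∞}
    (hf : AEMeasurable f ν) (hg : AEMeasurable g ν) :
    (∫⁻ a, f a * g a ∂ν) ^ 2 ≤ (∫⁻ a, f a ^ 2 ∂ν) * ∫⁻ a, g a ^ 2 ∂ν := by
  have h := ENNReal.lintegral_mul_le_Lp_mul_Lq ν Real.HolderConjugate.two_two hf hg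
  simp only [Pi.mul_apply] at h
  have h2 := ENNReal.rpow_le_rpow h (by norm_num : (0 : ℝ) ≤ 2)
  rw [ENNReal.mul_rpow_of_nonneg _ _ (by norm_num : (0 : ℝ) ≤ 2), ← ENNReal.rpow_mul,
    ← ENNReal.rpow_mul] at h2
  simpa using h2

/-- A mean-zero density has a field of finite energy, bounded by its norm in `L²(n dx)`. This is a
Schur test; the vanishing mean allows to subtract the monopole from the kernel. -/
lemma IsRapidWeight.exists_lintegral_field_le (hn : IsRapidWeight n) :
    ∃ C : ℝ, 0 ≤ C ∧ ∀ f : Plane → ℝ, AEStronglyMeasurable f →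
      Integrable (fun x => f x ^ 2 * n x) → ∫ x, f x * n x = 0 →
      ∫⁻ x, ENNReal.ofReal (‖field (fun y => f y * n y) x‖ ^ 2) ≤
        ENNReal.ofReal (C * ∫ x, f x ^ 2 * n x) := by
  obtain ⟨C₀, hC₀, hCb⟩ := exists_integral_japanese_div_le
  obtain ⟨B, hB, hBn⟩ := hn.decay 2
  have hcn := hn.continuous
  refine ⟨B * C₀ * C₀, by positivity, fun f hfm hf hmean => ?_⟩
  have hne : ∀ x : Plane, ∀ᵐ y : Plane, x ≠ y := fun x => by simp [ae_iff]
  have hint := hn.integrable_mul_weight hfm hf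
  -- the pointwise bound
  have hpt : ∀ x, ENNReal.ofReal (‖field (fun y => f y * n y) x‖ ^ 2) ≤
      ENNReal.ofReal (B * C₀) *
        ∫⁻ y, ENNReal.ofReal ((1 + ‖x‖ ^ 2)⁻¹ * ‖y - x‖⁻¹ * (f y ^ 2 * n y)) := by
    intro x
    by_cases hI : Integrable fun y => (f y * n y) • greenGrad (x - y)
    swap
    · rw [field, integral_undef hI]; simp
    set κ : Plane := (-(1 / (2 * Real.pi)) * (1 + ‖x‖ ^ 2)⁻¹) • x
    have h1 : field (fun y => f y * n y) x = ∫ y, (f y * n y) • (greenGrad (x - y) - κ) := by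
      simp_rw [smul_sub]
      rw [integral_sub hI (hint.smul_const κ), integral_smul_const, hmean, zero_smul, sub_zero,
        field]
    set a : Plane → ℝ≥0∞ := fun y =>
      ENNReal.ofReal (Real.sqrt ((1 + ‖x‖ ^ 2)⁻¹ * ‖y - x‖⁻¹ * (f y ^ 2 * n y)))
    set b : Plane → ℝ≥0∞ := fun y =>
      ENNReal.ofReal (Real.sqrt ((1 + ‖y‖ ^ 2) * n y * ‖x - y‖⁻¹))
    have h2 : ‖field (fun y => f y * n y) x‖ₑ ≤ ∫⁻ y, a y * b y := by
      rw [h1]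
      refine (enorm_integral_le_lintegral_enorm _).trans (lintegral_mono_ae ?_)
      filter_upwards [hne x] with y hy
      have hny := (hn.pos y).le
      rw [← ENNReal.ofReal_mul (Real.sqrt_nonneg _), ← ofReal_norm,
        ← Real.sqrt_mul (by positivity)]
      refine ENNReal.ofReal_le_ofReal (Real.le_sqrt_of_sq_le ?_)
      rw [norm_smul, mul_pow, norm_mul, Real.norm_of_nonneg hny, mul_pow, Real.norm_eq_abs, sq_abs]
      calc f y ^ 2 * n y ^ 2 * ‖greenGrad (x - y) - κ‖ ^ 2
          ≤ f y ^ 2 * n y ^ 2 * ((1 + ‖y‖ ^ 2) * (1 + ‖x‖ ^ 2)⁻¹ * (‖x - y‖⁻¹) ^ 2) := by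
            gcongr; exact norm_greenGrad_sub_le hy
        _ = _ := by rw [norm_sub_rev y x]; ring
    have ha2 : ∀ y, a y ^ 2 = ENNReal.ofReal ((1 + ‖x‖ ^ 2)⁻¹ * ‖y - x‖⁻¹ * (f y ^ 2 * n y)) := by
      intro y
      have hny := (hn.pos y).le
      rw [← ENNReal.ofReal_pow (Real.sqrt_nonneg _), Real.sq_sqrt (by positivity)]
    have hb2 : ∫⁻ y, b y ^ 2 ≤ ENNReal.ofReal (B * C₀) := by
      have h3 : ∀ y, b y ^ 2 ≤ ENNReal.ofReal (B * ((1 + ‖y‖ ^ 2)⁻¹ * ‖x - y‖⁻¹)) := by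
        intro y
        have hny := (hn.pos y).le
        rw [← ENNReal.ofReal_pow (Real.sqrt_nonneg _), Real.sq_sqrt (by positivity)]
        refine ENNReal.ofReal_le_ofReal ?_
        calc (1 + ‖y‖ ^ 2) * n y * ‖x - y‖⁻¹
            ≤ (1 + ‖y‖ ^ 2) * (B * ((1 + ‖y‖ ^ 2)⁻¹) ^ 2) * ‖x - y‖⁻¹ := by gcongr; exact hBn y
          _ = _ := by field_simp
      refine (lintegral_mono h3).trans ?_
      rw [← ofReal_integral_eq_lintegral_ofReal ((integrable_japanese_div x).const_mul B)
        (Eventually.of_forall fun y => by positivity), integral_const_mul]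
      exact ENNReal.ofReal_le_ofReal (mul_le_mul_of_nonneg_left (hCb x) hB)
    have ham : AEMeasurable a := by
      refine ENNReal.measurable_ofReal.comp_aemeasurable
        (Real.continuous_sqrt.measurable.comp_aemeasurable ?_)
      exact AEMeasurable.mul (by fun_prop) ((hfm.aemeasurable.pow_const 2).mul (by fun_prop))
    have hbm : AEMeasurable b := by fun_prop
    calc ENNReal.ofReal (‖field (fun y => f y * n y) x‖ ^ 2)
        = ‖field (fun y => f y * n y) x‖ₑ ^ 2 := by
          rw [ENNReal.ofReal_pow (norm_nonneg _), ofReal_norm]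
      _ ≤ (∫⁻ y, a y * b y) ^ 2 := by gcongr
      _ ≤ (∫⁻ y, a y ^ 2) * ∫⁻ y, b y ^ 2 := lintegral_mul_sq_le ham hbm
      _ ≤ (∫⁻ y, a y ^ 2) * ENNReal.ofReal (B * C₀) := by gcongr
      _ = _ := by rw [mul_comm]; simp_rw [ha2]
  calc ∫⁻ x, ENNReal.ofReal (‖field (fun y => f y * n y) x‖ ^ 2)
      ≤ ∫⁻ x, ENNReal.ofReal (B * C₀) *
          ∫⁻ y, ENNReal.ofReal ((1 + ‖x‖ ^ 2)⁻¹ * ‖y - x‖⁻¹ * (f y ^ 2 * n y)) :=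
        lintegral_mono hpt
    _ = ENNReal.ofReal (B * C₀) * ∫⁻ y, ∫⁻ x,
          ENNReal.ofReal ((1 + ‖x‖ ^ 2)⁻¹ * ‖y - x‖⁻¹ * (f y ^ 2 * n y)) := by
        rw [lintegral_const_mul' _ _ ENNReal.ofReal_ne_top, lintegral_lintegral_swap]
        refine ENNReal.measurable_ofReal.comp_aemeasurable ?_
        refine AEMeasurable.mul (by fun_prop) ?_
        have : AEMeasurable fun y => f y ^ 2 * n y := hf.aestronglyMeasurable.aemeasurable
        exact this.comp_snd
    _ ≤ ENNReal.ofReal (B * C₀) * ∫⁻ y, ENNReal.ofReal (C₀ * (f y ^ 2 * n y)) := by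
        gcongr with y
        have hny := (hn.pos y).le
        rw [← ofReal_integral_eq_lintegral_ofReal ((integrable_japanese_div y).mul_const _)
          (Eventually.of_forall fun x => by positivity), integral_mul_const]
        exact ENNReal.ofReal_le_ofReal (by gcongr; exact hCb y)
    _ = _ := by
        rw [← ofReal_integral_eq_lintegral_ofReal (hf.const_mul C₀)
          (Eventually.of_forall fun y => by have := (hn.pos y).le; positivity), integral_const_mul,
          ← ENNReal.ofReal_mul (by positivity)]
        congr 1
        ring

lemma aestronglyMeasurable_field {ρ : Plane → ℝ} (hρ : Integrable fun y => (1 + ‖y‖) * ρ y) :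
    AEStronglyMeasurable (field ρ) :=
  (hasWeakGradient_invLaplacian hρ).locallyIntegrable_grad.aestronglyMeasurable

lemma IsRapidWeight.integrable_field_sq (hn : IsRapidWeight n) {f : Plane → ℝ}
    (hfm : AEStronglyMeasurable f) (hf : Integrable fun x => f x ^ 2 * n x)
    (hmean : ∫ x, f x * n x = 0) :
    Integrable fun x => ‖field (fun y => f y * n y) x‖ ^ 2 := by
  obtain ⟨C, -, hC⟩ := hn.exists_lintegral_field_le
  refine ⟨(aestronglyMeasurable_field (hn.integrable_moment hfm hf)).norm.pow 2, ?_⟩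
  rw [hasFiniteIntegral_iff_ofReal (Eventually.of_forall fun x => by positivity)]
  exact (hC f hfm hf hmean).trans_lt ENNReal.ofReal_lt_top

lemma IsRapidWeight.exists_integral_field_le (hn : IsRapidWeight n) :
    ∃ C : ℝ, 0 ≤ C ∧ ∀ f : Plane → ℝ, AEStronglyMeasurable f →
      Integrable (fun x => f x ^ 2 * n x) → ∫ x, f x * n x = 0 →
      ∫ x, ‖field (fun y => f y * n y) x‖ ^ 2 ≤ C * ∫ x, f x ^ 2 * n x := by
  obtain ⟨C, hC0, hC⟩ := hn.exists_lintegral_field_le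
  refine ⟨C, hC0, fun f hfm hf hmean => ?_⟩
  have h0 : 0 ≤ ∫ x, f x ^ 2 * n x :=
    integral_nonneg fun x => mul_nonneg (sq_nonneg _) (hn.pos x).le
  rw [← ENNReal.ofReal_le_ofReal_iff (by positivity), ofReal_integral_eq_lintegral_ofReal
    (hn.integrable_field_sq hfm hf hmean) (Eventually.of_forall fun x => by positivity)]
  exact hC f hfm hf hmean

lemma IsRapidWeight.integrable_mul_of_bounded (hn : IsRapidWeight n) {g : Plane → ℝ}
    (hg : Integrable g) : Integrable fun x => g x * n x := by
  obtain ⟨C, hC, hb⟩ := hn.bounded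
  exact hg.mul_bdd (c := C) hn.continuous.aestronglyMeasurable
    (Eventually.of_forall fun x => by rw [Real.norm_of_nonneg (hn.pos x).le]; exact hb x)

end

/-! ### Calculus in polar coordinates -/

section

/-- The radial unit vector at angle `θ`. -/
noncomputable def er (θ : ℝ) : Plane := !₂[Real.cos θ, Real.sin θ]

/-- The angular unit vector at angle `θ`. -/
noncomputable def et (θ : ℝ) : Plane := !₂[-Real.sin θ, Real.cos θ]

lemma er_eq (θ : ℝ) : er θ = Real.cos θ • er 0 + Real.sin θ • et 0 := by
  ext i; fin_cases i <;> simp [er, et]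

lemma et_eq (θ : ℝ) : et θ = (-Real.sin θ) • er 0 + Real.cos θ • et 0 := by
  ext i; fin_cases i <;> simp [er, et]

lemma norm_er (θ : ℝ) : ‖er θ‖ = 1 := by
  simp [er, EuclideanSpace.norm_eq]

lemma norm_et (θ : ℝ) : ‖et θ‖ = 1 := by
  simp [et, EuclideanSpace.norm_eq]

lemma inner_er_et (θ : ℝ) : inner ℝ (er θ) (et θ) = 0 := by
  simp [er, et, PiLp.inner_apply]
  ring

lemma hasDerivAt_er (θ : ℝ) : HasDerivAt er (et θ) θ := by
  have h := ((Real.hasDerivAt_cos θ).smul_const (er 0)).add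
    ((Real.hasDerivAt_sin θ).smul_const (et 0))
  rw [← et_eq] at h
  exact h.congr_of_eventuallyEq (Eventually.of_forall er_eq)

lemma hasDerivAt_et (θ : ℝ) : HasDerivAt et (-er θ) θ := by
  have h := ((Real.hasDerivAt_sin θ).neg.smul_const (er 0)).add
    ((Real.hasDerivAt_cos θ).smul_const (et 0))
  have h2 : -er θ = -Real.cos θ • er 0 + -Real.sin θ • et 0 := by
    rw [er_eq θ]; simp only [neg_smul, neg_add]
  rw [h2]
  exact h.congr_of_eventuallyEq (Eventually.of_forall et_eq)

lemma continuous_er : Continuous er :=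
  continuous_iff_continuousAt.2 fun θ => (hasDerivAt_er θ).continuousAt

lemma continuous_et : Continuous et :=
  continuous_iff_continuousAt.2 fun θ => (hasDerivAt_et θ).continuousAt

lemma exists_polar (x : Plane) : ∃ θ, x = ‖x‖ • er θ := by
  set z : ℂ := ⟨x 0, x 1⟩
  refine ⟨z.arg, ?_⟩
  have hz : ‖z‖ = ‖x‖ := by
    rw [EuclideanSpace.norm_eq, Complex.norm_def, Complex.normSq_apply]
    simp [z, Fin.sum_univ_two, sq]
  ext i
  fin_cases i
  · simp only [er, PiLp.smul_apply, smul_eq_mul, ← hz]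
    exact (Complex.norm_mul_cos_arg z).symm
  · simp only [er, PiLp.smul_apply, smul_eq_mul, ← hz]
    exact (Complex.norm_mul_sin_arg z).symm

/-- The square of the norm of a vector in the polar frame. -/
lemma norm_sq_eq_polar (v : Plane) (θ : ℝ) :
    ‖v‖ ^ 2 = inner ℝ v (er θ) ^ 2 + inner ℝ v (et θ) ^ 2 := by
  simp only [EuclideanSpace.norm_sq_eq, er, et, PiLp.inner_apply, Fin.sum_univ_two]
  simp
  linear_combination (-v 0 ^ 2 - v 1 ^ 2) * (Real.sin_sq_add_cos_sq θ)

lemma gradient_norm_sq_eq_polar (u : Plane → ℝ) (x : Plane) (θ : ℝ) :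
    ‖gradient u x‖ ^ 2 = fderiv ℝ u x (er θ) ^ 2 + fderiv ℝ u x (et θ) ^ 2 := by
  rw [norm_sq_eq_polar _ θ, inner_gradient_left, inner_gradient_left]

/-- The Laplacian as the trace of the second derivative in the polar frame. -/
lemma laplacian_eq_polar (u : Plane → ℝ) (x : Plane) (θ : ℝ) :
    Laplacian.laplacian u x = fderiv ℝ (fderiv ℝ u) x (er θ) (er θ)
      + fderiv ℝ (fderiv ℝ u) x (et θ) (et θ) := by
  rw [InnerProductSpace.laplacian_eq_iteratedFDeriv_orthonormalBasis u
    (EuclideanSpace.basisFun (Fin 2) ℝ)]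
  have h0 : EuclideanSpace.basisFun (Fin 2) ℝ 0 = er 0 := by
    ext i; fin_cases i <;> simp [er]
  have h1 : EuclideanSpace.basisFun (Fin 2) ℝ 1 = et 0 := by
    ext i; fin_cases i <;> simp [et]
  simp only [Fin.sum_univ_two, iteratedFDeriv_two_apply, h0, h1, Matrix.cons_val_zero,
    Matrix.cons_val_one]
  rw [er_eq θ, et_eq θ]
  simp only [map_add, map_smul, add_apply, FunLike.coe_smul, Pi.smul_apply, smul_eq_mul]
  linear_combination (-(fderiv ℝ (fderiv ℝ u) x (er 0) (er 0))
    - fderiv ℝ (fderiv ℝ u) x (et 0) (et 0)) * (Real.sin_sq_add_cos_sq θ)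

variable {u : Plane → ℝ}

lemma hasFDerivAt_fderiv (hu : ContDiff ℝ 2 u) (x : Plane) :
    HasFDerivAt (fderiv ℝ u) (fderiv ℝ (fderiv ℝ u) x) x :=
  ((hu.fderiv_right (m := 1) (by norm_num)).differentiable one_ne_zero x).hasFDerivAt

lemma hasDerivAt_line (hu : ContDiff ℝ 2 u) (x e : Plane) (t : ℝ) :
    HasDerivAt (fun t : ℝ => u (x + t • e)) (fderiv ℝ u (x + t • e) e) t := by
  have h1 : HasDerivAt (fun t : ℝ => x + t • e) ((1 : ℝ) • e) t :=
    ((hasDerivAt_id t).smul_const e).const_add x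
  rw [one_smul] at h1
  exact ((hu.differentiable two_ne_zero) (x + t • e)).hasFDerivAt.comp_hasDerivAt t h1

lemma hasDerivAt_fderiv_line (hu : ContDiff ℝ 2 u) (x e v : Plane) (t : ℝ) :
    HasDerivAt (fun t : ℝ => fderiv ℝ u (x + t • e) v)
      (fderiv ℝ (fderiv ℝ u) (x + t • e) e v) t := by
  have h1 : HasDerivAt (fun t : ℝ => x + t • e) ((1 : ℝ) • e) t :=
    ((hasDerivAt_id t).smul_const e).const_add x
  rw [one_smul] at h1
  have h2 := (hasFDerivAt_fderiv hu (x + t • e)).comp_hasDerivAt t h1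
  exact (ContinuousLinearMap.apply ℝ ℝ v).hasFDerivAt.comp_hasDerivAt t h2

/-- At a local maximum, second directional derivatives are nonpositive. -/
lemma fderiv_fderiv_nonpos_of_isLocalMax (hu : ContDiff ℝ 2 u) {x : Plane} (hx : IsLocalMax u x)
    (e : Plane) :
    fderiv ℝ (fderiv ℝ u) x e e ≤ 0 := by
  by_contra! hpos
  set g : ℝ → ℝ := fun t => u (x + t • e)
  have hcont : Continuous fun t : ℝ => x + t • e := by fun_prop
  have hg : IsLocalMax g 0 := by
    have : Tendsto (fun t : ℝ => x + t • e) (𝓝 0) (𝓝 x) := by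
      simpa using hcont.tendsto 0
    have := this.eventually hx
    simpa [IsLocalMax, IsMaxFilter, g] using this
  have hd : deriv g = fun t => fderiv ℝ u (x + t • e) e :=
    funext fun t => (hasDerivAt_line hu x e t).deriv
  have hdd : deriv (deriv g) 0 = fderiv ℝ (fderiv ℝ u) x e e := by
    rw [hd, (hasDerivAt_fderiv_line hu x e e 0).deriv]; simp
  have hmin : IsLocalMin g 0 := isLocalMin_of_deriv_deriv_pos (by rw [hdd]; exact hpos)
    hg.deriv_eq_zero (hasDerivAt_line hu x e 0).continuousAt
  -- a point that is both a local maximum and a local minimum has a locally constant neighbourhood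
  have hconst : g =ᶠ[𝓝 0] fun _ => g 0 := by
    filter_upwards [hg, hmin] with t h1 h2 using le_antisymm h1 h2
  have h0 : deriv (deriv g) 0 = 0 := by
    have : deriv g =ᶠ[𝓝 0] fun _ => 0 := hconst.deriv.trans (by simp)
    rw [this.deriv_eq]; simp
  rw [hdd] at h0
  exact hpos.ne' h0

/-- The maximum principle. -/
lemma laplacian_nonpos_of_isLocalMax (hu : ContDiff ℝ 2 u) {x : Plane} (hx : IsLocalMax u x) :
    Laplacian.laplacian u x ≤ 0 := by
  rw [laplacian_eq_polar u x 0]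
  exact add_nonpos (fderiv_fderiv_nonpos_of_isLocalMax hu hx _)
    (fderiv_fderiv_nonpos_of_isLocalMax hu hx _)

lemma laplacian_comp_isometry (hu : ContDiff ℝ 2 u) (R : Plane ≃ₗᵢ[ℝ] Plane) (x : Plane) :
    Laplacian.laplacian (fun y => u (R y)) x = Laplacian.laplacian u (R x) := by
  rw [InnerProductSpace.laplacian_eq_iteratedFDeriv_orthonormalBasis u
    ((EuclideanSpace.basisFun (Fin 2) ℝ).map R),
    InnerProductSpace.laplacian_eq_iteratedFDeriv_orthonormalBasis (fun y => u (R y))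
    (EuclideanSpace.basisFun (Fin 2) ℝ)]
  refine Finset.sum_congr rfl fun i _ => ?_
  have := R.toContinuousLinearEquiv.toContinuousLinearMap.iteratedFDeriv_comp_right hu x
    (i := 2) le_rfl
  have h2 : (fun y => u (R y)) = u ∘ R.toContinuousLinearEquiv.toContinuousLinearMap := rfl
  rw [h2, this]
  simp only [ContinuousMultilinearMap.compContinuousLinearMap_apply, OrthonormalBasis.map_apply]
  congr 1
  ext j
  fin_cases j <;> rfl

lemma continuous_laplacian (hu : ContDiff ℝ 2 u) :
    Continuous (Laplacian.laplacian u) := by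
  have h : Continuous (fderiv ℝ (fderiv ℝ u)) :=
    (hu.fderiv_right (m := 1) (by norm_num)).continuous_fderiv one_ne_zero
  rw [show Laplacian.laplacian u = fun x => fderiv ℝ (fderiv ℝ u) x (er 0) (er 0)
      + fderiv ℝ (fderiv ℝ u) x (et 0) (et 0) from funext fun x => laplacian_eq_polar u x 0]
  exact ((h.clm_apply continuous_const).clm_apply continuous_const).add
    ((h.clm_apply continuous_const).clm_apply continuous_const)

lemma hasFDerivAt_harmonicPotential (μ : ℝ) (x : Plane) :
    HasFDerivAt (harmonicPotential μ) (μ • innerSL ℝ x) x := by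
  refine ((hasStrictFDerivAt_norm_sq x).hasFDerivAt.const_mul (μ / 2)).congr_fderiv ?_
  ext v
  simp
  ring

lemma contDiff_harmonicPotential (μ : ℝ) {k : WithTop ℕ∞} : ContDiff ℝ k (harmonicPotential μ) :=
  contDiff_const.mul (contDiff_norm_sq ℝ)

lemma laplacian_harmonicPotential (μ : ℝ) (x : Plane) :
    Laplacian.laplacian (harmonicPotential μ) x = 2 * μ := by
  rw [laplacian_eq_polar _ x 0]
  have h : fderiv ℝ (harmonicPotential μ) =
    fun x => (μ • innerSL ℝ : Plane →L[ℝ] Plane →L[ℝ] ℝ) x :=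
    funext fun x => (hasFDerivAt_harmonicPotential μ x).fderiv
  rw [h, ContinuousLinearMap.fderiv]
  have h2 : ∀ v : Plane, (innerSL ℝ v) v = ‖v‖ ^ 2 := fun v => real_inner_self_eq_norm_sq v
  simp [h2, norm_er, norm_et]
  ring

end

/-! ### The stationary solution: decay and radial symmetry -/

section

lemma abs_log_sub_log_le {a b : ℝ} (ha : 0 < a) (hb : 0 < b) :
    |Real.log a - Real.log b| ≤ |a - b| * (a⁻¹ + b⁻¹) := by
  have key : ∀ {a b : ℝ}, 0 < a → 0 < b → Real.log a - Real.log b ≤ |a - b| * (a⁻¹ + b⁻¹) := by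
    intro a b ha hb
    have h := Real.log_le_sub_one_of_pos (div_pos ha hb)
    rw [Real.log_div ha.ne' hb.ne'] at h
    have h2 : a / b - 1 = (a - b) * b⁻¹ := by field_simp
    calc _ ≤ (a - b) * b⁻¹ := h.trans_eq h2
      _ ≤ |a - b| * b⁻¹ := by gcongr; exact le_abs_self _
      _ ≤ _ := by gcongr; linarith [inv_pos.2 ha]
  refine abs_le.2 ⟨?_, key ha hb⟩
  have := key hb ha
  rw [abs_sub_comm, add_comm] at this
  linarith

lemma log_norm_sub_le (x y : Plane) :
    Real.log ‖x - y‖ ≤ ‖x‖ + (1 + |Real.log ‖y‖|) := by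
  rcases eq_or_ne x y with rfl | hxy
  · simp; positivity
  have h1 : ‖x - y‖ ≤ (1 + ‖x‖) * (1 + ‖y‖) := by
    nlinarith [norm_sub_le x y, norm_nonneg x, norm_nonneg y,
      mul_nonneg (norm_nonneg x) (norm_nonneg y)]
  have h2 := Real.log_le_log (norm_pos_iff.2 (sub_ne_zero.2 hxy)) h1
  rw [Real.log_mul (by positivity) (by positivity)] at h2
  have h3 : Real.log (1 + ‖x‖) ≤ ‖x‖ := by
    have := Real.log_le_sub_one_of_pos (by positivity : 0 < 1 + ‖x‖); linarith
  have h4 : Real.log (1 + ‖y‖) ≤ 1 + |Real.log ‖y‖| := by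
    rcases le_total ‖y‖ 1 with h | h
    · have := Real.log_le_sub_one_of_pos (by positivity : 0 < 1 + ‖y‖)
      have := abs_nonneg (Real.log ‖y‖)
      linarith
    · have h5 : Real.log (1 + ‖y‖) ≤ Real.log (2 * ‖y‖) :=
        Real.log_le_log (by positivity) (by linarith)
      rw [Real.log_mul two_ne_zero (by positivity)] at h5
      have := Real.log_le_sub_one_of_pos (two_pos (α := ℝ))
      have := le_abs_self (Real.log ‖y‖)
      linarith
  linarith

namespace IsStationary

variable {μ M : ℝ} {n c : Plane → ℝ}

lemma exists_eq_exp (hM : 0 < M) (hst : IsStationary M (harmonicPotential μ) n c) :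
    ∃ κ, 0 < κ ∧ ∀ x, n x = κ * Real.exp (-c x - harmonicPotential μ x) := by
  have hZ := integral_exp_pos hst.integrable
  exact ⟨M / ∫ y, Real.exp (-c y - harmonicPotential μ y), by positivity, fun x => by
    rw [hst.boltzmann x]; ring⟩

lemma pos (hM : 0 < M) (hst : IsStationary M (harmonicPotential μ) n c) (x : Plane) : 0 < n x := by
  obtain ⟨κ, hκ, h⟩ := hst.exists_eq_exp hM
  rw [h]
  positivity

lemma contDiff_density (hM : 0 < M) (hst : IsStationary M (harmonicPotential μ) n c) :
    ContDiff ℝ 2 n := by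
  obtain ⟨κ, hκ, h⟩ := hst.exists_eq_exp hM
  rw [funext h]
  exact contDiff_const.mul (hst.contDiff.neg.sub (contDiff_harmonicPotential μ)).exp

lemma integrable_density (hM : 0 < M) (hst : IsStationary M (harmonicPotential μ) n c) :
    Integrable n := by
  obtain ⟨κ, hκ, h⟩ := hst.exists_eq_exp hM
  rw [funext h]
  exact hst.integrable.const_mul κ

lemma integral_density (hst : IsStationary M (harmonicPotential μ) n c) : ∫ x, n x = M := by
  have hZ := integral_exp_pos hst.integrable
  simp_rw [hst.boltzmann]
  rw [integral_const_mul, integral_div, div_self hZ.ne', mul_one]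

lemma fderiv_density (hM : 0 < M) (hst : IsStationary M (harmonicPotential μ) n c)
    (x e : Plane) : fderiv ℝ n x e = -(fderiv ℝ c x e + μ * inner ℝ x e) * n x := by
  obtain ⟨κ, hκ, h⟩ := hst.exists_eq_exp hM
  have h1 := (((hst.contDiff.differentiable two_ne_zero x).hasFDerivAt.neg.sub
    (hasFDerivAt_harmonicPotential μ x)).exp).const_mul κ
  have h2 : (fun y => κ * Real.exp ((-c - harmonicPotential μ) y)) = n := funext fun y => (h y).symm
  rw [h2] at h1
  rw [h1.fderiv, h x]
  simp
  ring

/-- The potential grows at most logarithmically; a linear bound is enough. -/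
lemma exists_neg_potential_le (hM : 0 < M) (hst : IsStationary M (harmonicPotential μ) n c) :
    ∃ A, 0 ≤ A ∧ ∀ x, -c x ≤ A * (1 + ‖x‖) := by
  have hn := hst.integrable_density hM
  set L := ∫ y, 2 * Real.pi * |green (0 - y) * n y|
  have hL : Integrable fun y => 2 * Real.pi * |green (0 - y) * n y| :=
    (hst.integrable_green 0).abs.const_mul _
  have hL0 : 0 ≤ L := integral_nonneg fun y => by positivity
  refine ⟨M + L, by positivity, fun x => ?_⟩
  have h1 : c x = ∫ y, green (x - y) * n y := congrFun hst.eq_invLaplacian x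
  rw [h1, ← integral_neg]
  have hx := norm_nonneg x
  have h2 : ∀ y, -(green (x - y) * n y) ≤
      (‖x‖ + 1) * n y + 2 * Real.pi * |green (0 - y) * n y| := by
    intro y
    have hny := hst.pos hM y
    have e1 : 2 * Real.pi * |green (0 - y) * n y| = |Real.log ‖y‖| * n y := by
      rw [green, abs_mul, abs_mul, abs_neg, abs_of_pos hny, zero_sub, norm_neg,
        abs_of_nonneg (by positivity : 0 ≤ 1 / (2 * Real.pi))]
      field_simp
    rw [e1]
    have h3 := log_norm_sub_le x y
    have h4 : 0 ≤ ‖x‖ + (1 + |Real.log ‖y‖|) := by positivity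
    calc -(green (x - y) * n y) = 1 / (2 * Real.pi) * Real.log ‖x - y‖ * n y := by
          rw [green]; ring
      _ ≤ 1 / (2 * Real.pi) * (‖x‖ + (1 + |Real.log ‖y‖|)) * n y := by gcongr
      _ ≤ 1 * (‖x‖ + (1 + |Real.log ‖y‖|)) * n y := by gcongr; exact one_div_two_pi_le_one
      _ = _ := by ring
  refine (integral_mono (hst.integrable_green x).neg ((hn.const_mul _).add hL) h2).trans ?_
  simp only [Pi.add_apply]
  rw [integral_add (hn.const_mul _) hL, integral_const_mul, hst.integral_density]
  nlinarith

/-- The confinement makes the stationary density decay like a Gaussian. -/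
lemma isRapidWeight (hμ : 0 < μ) (hM : 0 < M)
    (hst : IsStationary M (harmonicPotential μ) n c) : IsRapidWeight n := by
  refine ⟨(hst.contDiff_density hM).continuous, hst.pos hM, fun N => ?_⟩
  obtain ⟨κ, hκ, h⟩ := hst.exists_eq_exp hM
  obtain ⟨A, hA, hc⟩ := hst.exists_neg_potential_le hM
  refine ⟨κ * (Real.exp (A + A ^ 2 / μ + μ / 4) * (N.factorial * (4 / μ) ^ N)), by positivity,
    fun x => ?_⟩
  set s := 1 + ‖x‖ ^ 2 with hs
  have hs0 : 0 < s := by positivity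
  have h1 : -c x - harmonicPotential μ x ≤ (A + A ^ 2 / μ + μ / 4) - μ / 4 * s := by
    have h2 : A * ‖x‖ ≤ A ^ 2 / μ + μ / 4 * ‖x‖ ^ 2 := by
      have : A ^ 2 / μ + μ / 4 * ‖x‖ ^ 2 - A * ‖x‖ = (A - μ / 2 * ‖x‖) ^ 2 / μ := by
        field_simp; ring
      have h3 : 0 ≤ (A - μ / 2 * ‖x‖) ^ 2 / μ := by positivity
      linarith
    have h4 := hc x
    rw [harmonicPotential, hs]
    linarith
  have h2 : s ^ N * Real.exp (-(μ / 4 * s)) ≤ N.factorial * (4 / μ) ^ N := by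
    have h3 := Real.pow_div_factorial_le_exp (μ / 4 * s) (by positivity) N
    rw [div_le_iff₀ (by positivity)] at h3
    rw [Real.exp_neg, ← div_eq_mul_inv, div_le_iff₀ (Real.exp_pos _)]
    calc s ^ N = (4 / μ) ^ N * (μ / 4 * s) ^ N := by rw [← mul_pow]; congr 1; field_simp
      _ ≤ (4 / μ) ^ N * (Real.exp (μ / 4 * s) * N.factorial) := by gcongr
      _ = _ := by ring
  rw [h x, inv_pow, ← div_eq_mul_inv, le_div_iff₀ (by positivity), mul_assoc]
  refine mul_le_mul_of_nonneg_left ?_ hκ.le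
  calc Real.exp (-c x - harmonicPotential μ x) * s ^ N
      ≤ Real.exp ((A + A ^ 2 / μ + μ / 4) - μ / 4 * s) * s ^ N := by gcongr
    _ = Real.exp (A + A ^ 2 / μ + μ / 4) * (s ^ N * Real.exp (-(μ / 4 * s))) := by
        rw [sub_eq_add_neg, Real.exp_add]; ring
    _ ≤ _ := mul_le_mul_of_nonneg_left h2 (Real.exp_pos _).le

/-- At infinity the potential is that of a point mass at the origin. -/
lemma exists_abs_potential_sub_le (hμ : 0 < μ) (hM : 0 < M)
    (hst : IsStationary M (harmonicPotential μ) n c) :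
    ∃ C, ∀ x, x ≠ 0 → |c x - M * green x| ≤ C * ‖x‖⁻¹ := by
  have hw := hst.isRapidWeight hμ hM
  have hn := hw.integrable
  obtain ⟨C₀, hC₀, hCb⟩ := exists_integral_japanese_div_le
  obtain ⟨B, hB, hBn⟩ := hw.decay 2
  set J := ∫ y, 2 * ((1 + ‖y‖ ^ 2) ^ 1 * n y)
  have hJ : Integrable fun y => 2 * ((1 + ‖y‖ ^ 2) ^ 1 * n y) := (hw.integrable_pow 1).const_mul 2
  refine ⟨B * C₀ + J, fun x hx => ?_⟩
  have hx' : 0 < ‖x‖ := norm_pos_iff.2 hx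
  have h1 : c x - M * green x = ∫ y, (green (x - y) * n y - green x * n y) := by
    rw [integral_sub (hst.integrable_green x) (hn.const_mul _), integral_const_mul,
      hst.integral_density, congrFun hst.eq_invLaplacian x, invLaplacian, mul_comm M]
  have hne : ∀ᵐ y : Plane, x ≠ y := by simp [ae_iff]
  have h2 : ∀ᵐ y, ‖green (x - y) * n y - green x * n y‖ ≤
      ‖x‖⁻¹ * (B * ((1 + ‖y‖ ^ 2)⁻¹ * ‖x - y‖⁻¹) + 2 * ((1 + ‖y‖ ^ 2) ^ 1 * n y)) := by
    filter_upwards [hne] with y hy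
    have hny := hst.pos hM y
    have hz : 0 < ‖x - y‖ := norm_pos_iff.2 (sub_ne_zero.2 hy)
    have e1 : |green (x - y) - green x| ≤ ‖y‖ * (‖x - y‖⁻¹ + ‖x‖⁻¹) := by
      have e2 : green (x - y) - green x =
          -(1 / (2 * Real.pi)) * (Real.log ‖x - y‖ - Real.log ‖x‖) := by rw [green, green]; ring
      rw [e2, abs_mul, abs_neg, abs_of_nonneg (by positivity : 0 ≤ 1 / (2 * Real.pi))]
      calc _ ≤ 1 * (|‖x - y‖ - ‖x‖| * (‖x - y‖⁻¹ + ‖x‖⁻¹)) := by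
            gcongr
            · exact one_div_two_pi_le_one
            · exact abs_log_sub_log_le hz hx'
        _ ≤ 1 * (‖y‖ * (‖x - y‖⁻¹ + ‖x‖⁻¹)) := by
            gcongr
            have := abs_norm_sub_norm_le (x - y) x
            simpa using this
        _ = _ := one_mul _
    -- `|x| ≤ |y| + |x - y|` trades a factor `|x - y|⁻¹` for `|x|⁻¹`
    have e3 : ‖x - y‖⁻¹ ≤ ‖x‖⁻¹ * (‖y‖ * ‖x - y‖⁻¹ + 1) := by
      have : ‖x‖ ≤ ‖y‖ + ‖x - y‖ := by
        have := norm_add_le y (x - y); simpa using this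
      have e4 : ‖x‖⁻¹ * (‖y‖ * ‖x - y‖⁻¹ + 1) - ‖x - y‖⁻¹ =
          ‖x‖⁻¹ * ‖x - y‖⁻¹ * (‖y‖ + ‖x - y‖ - ‖x‖) := by field_simp
      have e5 : 0 ≤ ‖x‖⁻¹ * ‖x - y‖⁻¹ * (‖y‖ + ‖x - y‖ - ‖x‖) :=
        mul_nonneg (by positivity) (by linarith)
      linarith
    have hy0 := norm_nonneg y
    rw [← sub_mul, norm_mul, Real.norm_of_nonneg hny.le, Real.norm_eq_abs]
    calc |green (x - y) - green x| * n y
        ≤ ‖y‖ * (‖x‖⁻¹ * (‖y‖ * ‖x - y‖⁻¹ + 1) + ‖x‖⁻¹) * n y := by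
          gcongr
          exact e1.trans (by gcongr)
      _ = ‖x‖⁻¹ * (‖y‖ ^ 2 * ‖x - y‖⁻¹ * n y + 2 * (‖y‖ * n y)) := by ring
      _ ≤ ‖x‖⁻¹ * ((1 + ‖y‖ ^ 2) * ‖x - y‖⁻¹ * (B * ((1 + ‖y‖ ^ 2)⁻¹) ^ 2)
            + 2 * ((1 + ‖y‖ ^ 2) ^ 1 * n y)) := by
          gcongr
          · linarith
          · exact hBn y
          · rw [pow_one]; nlinarith [sq_nonneg (‖y‖ - 1)]
      _ = _ := by field_simp
  have hint := (integrable_japanese_div x).const_mul B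
  rw [h1, ← Real.norm_eq_abs]
  refine (norm_integral_le_of_norm_le ((hint.add hJ).const_mul ‖x‖⁻¹) h2).trans ?_
  simp only [Pi.add_apply]
  rw [integral_const_mul, integral_add hint hJ, integral_const_mul, mul_comm]
  gcongr
  exact hCb x

/-- Radial symmetry, by the maximum principle for the difference of the potential and its image
under an isometry. -/
lemma potential_comp_isometry (hμ : 0 < μ) (hM : 0 < M)
    (hst : IsStationary M (harmonicPotential μ) n c) (R : Plane ≃ₗᵢ[ℝ] Plane) (x : Plane) :
    c (R x) = c x := by
  obtain ⟨κ, hκ, h⟩ := hst.exists_eq_exp hM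
  have key : ∀ (R : Plane ≃ₗᵢ[ℝ] Plane) (x : Plane), c x ≤ c (R x) := by
    intro R x₀
    by_contra! hlt
    set w : Plane → ℝ := fun x => c x - c (R x)
    have hcR : ContDiff ℝ 2 fun x => c (R x) := hst.contDiff.comp R.contDiff
    have hw : ContDiff ℝ 2 w := hst.contDiff.sub hcR
    obtain ⟨C, hC⟩ := hst.exists_abs_potential_sub_le hμ hM
    have hw0 : Tendsto w (cocompact Plane) (𝓝 0) := by
      have h1 : Tendsto (fun x : Plane => 2 * C * ‖x‖⁻¹) (cocompact Plane) (𝓝 (2 * C * 0)) :=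
        (tendsto_inv_atTop_zero.comp (tendsto_norm_cocompact_atTop (E := Plane))).const_mul _
      rw [mul_zero] at h1
      refine squeeze_zero_norm' ?_ h1
      filter_upwards [(isCompact_singleton (x := (0 : Plane))).compl_mem_cocompact] with x hx
      have hx0 : x ≠ 0 := hx
      have hRx : R x ≠ 0 := by simpa using hx0
      have h2 := hC x hx0
      have h3 := hC (R x) hRx
      have h4 : green (R x) = green x := by simp [green]
      rw [h4, R.norm_map] at h3
      have h5 : w x = (c x - M * green x) - (c (R x) - M * green x) := by simp only [w]; ring
      rw [h5, Real.norm_eq_abs]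
      exact (abs_sub _ _).trans (by linarith)
    have hpos : 0 < w x₀ := sub_pos.2 hlt
    obtain ⟨x₁, hx₁⟩ := hw.continuous.exists_forall_ge' x₀
      ((hw0.eventually (gt_mem_nhds hpos)).mono fun x hx => hx.le)
    have hmax : IsLocalMax w x₁ := Eventually.of_forall hx₁
    have hΔ := laplacian_nonpos_of_isLocalMax hw hmax
    have e1 : Laplacian.laplacian w x₁ = n (R x₁) - n x₁ := by
      have : w = c - fun x => c (R x) := rfl
      rw [this, hst.contDiff.contDiffAt.laplacian_sub hcR.contDiffAt,
        laplacian_comp_isometry hst.contDiff]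
      linarith [hst.poisson x₁, hst.poisson (R x₁)]
    have e2 : n x₁ < n (R x₁) := by
      have h2 : c (R x₁) < c x₁ := by have := hpos.trans_le (hx₁ x₀); simpa [w] using this
      have h3 : harmonicPotential μ (R x₁) = harmonicPotential μ x₁ := by simp [harmonicPotential]
      rw [h, h, h3]
      gcongr
    linarith
  refine le_antisymm ?_ (key R x)
  simpa using key R.symm (R x)

lemma potential_eq_of_norm_eq (hμ : 0 < μ) (hM : 0 < M)
    (hst : IsStationary M (harmonicPotential μ) n c) {x y : Plane} (hxy : ‖x‖ = ‖y‖) :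
    c x = c y := by
  have := hst.potential_comp_isometry hμ hM ((Submodule.span ℝ {x - y})ᗮ.reflection) x
  rw [Submodule.reflection_sub hxy] at this
  exact this.symm

lemma density_eq_of_norm_eq (hμ : 0 < μ) (hM : 0 < M)
    (hst : IsStationary M (harmonicPotential μ) n c) {x y : Plane} (hxy : ‖x‖ = ‖y‖) :
    n x = n y := by
  obtain ⟨κ, hκ, h⟩ := hst.exists_eq_exp hM
  rw [h, h, hst.potential_eq_of_norm_eq hμ hM hxy, harmonicPotential, harmonicPotential, hxy]

/-- The density does not exceed `2 μ`, by the maximum principle for `log n`. -/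
lemma density_le (hμ : 0 < μ) (hM : 0 < M)
    (hst : IsStationary M (harmonicPotential μ) n c) (x : Plane) : n x ≤ 2 * μ := by
  obtain ⟨κ, hκ, h⟩ := hst.exists_eq_exp hM
  have hw := hst.isRapidWeight hμ hM
  obtain ⟨C, hC, hCn⟩ := hw.decay 1
  have hn0 : Tendsto n (cocompact Plane) (𝓝 0) := by
    have h1 : Tendsto (fun x : Plane => C * ((1 + ‖x‖ ^ 2)⁻¹) ^ 1) (cocompact Plane)
        (𝓝 (C * 0 ^ 1)) := by
      refine ((tendsto_inv_atTop_zero.comp ?_).pow 1).const_mul C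
      exact tendsto_atTop_add_const_left _ _
        ((tendsto_pow_atTop two_ne_zero).comp (tendsto_norm_cocompact_atTop (E := Plane)))
    simp only [pow_one, mul_zero] at h1
    exact squeeze_zero (fun x => (hst.pos hM x).le) (fun x => by simpa using hCn x) h1
  obtain ⟨x₁, hx₁⟩ := hw.continuous.exists_forall_ge' 0
    ((hn0.eventually (gt_mem_nhds (hst.pos hM 0))).mono fun x hx => hx.le)
  refine (hx₁ x).trans ?_
  set u : Plane → ℝ := -c - harmonicPotential μ
  have hu : ContDiff ℝ 2 u := hst.contDiff.neg.sub (contDiff_harmonicPotential μ)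
  have hmax : IsLocalMax u x₁ := Eventually.of_forall fun y => by
    have := hx₁ y
    rw [h, h] at this
    exact Real.exp_le_exp.1 (le_of_mul_le_mul_left this hκ)
  have hΔ := laplacian_nonpos_of_isLocalMax hu hmax
  have h1 : Laplacian.laplacian u x₁ = n x₁ - 2 * μ := by
    have hc : ContDiffAt ℝ 2 (-c) x₁ := hst.contDiff.neg.contDiffAt
    rw [hc.laplacian_sub (contDiff_harmonicPotential μ).contDiffAt,
      InnerProductSpace.laplacian_neg, laplacian_harmonicPotential, Pi.neg_apply, hst.poisson]
  linarith

end IsStationary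

end

/-! ### The radial profile of the stationary solution -/

section

section PolarDerivatives

variable {u : Plane → ℝ}

lemma hasDerivAt_radial (hu : Differentiable ℝ u) (r θ : ℝ) :
    HasDerivAt (fun r : ℝ => u (r • er θ)) (fderiv ℝ u (r • er θ) (er θ)) r := by
  have h1 : HasDerivAt (fun t : ℝ => t • er θ) ((1 : ℝ) • er θ) r :=
    (hasDerivAt_id r).smul_const (er θ)
  rw [one_smul] at h1
  exact (hu (r • er θ)).hasFDerivAt.comp_hasDerivAt r h1

lemma hasDerivAt_radial_radial (hu : ContDiff ℝ 2 u) (r θ : ℝ) :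
    HasDerivAt (fun r : ℝ => fderiv ℝ u (r • er θ) (er θ))
      (fderiv ℝ (fderiv ℝ u) (r • er θ) (er θ) (er θ)) r := by
  simpa using hasDerivAt_fderiv_line hu 0 (er θ) (er θ) r

lemma hasDerivAt_angular (hu : Differentiable ℝ u) (r θ : ℝ) :
    HasDerivAt (fun θ : ℝ => u (r • er θ)) (r * fderiv ℝ u (r • er θ) (et θ)) θ := by
  have h := (hu (r • er θ)).hasFDerivAt.comp_hasDerivAt θ ((hasDerivAt_er θ).const_smul r)
  rw [map_smul, smul_eq_mul] at h
  exact h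

lemma hasDerivAt_angular_angular (hu : ContDiff ℝ 2 u) (r θ : ℝ) :
    HasDerivAt (fun θ : ℝ => fderiv ℝ u (r • er θ) (et θ))
      (r * fderiv ℝ (fderiv ℝ u) (r • er θ) (et θ) (et θ) - fderiv ℝ u (r • er θ) (er θ)) θ := by
  have h1 := (hasFDerivAt_fderiv hu (r • er θ)).comp_hasDerivAt θ
    ((hasDerivAt_er θ).const_smul r)
  have h2 := h1.clm_apply (hasDerivAt_et θ)
  refine h2.congr_deriv ?_
  simp only [map_smul, map_neg, FunLike.coe_smul, Pi.smul_apply, smul_eq_mul,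
    Function.comp_apply]
  ring

end PolarDerivatives

namespace IsStationary

variable {μ M : ℝ} {n c : Plane → ℝ}

/-- The mass of the disc of radius `r` divided by `2π`, read off from the flux `-r ∂ᵣ c`. -/
noncomputable def mass (c : Plane → ℝ) (r : ℝ) : ℝ := -(r * fderiv ℝ c (r • er 0) (er 0))

lemma norm_smul_er (r θ : ℝ) : ‖r • er θ‖ = |r| := by
  rw [norm_smul, norm_er, mul_one, Real.norm_eq_abs]

lemma fderiv_potential_radial (hμ : 0 < μ) (hM : 0 < M)
    (hst : IsStationary M (harmonicPotential μ) n c) (r θ : ℝ) :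
    fderiv ℝ c (r • er θ) (er θ) = fderiv ℝ c (r • er 0) (er 0) := by
  have hd := hst.contDiff.differentiable two_ne_zero
  have h1 := hasDerivAt_radial hd r θ
  have h2 := hasDerivAt_radial hd r 0
  have h3 : (fun r : ℝ => c (r • er θ)) = fun r : ℝ => c (r • er 0) := funext fun r =>
    hst.potential_eq_of_norm_eq hμ hM (by rw [norm_smul_er, norm_smul_er])
  rw [h3] at h1
  exact h1.unique h2

lemma fderiv_potential_angular (hμ : 0 < μ) (hM : 0 < M)
    (hst : IsStationary M (harmonicPotential μ) n c) (r θ : ℝ) :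
    r * fderiv ℝ c (r • er θ) (et θ) = 0 := by
  have hd := hst.contDiff.differentiable two_ne_zero
  have h1 := hasDerivAt_angular hd r θ
  have h3 : (fun θ : ℝ => c (r • er θ)) = fun _ : ℝ => c (r • er 0) := funext fun θ =>
    hst.potential_eq_of_norm_eq hμ hM (by rw [norm_smul_er, norm_smul_er])
  rw [h3] at h1
  exact h1.unique (hasDerivAt_const θ _)

/-- The rotational invariance determines the tangential second derivative. -/
lemma fderiv_fderiv_potential_angular (hμ : 0 < μ) (hM : 0 < M)
    (hst : IsStationary M (harmonicPotential μ) n c) {r : ℝ} (hr : r ≠ 0) (θ : ℝ) :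
    r * fderiv ℝ (fderiv ℝ c) (r • er θ) (et θ) (et θ) = fderiv ℝ c (r • er 0) (er 0) := by
  have h1 := hasDerivAt_angular_angular hst.contDiff r θ
  have h3 : (fun θ : ℝ => fderiv ℝ c (r • er θ) (et θ)) = fun _ : ℝ => (0 : ℝ) := funext fun θ =>
    (mul_eq_zero.1 (hst.fderiv_potential_angular hμ hM r θ)).resolve_left hr
  rw [h3] at h1
  have := h1.unique (hasDerivAt_const θ _)
  rw [hst.fderiv_potential_radial hμ hM] at this
  linarith

lemma hasDerivAt_mass (hμ : 0 < μ) (hM : 0 < M)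
    (hst : IsStationary M (harmonicPotential μ) n c) {r : ℝ} (hr : r ≠ 0) :
    HasDerivAt (mass c) (n (r • er 0) * r) r := by
  have h1 := ((hasDerivAt_id r).mul (hasDerivAt_radial_radial hst.contDiff r 0)).neg
  refine h1.congr_deriv ?_
  have h2 := hst.poisson (r • er 0)
  rw [laplacian_eq_polar _ _ 0] at h2
  have h3 := hst.fderiv_fderiv_potential_angular hμ hM hr 0
  rw [← h2]
  simp only [id, one_mul]
  linarith

/-- The field of the stationary solution is radial. -/
lemma gradient_potential (hμ : 0 < μ) (hM : 0 < M)
    (hst : IsStationary M (harmonicPotential μ) n c) {x : Plane} (hx : x ≠ 0) :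
    gradient c x = -(mass c ‖x‖ / ‖x‖ ^ 2) • x := by
  obtain ⟨θ, hθ⟩ := exists_polar x
  have hr : 0 < ‖x‖ := norm_pos_iff.2 hx
  set r := ‖x‖
  have h1 := hst.fderiv_potential_radial hμ hM r θ
  have h2 := (mul_eq_zero.1 (hst.fderiv_potential_angular hμ hM r θ)).resolve_left hr.ne'
  have h3 : ‖gradient c x + (mass c r / r ^ 2) • x‖ ^ 2 = 0 := by
    rw [norm_sq_eq_polar _ θ, inner_add_left, inner_add_left, inner_gradient_left,
      inner_gradient_left, hθ, h1, h2, real_inner_smul_left, real_inner_smul_left,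
      real_inner_smul_left, real_inner_smul_left, inner_er_et, real_inner_self_eq_norm_sq, norm_er,
      mass]
    field_simp
    ring
  have h4 : gradient c x + (mass c r / r ^ 2) • x = 0 := by simpa using h3
  rw [neg_smul]
  exact eq_neg_of_add_eq_zero_left h4

lemma continuous_mass (hst : IsStationary M (harmonicPotential μ) n c) : Continuous (mass c) := by
  have h := hst.contDiff.continuous_fderiv two_ne_zero
  have h1 : Continuous fun r : ℝ => fderiv ℝ c (r • er 0) (er 0) :=
    (h.comp (continuous_id.smul continuous_const)).clm_apply continuous_const
  exact (continuous_id.mul h1).neg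

/-- The bound `m ≤ μ r²` is the integrated form of `n ≤ 2 μ`. -/
lemma radialProfile (hμ : 0 < μ) (hM : 0 < M)
    (hst : IsStationary M (harmonicPotential μ) n c) :
    RadialProfile μ (fun r => n (r • er 0)) (mass c) := by
  have hn2 := hst.contDiff_density hM
  have hncont : Continuous fun r : ℝ => n (r • er 0) :=
    hn2.continuous.comp (continuous_id.smul continuous_const)
  have hm0 : mass c 0 = 0 := by simp [mass]
  have hmc := hst.continuous_mass
  refine ⟨fun r _ => hst.pos hM _, fun r hr => ?_, fun r hr => hst.hasDerivAt_mass hμ hM hr.ne',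
    fun r hr => ?_, fun r hr => ?_, ⟨n 0, hst.pos hM 0, ?_⟩, ⟨n 0 / 2, half_pos (hst.pos hM 0), ?_⟩⟩
  · have h1 : StrictMonoOn (mass c) (Ici 0) := by
      refine strictMonoOn_of_deriv_pos (convex_Ici 0) hmc.continuousOn fun x hx => ?_
      rw [interior_Ici] at hx
      rw [(hst.hasDerivAt_mass hμ hM (ne_of_gt hx)).deriv]
      exact mul_pos (hst.pos hM _) hx
    have := h1 self_mem_Ici (mem_Ici.2 hr.le) hr
    rwa [hm0] at this
  · refine (hasDerivAt_radial (hn2.differentiable two_ne_zero) r 0).congr_deriv ?_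
    rw [hst.fderiv_density hM, real_inner_smul_left, real_inner_self_eq_norm_sq, norm_er, mass]
    field_simp
    ring
  · have h1 : MonotoneOn (fun r => μ * r ^ 2 - mass c r) (Ici 0) := by
      refine monotoneOn_of_deriv_nonneg (convex_Ici 0) (by fun_prop) (fun x hx => ?_) fun x hx => ?_
      all_goals
        rw [interior_Ici] at hx
        have hd := ((hasDerivAt_pow 2 x).const_mul μ).sub (hst.hasDerivAt_mass hμ hM (ne_of_gt hx))
      · exact hd.differentiableAt.differentiableWithinAt
      · have h2 := hst.density_le hμ hM (x • er 0)
        have h3 : deriv (fun r => μ * r ^ 2 - mass c r) x = _ := hd.deriv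
        rw [h3]
        have hx0 : 0 < x := hx
        simp
        nlinarith
    have := h1 self_mem_Ici (mem_Ici.2 hr.le) hr.le
    simp only [hm0] at this
    linarith
  · simpa using (hncont.tendsto 0).mono_left nhdsWithin_le_nhds
  · refine HasDerivAt.lhopital_zero_nhdsGT (f' := fun r => n (r • er 0) * r)
      (g' := fun r => 2 * r) ?_ ?_ ?_ ?_ ?_ ?_
    · filter_upwards [self_mem_nhdsWithin] with r hr
      exact hst.hasDerivAt_mass hμ hM (ne_of_gt hr)
    · exact Eventually.of_forall fun r => by simpa using hasDerivAt_pow 2 r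
    · filter_upwards [self_mem_nhdsWithin] with r hr
      have : 0 < r := hr
      positivity
    · simpa [hm0] using (hmc.tendsto 0).mono_left nhdsWithin_le_nhds
    · simpa using ((continuous_pow 2).tendsto (0 : ℝ)).mono_left nhdsWithin_le_nhds
    · have h1 : Tendsto (fun r : ℝ => n (r • er 0) / 2) (𝓝[>] 0) (𝓝 (n 0 / 2)) := by
        simpa using ((hncont.tendsto 0).mono_left nhdsWithin_le_nhds).div_const 2
      refine h1.congr' ?_
      filter_upwards [self_mem_nhdsWithin] with r hr
      have : r ≠ 0 := ne_of_gt hr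
      field_simp

end IsStationary

end

/-! ### Polar integration and angular modes -/

section

lemma repr_polarCoord_symm (p : ℝ × ℝ) :
    Complex.orthonormalBasisOneI.repr (Complex.polarCoord.symm p) = p.1 • er p.2 := by
  ext i
  rw [Complex.orthonormalBasisOneI_repr_apply, Complex.polarCoord_symm_apply]
  fin_cases i <;> simp [er, Complex.cos_ofReal_re, Complex.sin_ofReal_re, Complex.cos_ofReal_im,
    Complex.sin_ofReal_im]

lemma continuous_polar : Continuous fun p : ℝ × ℝ => p.1 • er p.2 :=
  continuous_fst.smul (continuous_er.comp continuous_snd)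

/-- Polar coordinates in the plane. -/
lemma lintegral_polar {F : Plane → ℝ≥0∞} (hF : Measurable F) :
    ∫⁻ x, F x = ∫⁻ r in Ioi (0 : ℝ), ∫⁻ θ in Ioc (-Real.pi) Real.pi,
      ENNReal.ofReal r * F (r • er θ) := by
  have h1 := Complex.orthonormalBasisOneI.repr.measurePreserving.lintegral_comp hF
  rw [← h1, ← Complex.lintegral_comp_polarCoord_symm]
  simp_rw [repr_polarCoord_symm, smul_eq_mul]
  rw [show polarCoord.target = Ioi (0 : ℝ) ×ˢ Ioo (-Real.pi) Real.pi from rfl,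
    Measure.volume_eq_prod, setLIntegral_prod]
  · simp_rw [Measure.restrict_congr_set Ioo_ae_eq_Ioc]
  · exact (Measurable.mul (by fun_prop) (hF.comp continuous_polar.measurable)).aemeasurable

lemma integral_polar {f : Plane → ℝ} (hf : Integrable f) (hm : Measurable f) :
    IntegrableOn (fun r => ∫ θ in (-Real.pi)..Real.pi, r * f (r • er θ)) (Ioi 0) ∧
    ∫ x, f x = ∫ r in Ioi (0 : ℝ), ∫ θ in (-Real.pi)..Real.pi, r * f (r • er θ) := by
  have hpi : -Real.pi ≤ Real.pi := by linarith [Real.pi_pos]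
  have h1 := Complex.orthonormalBasisOneI.repr.measurePreserving.integral_comp
    Complex.orthonormalBasisOneI.repr.toHomeomorph.measurableEmbedding f
  have hint : Integrable (fun p : ℝ × ℝ => p.1 * f (p.1 • er p.2))
      ((volume.restrict (Ioi (0 : ℝ))).prod (volume.restrict (Ioc (-Real.pi) Real.pi))) := by
    refine ⟨(measurable_fst.mul (hm.comp continuous_polar.measurable)).aestronglyMeasurable, ?_⟩
    rw [hasFiniteIntegral_iff_enorm, lintegral_prod]
    · have h2 := hf.2
      rw [hasFiniteIntegral_iff_enorm, lintegral_polar hm.enorm] at h2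
      refine lt_of_le_of_lt (le_of_eq ?_) h2
      refine setLIntegral_congr_fun measurableSet_Ioi fun r hr => ?_
      simp only
      refine lintegral_congr fun θ => ?_
      rw [enorm_mul, Real.enorm_of_nonneg (le_of_lt hr)]
    · exact (measurable_fst.mul (hm.comp continuous_polar.measurable)).enorm.aemeasurable
  refine ⟨?_, ?_⟩
  · have := hint.integral_prod_left
    simp_rw [intervalIntegral.integral_of_le hpi]
    exact this
  · rw [← h1, ← Complex.integral_comp_polarCoord_symm]
    simp_rw [repr_polarCoord_symm, smul_eq_mul]
    rw [show polarCoord.target = Ioi (0 : ℝ) ×ˢ Ioo (-Real.pi) Real.pi from rfl,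
      Measure.volume_eq_prod, ← Measure.prod_restrict,
      Measure.restrict_congr_set Ioo_ae_eq_Ioc, integral_prod _ hint]
    simp_rw [intervalIntegral.integral_of_le hpi]

/-- Differentiation under an integral over a compact interval. -/
lemma hasDerivAt_intervalIntegral_param {F F' : ℝ → ℝ → ℝ} (hF : Continuous (Function.uncurry F))
    (hF' : Continuous (Function.uncurry F')) (h : ∀ r θ, HasDerivAt (fun r => F r θ) (F' r θ) r)
    (a b r : ℝ) :
    HasDerivAt (fun r => ∫ θ in a..b, F r θ) (∫ θ in a..b, F' r θ) r := by
  obtain ⟨C, hC⟩ :=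
    (isCompact_Icc (a := r - 1) (b := r + 1)).prod (isCompact_uIcc (a := a) (b := b))
    |>.exists_bound_of_continuousOn hF'.continuousOn
  have hc : ∀ r, Continuous (F r) := fun r => hF.comp (continuous_const.prodMk continuous_id)
  have hc' : ∀ r, Continuous (F' r) := fun r => hF'.comp (continuous_const.prodMk continuous_id)
  refine (intervalIntegral.hasDerivAt_integral_of_dominated_loc_of_deriv_le (bound := fun _ => C)
    (Icc_mem_nhds (by linarith : r - 1 < r) (by linarith : r < r + 1))
    (Eventually.of_forall fun r => (hc r).aestronglyMeasurable) ((hc r).intervalIntegrable _ _)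
    (hc' r).aestronglyMeasurable (Eventually.of_forall fun θ hθ s hs => ?_)
    intervalIntegrable_const (Eventually.of_forall fun θ _ s _ => h s θ)).2
  exact hC (s, θ) ⟨hs, uIoc_subset_uIcc hθ⟩

/-- The angular mode `∫ u(r, θ) χ(θ) dθ`. -/
noncomputable def mode (χ : ℝ → ℝ) (u : Plane → ℝ) (r : ℝ) : ℝ :=
  ∫ θ in (-Real.pi)..Real.pi, u (r • er θ) * χ θ

/-- The radial derivative of an angular mode. -/
noncomputable def modeDeriv (χ : ℝ → ℝ) (u : Plane → ℝ) (r : ℝ) : ℝ :=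
  ∫ θ in (-Real.pi)..Real.pi, fderiv ℝ u (r • er θ) (er θ) * χ θ

/-- A periodic eigenfunction `χ'' = -k² χ` on the circle. -/
structure IsAngular (k : ℕ) (χ χ' : ℝ → ℝ) : Prop where
  hasDerivAt : ∀ θ, HasDerivAt χ (χ' θ) θ
  hasDerivAt_deriv : ∀ θ, HasDerivAt χ' (-(k ^ 2 * χ θ)) θ
  periodic : χ (-Real.pi) = χ Real.pi
  periodic_deriv : χ' (-Real.pi) = χ' Real.pi

lemma isAngular_cos (k : ℕ) :
    IsAngular k (fun θ => Real.cos (k * θ)) (fun θ => -(k * Real.sin (k * θ))) where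
  hasDerivAt θ := by
    refine (((hasDerivAt_id θ).const_mul (k : ℝ)).cos).congr_deriv ?_
    simp; ring
  hasDerivAt_deriv θ := by
    refine ((((hasDerivAt_id θ).const_mul (k : ℝ)).sin).const_mul (k : ℝ)).neg.congr_deriv ?_
    simp; ring
  periodic := by simp
  periodic_deriv := by simp [Real.sin_nat_mul_pi]

lemma isAngular_sin (k : ℕ) :
    IsAngular k (fun θ => Real.sin (k * θ)) (fun θ => k * Real.cos (k * θ)) where
  hasDerivAt θ := by
    refine (((hasDerivAt_id θ).const_mul (k : ℝ)).sin).congr_deriv ?_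
    simp; ring
  hasDerivAt_deriv θ := by
    refine ((((hasDerivAt_id θ).const_mul (k : ℝ)).cos).const_mul (k : ℝ)).congr_deriv ?_
    simp; ring
  periodic := by simp [Real.sin_nat_mul_pi]
  periodic_deriv := by simp

namespace IsAngular

variable {k : ℕ} {χ χ' : ℝ → ℝ}

lemma continuous (h : IsAngular k χ χ') : Continuous χ :=
  continuous_iff_continuousAt.2 fun θ => (h.hasDerivAt θ).continuousAt

lemma continuous_deriv (h : IsAngular k χ χ') : Continuous χ' :=
  continuous_iff_continuousAt.2 fun θ => (h.hasDerivAt_deriv θ).continuousAt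

lemma integral_eq_zero (h : IsAngular k χ χ') (hk : k ≠ 0) :
    ∫ θ in (-Real.pi)..Real.pi, χ θ = 0 := by
  have h1 := intervalIntegral.integral_eq_sub_of_hasDerivAt (a := -Real.pi) (b := Real.pi)
    (fun θ _ => h.hasDerivAt_deriv θ)
    ((h.continuous.const_smul (k ^ 2 : ℝ)).neg.intervalIntegrable _ _)
  rw [h.periodic_deriv, sub_self, intervalIntegral.integral_neg,
    intervalIntegral.integral_const_mul, neg_eq_zero, mul_eq_zero] at h1
  exact h1.resolve_left (by positivity)

end IsAngular

section Modes

variable {u : Plane → ℝ} {k : ℕ} {χ χ' : ℝ → ℝ}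

lemma continuous_uncurry_fderiv_er (hu : ContDiff ℝ 1 u) :
    Continuous fun p : ℝ × ℝ => fderiv ℝ u (p.1 • er p.2) (er p.2) :=
  ((hu.continuous_fderiv one_ne_zero).comp continuous_polar).clm_apply
    (continuous_er.comp continuous_snd)

lemma continuous_uncurry_fderiv_et (hu : ContDiff ℝ 1 u) :
    Continuous fun p : ℝ × ℝ => fderiv ℝ u (p.1 • er p.2) (et p.2) :=
  ((hu.continuous_fderiv one_ne_zero).comp continuous_polar).clm_apply
    (continuous_et.comp continuous_snd)

lemma continuous_mode (hu : Continuous u) (hχ : Continuous χ) : Continuous (mode χ u) :=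
  intervalIntegral.continuous_parametric_intervalIntegral_of_continuous'
    ((hu.comp continuous_polar).mul (hχ.comp continuous_snd)) _ _

lemma continuous_modeDeriv (hu : ContDiff ℝ 1 u) (hχ : Continuous χ) :
    Continuous (modeDeriv χ u) :=
  intervalIntegral.continuous_parametric_intervalIntegral_of_continuous'
    ((continuous_uncurry_fderiv_er hu).mul (hχ.comp continuous_snd)) _ _

lemma hasDerivAt_mode (hu : ContDiff ℝ 1 u) (hχ : Continuous χ) (r : ℝ) :
    HasDerivAt (mode χ u) (modeDeriv χ u r) r := by
  refine hasDerivAt_intervalIntegral_param (F := fun r θ => u (r • er θ) * χ θ)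
    (F' := fun r θ => fderiv ℝ u (r • er θ) (er θ) * χ θ)
    ((hu.continuous.comp continuous_polar).mul (hχ.comp continuous_snd))
    ((continuous_uncurry_fderiv_er hu).mul (hχ.comp continuous_snd)) (fun r θ => ?_) _ _ r
  exact (hasDerivAt_radial (hu.differentiable one_ne_zero) r θ).mul_const _

lemma mode_zero (u : Plane → ℝ) (h : IsAngular k χ χ') (hk : k ≠ 0) : mode χ u 0 = 0 := by
  simp only [mode, zero_smul]
  rw [intervalIntegral.integral_const_mul, h.integral_eq_zero hk, mul_zero]

lemma continuous_fderiv_fderiv (hu : ContDiff ℝ 2 u) : Continuous (fderiv ℝ (fderiv ℝ u)) :=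
  (hu.fderiv_right (m := 1) (by norm_num)).continuous_fderiv one_ne_zero

lemma er_neg_pi : er (-Real.pi) = er Real.pi := by simp [er]

lemma et_neg_pi : et (-Real.pi) = et Real.pi := by simp [et]

/-- Integration by parts on a circle. -/
lemma mode_angular (hu : ContDiff ℝ 1 u) (h : IsAngular k χ χ') (r : ℝ) :
    ∫ θ in (-Real.pi)..Real.pi, r * fderiv ℝ u (r • er θ) (et θ) * χ θ = -mode χ' u r := by
  have hc : Continuous fun θ => r * fderiv ℝ u (r • er θ) (et θ) :=
    ((continuous_uncurry_fderiv_et hu).comp (continuous_const.prodMk continuous_id)).const_smul r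
  have := intervalIntegral.integral_mul_deriv_eq_deriv_mul (a := -Real.pi) (b := Real.pi)
    (fun θ _ => hasDerivAt_angular (hu.differentiable one_ne_zero) r θ) (fun θ _ => h.hasDerivAt θ)
    (hc.intervalIntegrable _ _) (h.continuous_deriv.intervalIntegrable _ _)
  rw [h.periodic, er_neg_pi, sub_self, zero_sub] at this
  rw [mode, this, neg_neg]

/-- The polar form of the Laplacian, mode by mode. -/
lemma hasDerivAt_modeDeriv (hu : ContDiff ℝ 2 u) (h : IsAngular k χ χ') {r : ℝ} (hr : r ≠ 0) :
    HasDerivAt (modeDeriv χ u) (-modeDeriv χ u r / r + k ^ 2 * mode χ u r / r ^ 2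
      + mode χ (Laplacian.laplacian u) r) r := by
  have hu1 : ContDiff ℝ 1 u := hu.of_le (by norm_num)
  have hD := continuous_fderiv_fderiv hu
  have cee : Continuous fun p : ℝ × ℝ =>
      fderiv ℝ (fderiv ℝ u) (p.1 • er p.2) (er p.2) (er p.2) :=
    ((hD.comp continuous_polar).clm_apply (continuous_er.comp continuous_snd)).clm_apply
      (continuous_er.comp continuous_snd)
  have ctt : Continuous fun p : ℝ × ℝ =>
      fderiv ℝ (fderiv ℝ u) (p.1 • er p.2) (et p.2) (et p.2) :=
    ((hD.comp continuous_polar).clm_apply (continuous_et.comp continuous_snd)).clm_apply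
      (continuous_et.comp continuous_snd)
  have slice : ∀ {g : ℝ × ℝ → ℝ}, Continuous g → Continuous fun θ => g (r, θ) := fun hg =>
    hg.comp (continuous_const.prodMk continuous_id)
  have h1 : HasDerivAt (modeDeriv χ u)
      (∫ θ in (-Real.pi)..Real.pi, fderiv ℝ (fderiv ℝ u) (r • er θ) (er θ) (er θ) * χ θ) r := by
    refine hasDerivAt_intervalIntegral_param
      (F := fun r θ => fderiv ℝ u (r • er θ) (er θ) * χ θ)
      (F' := fun r θ => fderiv ℝ (fderiv ℝ u) (r • er θ) (er θ) (er θ) * χ θ)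
      ((continuous_uncurry_fderiv_er hu1).mul (h.continuous.comp continuous_snd))
      (cee.mul (h.continuous.comp continuous_snd)) (fun r θ => ?_) _ _ r
    exact (hasDerivAt_radial_radial hu r θ).mul_const _
  -- the tangential part, by two integrations by parts on the circle
  have h2 : ∫ θ in (-Real.pi)..Real.pi,
      (r * fderiv ℝ (fderiv ℝ u) (r • er θ) (et θ) (et θ) - fderiv ℝ u (r • er θ) (er θ)) * χ θ
      = -∫ θ in (-Real.pi)..Real.pi, fderiv ℝ u (r • er θ) (et θ) * χ' θ := by
    have hc : Continuous fun θ => r * fderiv ℝ (fderiv ℝ u) (r • er θ) (et θ) (et θ)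
        - fderiv ℝ u (r • er θ) (er θ) :=
      ((slice ctt).const_smul r).sub (slice (continuous_uncurry_fderiv_er hu1))
    have := intervalIntegral.integral_mul_deriv_eq_deriv_mul (a := -Real.pi) (b := Real.pi)
      (fun θ _ => hasDerivAt_angular_angular hu r θ) (fun θ _ => h.hasDerivAt θ)
      (hc.intervalIntegrable _ _) (h.continuous_deriv.intervalIntegrable _ _)
    rw [h.periodic, er_neg_pi, et_neg_pi, sub_self, zero_sub] at this
    rw [this, neg_neg]
  have h' : IsAngular k χ' (fun θ => -(k ^ 2 * χ θ)) := by
    refine ⟨h.hasDerivAt_deriv, fun θ => ?_, h.periodic_deriv, by rw [h.periodic]⟩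
    exact ((h.hasDerivAt θ).const_mul _).neg
  have h3 := mode_angular hu1 h' r
  have h4 : mode (fun θ => -(k ^ 2 * χ θ)) u r = -(k ^ 2 * mode χ u r) := by
    rw [mode, mode, ← intervalIntegral.integral_const_mul, ← intervalIntegral.integral_neg]
    congr 1; ext θ; ring
  rw [h4, neg_neg] at h3
  have h5 : ∫ θ in (-Real.pi)..Real.pi, r * fderiv ℝ u (r • er θ) (et θ) * χ' θ
      = r * ∫ θ in (-Real.pi)..Real.pi, fderiv ℝ u (r • er θ) (et θ) * χ' θ := by
    rw [← intervalIntegral.integral_const_mul]; congr 1; ext θ; ring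
  have iee : Continuous fun θ =>
      fderiv ℝ (fderiv ℝ u) (r • er θ) (er θ) (er θ) * χ θ := (slice cee).mul h.continuous
  have itt : Continuous fun θ =>
      fderiv ℝ (fderiv ℝ u) (r • er θ) (et θ) (et θ) * χ θ := (slice ctt).mul h.continuous
  have ie : Continuous fun θ => fderiv ℝ u (r • er θ) (er θ) * χ θ :=
    (slice (continuous_uncurry_fderiv_er hu1)).mul h.continuous
  have h6 : mode χ (Laplacian.laplacian u) r =
      (∫ θ in (-Real.pi)..Real.pi, fderiv ℝ (fderiv ℝ u) (r • er θ) (er θ) (er θ) * χ θ)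
      + ∫ θ in (-Real.pi)..Real.pi, fderiv ℝ (fderiv ℝ u) (r • er θ) (et θ) (et θ) * χ θ := by
    rw [mode, ← intervalIntegral.integral_add (iee.intervalIntegrable _ _)
      (itt.intervalIntegrable _ _)]
    congr 1; ext θ
    rw [laplacian_eq_polar u _ θ]; ring
  have h7 : ∫ θ in (-Real.pi)..Real.pi,
      (r * fderiv ℝ (fderiv ℝ u) (r • er θ) (et θ) (et θ) - fderiv ℝ u (r • er θ) (er θ)) * χ θ
      = r * (∫ θ in (-Real.pi)..Real.pi, fderiv ℝ (fderiv ℝ u) (r • er θ) (et θ) (et θ) * χ θ)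
        - modeDeriv χ u r := by
    have hr' : Continuous fun θ =>
        r * (fderiv ℝ (fderiv ℝ u) (r • er θ) (et θ) (et θ) * χ θ) := continuous_const.mul itt
    rw [modeDeriv, ← intervalIntegral.integral_const_mul, ← intervalIntegral.integral_sub
      (hr'.intervalIntegrable _ _) (ie.intervalIntegrable _ _)]
    congr 1; ext θ; ring
  refine h1.congr_deriv ?_
  rw [h6]
  set I := ∫ θ in (-Real.pi)..Real.pi, fderiv ℝ (fderiv ℝ u) (r • er θ) (et θ) (et θ) * χ θ
  set J := ∫ θ in (-Real.pi)..Real.pi, fderiv ℝ u (r • er θ) (et θ) * χ' θ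
  rw [h7] at h2
  rw [h5] at h3
  field_simp
  linear_combination (-r) * h2 + h3

end Modes

/-- `-Δ` applied to the Green function is a unit point mass at the origin. -/
lemma integral_green_mul_laplacian {η : Plane → ℝ} (hη : ContDiff ℝ 2 η)
    (hc : HasCompactSupport η) : ∫ x, green x * Laplacian.laplacian η x = -η 0 := by
  have hη1 : ContDiff ℝ 1 η := hη.of_le (by norm_num)
  have hL := continuous_laplacian hη
  have hLc : HasCompactSupport (Laplacian.laplacian η) := by
    have h1 : HasCompactSupport (fderiv ℝ (fderiv ℝ η)) := (hc.fderiv (𝕜 := ℝ)).fderiv (𝕜 := ℝ)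
    rw [funext fun x => laplacian_eq_polar η x 0]
    exact h1.comp_left (g := fun L : Plane →L[ℝ] Plane →L[ℝ] ℝ => L (er 0) (er 0) + L (et 0) (et 0))
      (by simp)
  have hint : Integrable fun x => green x * Laplacian.laplacian η x := by
    simpa [mul_comm] using
      locallyIntegrable_green.integrable_smul_left_of_hasCompactSupport hL hLc
  obtain ⟨h1, h2⟩ := integral_polar hint (measurable_green.mul hL.measurable)
  have hang : IsAngular 0 (fun _ => (1 : ℝ)) (fun _ => 0) :=
    ⟨fun θ => hasDerivAt_const θ _, fun θ => by simpa using hasDerivAt_const θ (0 : ℝ), rfl, rfl⟩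
  set e := mode (fun _ => (1 : ℝ)) η
  set e' := modeDeriv (fun _ => (1 : ℝ)) η
  set P : ℝ → ℝ := fun r => -(1 / (2 * Real.pi)) * (r * Real.log r * e' r - e r) with hP
  have hfun : ∀ r, 0 < r → ∫ θ in (-Real.pi)..Real.pi,
      r * (green (r • er θ) * Laplacian.laplacian η (r • er θ))
      = r * (-(1 / (2 * Real.pi)) * Real.log r) * mode (fun _ => 1) (Laplacian.laplacian η) r := by
    intro r hr
    rw [mode, ← intervalIntegral.integral_const_mul]
    congr 1; ext θ
    rw [green, IsStationary.norm_smul_er, abs_of_pos hr]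
    ring
  have hderiv : ∀ r ∈ Ioi (0 : ℝ), HasDerivAt P (∫ θ in (-Real.pi)..Real.pi,
      r * (green (r • er θ) * Laplacian.laplacian η (r • er θ))) r := by
    intro r hr
    have hr0 : 0 < r := hr
    have d := ((((hasDerivAt_id r).mul (Real.hasDerivAt_log hr0.ne')).mul
      (hasDerivAt_modeDeriv hη hang hr0.ne')).sub
      (hasDerivAt_mode (χ := fun _ => (1 : ℝ)) hη1 (continuous_const (y := (1 : ℝ))) r)).const_mul
        (-(1 / (2 * Real.pi)))
    refine d.congr_deriv ?_
    rw [hfun r hr0]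
    simp only [id, Pi.mul_apply]
    push_cast
    field_simp
    ring
  have hcont : Continuous P := by
    have h3 := continuous_modeDeriv hη1 (continuous_const (y := (1 : ℝ)))
    have h4 := continuous_mode hη.continuous (continuous_const (y := (1 : ℝ)))
    exact continuous_const.mul ((Real.continuous_mul_log.mul h3).sub h4)
  have hlim : Tendsto P atTop (𝓝 0) := by
    obtain ⟨R, hR⟩ := hc.isBounded.subset_ball 0
    refine tendsto_const_nhds.congr' ?_
    filter_upwards [eventually_gt_atTop (max R 0)] with r hr
    have hrR : R < r := (le_max_left _ _).trans_lt hr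
    have hr0 : 0 < r := (le_max_right _ _).trans_lt hr
    have hx : ∀ θ, r • er θ ∉ tsupport η := fun θ hθ => by
      have := hR hθ
      rw [mem_ball_zero_iff, IsStationary.norm_smul_er, abs_of_pos hr0] at this
      linarith
    have h3 : e r = 0 := by
      simp only [e, mode]
      simp [fun θ => image_eq_zero_of_notMem_tsupport (hx θ)]
    have h4 : e' r = 0 := by
      simp only [e', modeDeriv]
      have : ∀ θ, fderiv ℝ η (r • er θ) = 0 := fun θ =>
        image_eq_zero_of_notMem_tsupport fun h => hx θ (tsupport_fderiv_subset ℝ h)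
      simp [this]
    simp [hP, h3, h4]
  rw [h2, integral_Ioi_of_hasDerivAt_of_tendsto hcont.continuousWithinAt hderiv h1 hlim]
  have h5 : e 0 = 2 * Real.pi * η 0 := by
    simp only [e, mode, zero_smul, mul_one, intervalIntegral.integral_const, smul_eq_mul]; ring
  simp only [hP, h5]
  have := Real.pi_ne_zero
  simp
  field_simp

end

/-! ### The Poisson equation and Parseval's identity on circles -/

section

section Potential

variable {ρ : Plane → ℝ}

open scoped Convolution in
lemma invLaplacian_eq_convolution (ρ : Plane → ℝ) :
    invLaplacian ρ = green ⋆[ContinuousLinearMap.lsmul ℝ ℝ] ρ := by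
  ext x
  rw [invLaplacian, convolution_def, ← integral_sub_left_eq_self _ _ x]
  simp

lemma contDiff_invLaplacian {k : ℕ∞} (hρ : ContDiff ℝ k ρ) (hc : HasCompactSupport ρ) :
    ContDiff ℝ k (invLaplacian ρ) := by
  rw [invLaplacian_eq_convolution]
  exact hc.contDiff_convolution_right _ locallyIntegrable_green hρ

lemma fderiv_invLaplacian (hρ : ContDiff ℝ 1 ρ) (hc : HasCompactSupport ρ) (x e : Plane) :
    fderiv ℝ (invLaplacian ρ) x e = invLaplacian (fun y => fderiv ℝ ρ y e) x := by
  rw [invLaplacian_eq_convolution, invLaplacian_eq_convolution,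
    (hc.hasFDerivAt_convolution_right _ locallyIntegrable_green hρ x).fderiv]
  exact convolution_precompR_apply _ locallyIntegrable_green (hc.fderiv (𝕜 := ℝ))
    (hρ.continuous_fderiv one_ne_zero) x e

lemma fderiv_fderiv_invLaplacian (hρ : ContDiff ℝ 2 ρ) (hc : HasCompactSupport ρ)
    (x e : Plane) : fderiv ℝ (fderiv ℝ (invLaplacian ρ)) x e e =
      invLaplacian (fun y => fderiv ℝ (fderiv ℝ ρ) y e e) x := by
  have hρ1 : ContDiff ℝ 1 ρ := hρ.of_le (by norm_num)
  have key : ∀ {u : Plane → ℝ}, ContDiff ℝ 2 u → ∀ x,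
      fderiv ℝ (fderiv ℝ u) x e e = fderiv ℝ (fun y => fderiv ℝ u y e) x e := by
    intro u hu x
    have := (ContinuousLinearMap.apply ℝ ℝ e).hasFDerivAt.comp x (hasFDerivAt_fderiv hu x)
    have h2 : fderiv ℝ (fun y => fderiv ℝ u y e) x = _ := this.fderiv
    rw [h2]; rfl
  have hc1 : HasCompactSupport fun y => fderiv ℝ ρ y e :=
    (hc.fderiv (𝕜 := ℝ)).comp_left (g := fun L : Plane →L[ℝ] ℝ => L e) (by simp)
  have hρe : ContDiff ℝ 1 fun y => fderiv ℝ ρ y e :=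
    (hρ.fderiv_right (m := 1) (by norm_num)).clm_apply contDiff_const
  rw [key (by exact_mod_cast contDiff_invLaplacian (k := 2) (by exact_mod_cast hρ) hc)]
  simp_rw [fderiv_invLaplacian hρ1 hc, fderiv_invLaplacian hρe hc1, key hρ]

/-- The Green potential solves the Poisson equation. -/
lemma laplacian_invLaplacian (hρ : ContDiff ℝ 2 ρ) (hc : HasCompactSupport ρ) (x : Plane) :
    Laplacian.laplacian (invLaplacian ρ) x = -ρ x := by
  have hloc : ∀ {g : Plane → ℝ}, Continuous g → HasCompactSupport g →
      Integrable fun y => green (x - y) * g y := by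
    intro g hg hgc
    have := (locallyIntegrable_green.integrable_smul_left_of_hasCompactSupport
      (g := fun t => g (x - t)) (hg.comp (continuous_const.sub continuous_id))
      (hgc.comp_homeomorph (Homeomorph.subLeft x))).comp_sub_left x
    refine this.congr (Eventually.of_forall fun y => ?_)
    simp [mul_comm]
  have hD := continuous_fderiv_fderiv hρ
  have hcD : HasCompactSupport (fderiv ℝ (fderiv ℝ ρ)) := (hc.fderiv (𝕜 := ℝ)).fderiv (𝕜 := ℝ)
  have hcc : ∀ e : Plane, HasCompactSupport fun y => fderiv ℝ (fderiv ℝ ρ) y e e := fun e =>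
    hcD.comp_left (g := fun L : Plane →L[ℝ] Plane →L[ℝ] ℝ => L e e) (by simp)
  have hcont : ∀ e : Plane, Continuous fun y => fderiv ℝ (fderiv ℝ ρ) y e e := fun e =>
    (hD.clm_apply continuous_const).clm_apply continuous_const
  rw [laplacian_eq_polar _ x 0, fderiv_fderiv_invLaplacian hρ hc, fderiv_fderiv_invLaplacian hρ hc,
    invLaplacian, invLaplacian, ← integral_add (hloc (hcont _) (hcc _)) (hloc (hcont _) (hcc _))]
  simp_rw [← mul_add, ← laplacian_eq_polar]
  -- reflect and translate so that the pole of the Green function is at the origin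
  have h := integral_green_mul_laplacian (η := fun t => ρ (x - t))
    (hρ.comp (contDiff_const.sub contDiff_id)) (hc.comp_homeomorph (Homeomorph.subLeft x))
  rw [sub_zero] at h
  rw [← h, ← integral_sub_left_eq_self _ _ x]
  congr 1; ext t
  rw [sub_sub_cancel]
  congr 1
  have h1 := laplacian_comp_isometry (u := fun t => ρ (x + t))
    (hρ.comp (contDiff_const.add contDiff_id)) (LinearIsometryEquiv.neg ℝ) t
  simp only [LinearIsometryEquiv.coe_neg, ← sub_eq_add_neg] at h1
  rw [h1, laplacian_eq_polar _ _ 0, laplacian_eq_polar _ _ 0]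
  have h2 : fderiv ℝ (fun t => ρ (x + t)) = fun t => fderiv ℝ ρ (x + t) := by
    ext1 t; rw [fderiv_comp_add_left]
  rw [h2, fderiv_comp_add_left, sub_eq_add_neg]

end Potential

/-- **Parseval's identity** on a circle, with real Fourier coefficients. -/
lemma hasSum_sq_integral_cos_sin {h : ℝ → ℝ} (hh : Continuous h) :
    HasSum (fun i : ℤ => (∫ θ in (-Real.pi)..Real.pi, h θ * Real.cos (i.natAbs * θ)) ^ 2
      + (∫ θ in (-Real.pi)..Real.pi, h θ * Real.sin (i.natAbs * θ)) ^ 2)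
      (2 * Real.pi * ∫ θ in (-Real.pi)..Real.pi, h θ ^ 2) := by
  have hpi := Real.pi_pos
  have hlt : -Real.pi < Real.pi := by linarith
  have hL2 : MemLp (fun θ => (h θ : ℂ)) 2 (volume.restrict (Ioc (-Real.pi) Real.pi)) := by
    have h1 : Continuous fun θ => (h θ : ℂ) := Complex.continuous_ofReal.comp hh
    refine (memLp_two_iff_integrable_sq_norm h1.aestronglyMeasurable).2 ?_
    have h2 : Continuous fun θ => ‖(h θ : ℂ)‖ ^ 2 := h1.norm.pow 2
    exact (h2.intervalIntegrable (-Real.pi) Real.pi).1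
  have hs := (hasSum_sq_fourierCoeffOn hlt hL2).mul_left ((2 * Real.pi) ^ 2)
  have hval : (2 * Real.pi) ^ 2 *
      ((Real.pi - -Real.pi)⁻¹ • ∫ θ in (-Real.pi)..Real.pi, ‖(h θ : ℂ)‖ ^ 2)
      = 2 * Real.pi * ∫ θ in (-Real.pi)..Real.pi, h θ ^ 2 := by
    simp only [Complex.norm_real, Real.norm_eq_abs, sq_abs, smul_eq_mul]
    field_simp
    ring
  rw [hval] at hs
  refine hs.congr_fun fun i => ?_
  set C := ∫ θ in (-Real.pi)..Real.pi, h θ * Real.cos (i * θ)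
  set S := ∫ θ in (-Real.pi)..Real.pi, h θ * Real.sin (i * θ)
  have hcoef : fourierCoeffOn hlt (fun θ => (h θ : ℂ)) i
      = (1 / (2 * Real.pi) : ℝ) * ((C : ℂ) - (S : ℂ) * Complex.I) := by
    rw [fourierCoeffOn_eq_integral]
    have hC : (C : ℂ) = ∫ θ in (-Real.pi)..Real.pi, ((h θ * Real.cos (i * θ) : ℝ) : ℂ) :=
      intervalIntegral.integral_ofReal.symm
    have hS : (S : ℂ) = ∫ θ in (-Real.pi)..Real.pi, ((h θ * Real.sin (i * θ) : ℝ) : ℂ) :=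
      intervalIntegral.integral_ofReal.symm
    have c1 : Continuous fun θ => ((h θ * Real.cos (i * θ) : ℝ) : ℂ) := by fun_prop
    have c2 : Continuous fun θ => ((h θ * Real.sin (i * θ) : ℝ) : ℂ) * Complex.I := by fun_prop
    rw [hC, hS, ← intervalIntegral.integral_mul_const, ← intervalIntegral.integral_sub
      (c1.intervalIntegrable _ _) (c2.intervalIntegrable _ _), Complex.real_smul]
    congr 1
    · push_cast; ring_nf
    · congr 1; ext θ
      rw [fourier_coe_apply, smul_eq_mul]
      have : 2 * (Real.pi : ℂ) * Complex.I * ((-i : ℤ) : ℂ) * (θ : ℂ) /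
        ((Real.pi - -Real.pi : ℝ) : ℂ)
          = ((-(i * θ) : ℝ) : ℂ) * Complex.I := by
        have : (Real.pi : ℂ) ≠ 0 := by exact_mod_cast hpi.ne'
        push_cast; field_simp; ring
      rw [this, Complex.exp_mul_I, ← Complex.ofReal_cos, ← Complex.ofReal_sin, Real.cos_neg,
        Real.sin_neg]
      push_cast; ring
  have hnorm : ‖(C : ℂ) - (S : ℂ) * Complex.I‖ ^ 2 = C ^ 2 + S ^ 2 := by
    rw [Complex.sq_norm, Complex.normSq_apply]; simp; ring
  have hCS : (∫ θ in (-Real.pi)..Real.pi, h θ * Real.cos (i.natAbs * θ)) ^ 2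
      + (∫ θ in (-Real.pi)..Real.pi, h θ * Real.sin (i.natAbs * θ)) ^ 2 = C ^ 2 + S ^ 2 := by
    have hi : ((i.natAbs : ℕ) : ℝ) = |(i : ℝ)| := by rw [Nat.cast_natAbs]; simp
    rw [hi]
    rcases abs_choice (i : ℝ) with h1 | h1
    · rw [h1]
    · rw [h1]
      simp only [neg_mul, Real.cos_neg, Real.sin_neg, mul_neg, intervalIntegral.integral_neg,
        neg_sq]
      rfl
  have hsq : ‖((1 / (2 * Real.pi) : ℝ) : ℂ) * ((C : ℂ) - (S : ℂ) * Complex.I)‖ ^ 2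
      = (1 / (2 * Real.pi)) ^ 2 * (C ^ 2 + S ^ 2) := by
    rw [norm_mul, mul_pow, hnorm, Complex.norm_real, Real.norm_of_nonneg (by positivity)]
  rw [hCS, hcoef, hsq]
  field_simp

/-- Integrating Parseval's identity over all circles. -/
lemma tsum_lintegral_of_hasSum {F : Plane → ℝ} (hF : Continuous F) (h0 : ∀ x, 0 ≤ F x)
    {e : ℤ → ℝ → ℝ} (he : ∀ i, Measurable (e i)) (hpos : ∀ i r, 0 < r → 0 ≤ e i r)
    (hs : ∀ r, 0 < r → HasSum (fun i => e i r)
      (2 * Real.pi * ∫ θ in (-Real.pi)..Real.pi, r * F (r • er θ))) :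
    ∑' i, ∫⁻ r in Ioi (0 : ℝ), ENNReal.ofReal (e i r)
      = ENNReal.ofReal (2 * Real.pi) * ∫⁻ x, ENNReal.ofReal (F x) := by
  have hpi : -Real.pi ≤ Real.pi := by linarith [Real.pi_pos]
  rw [← lintegral_tsum fun i => (he i).ennreal_ofReal.aemeasurable,
    lintegral_polar hF.measurable.ennreal_ofReal, ← lintegral_const_mul']
  · refine setLIntegral_congr_fun measurableSet_Ioi fun r hr => ?_
    have hr0 : 0 < r := hr
    rw [← ENNReal.ofReal_tsum_of_nonneg (fun i => hpos i r hr0) (hs r hr0).summable,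
      (hs r hr0).tsum_eq, ENNReal.ofReal_mul (by positivity)]
    have hc : Continuous fun θ => r * F (r • er θ) :=
      continuous_const.mul (hF.comp (continuous_er.const_smul r))
    rw [intervalIntegral.integral_of_le hpi, ofReal_integral_eq_lintegral_ofReal
      ((hc.intervalIntegrable _ _).1) (Eventually.of_forall fun θ => mul_nonneg hr0.le (h0 _))]
    simp_rw [ENNReal.ofReal_mul hr0.le]
  · exact ENNReal.ofReal_ne_top

end

/-! ### The spectral gap for smooth perturbations -/

section

section ModeForms

variable {u v : Plane → ℝ} {χ χ' : ℝ → ℝ} {k : ℕ}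

lemma mode_add (hu : Continuous u) (hv : Continuous v) (hχ : Continuous χ) (r : ℝ) :
    mode χ (fun x => u x + v x) r = mode χ u r + mode χ v r := by
  have h : ∀ {w : Plane → ℝ}, Continuous w → Continuous fun θ => w (r • er θ) * χ θ :=
    fun hw => (hw.comp (continuous_er.const_smul r)).mul hχ
  rw [mode, mode, mode, ← intervalIntegral.integral_add ((h hu).intervalIntegrable _ _)
    ((h hv).intervalIntegrable _ _)]
  simp_rw [add_mul]

lemma modeDeriv_add (hu : ContDiff ℝ 1 u) (hv : ContDiff ℝ 1 v) (hχ : Continuous χ) (r : ℝ) :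
    modeDeriv χ (fun x => u x + v x) r = modeDeriv χ u r + modeDeriv χ v r := by
  have h : ∀ {w : Plane → ℝ}, ContDiff ℝ 1 w →
      Continuous fun θ => fderiv ℝ w (r • er θ) (er θ) * χ θ :=
    fun hw => ((continuous_uncurry_fderiv_er hw).comp
      (continuous_const.prodMk continuous_id)).mul hχ
  rw [modeDeriv, modeDeriv, modeDeriv, ← intervalIntegral.integral_add
    ((h hu).intervalIntegrable _ _) ((h hv).intervalIntegrable _ _)]
  congr 1; ext θ
  rw [fderiv_fun_add (hu.differentiable one_ne_zero _) (hv.differentiable one_ne_zero _)]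
  simp [add_mul]

/-- The gradient at the origin has no radial mean. -/
lemma modeDeriv_zero (u : Plane → ℝ) (hχ : ∀ θ, χ θ = χ 0) : modeDeriv χ u 0 = 0 := by
  simp only [modeDeriv, zero_smul]
  simp_rw [hχ]
  have h := intervalIntegral.integral_eq_sub_of_hasDerivAt (a := -Real.pi) (b := Real.pi)
    (f := fun θ => fderiv ℝ u 0 (et θ)) (f' := fun θ => fderiv ℝ u 0 (-er θ))
    (fun θ _ => (fderiv ℝ u 0).hasFDerivAt.comp_hasDerivAt θ (hasDerivAt_et θ))
    (((fderiv ℝ u 0).continuous.comp continuous_er.neg).intervalIntegrable _ _)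
  rw [et_neg_pi, sub_self] at h
  simp only [map_neg, intervalIntegral.integral_neg, neg_eq_zero] at h
  rw [intervalIntegral.integral_mul_const, h, zero_mul]

/-- The contribution of an angular mode to the Dirichlet integral, up to the weight. -/
noncomputable def modeDirichlet (k : ℕ) (χ : ℝ → ℝ) (u : Plane → ℝ) (r : ℝ) : ℝ :=
  r * modeDeriv χ u r ^ 2 + k ^ 2 * mode χ u r ^ 2 / r

lemma modeDirichlet_nonneg (k : ℕ) (χ : ℝ → ℝ) (u : Plane → ℝ) {r : ℝ} (hr : 0 < r) :
    0 ≤ modeDirichlet k χ u r := by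
  unfold modeDirichlet; positivity

lemma measurable_modeDirichlet (hu : ContDiff ℝ 1 u) (hχ : Continuous χ) :
    Measurable (modeDirichlet k χ u) := by
  have h1 := (continuous_mode hu.continuous hχ).measurable
  have h2 := (continuous_modeDeriv hu hχ).measurable
  unfold modeDirichlet
  fun_prop

lemma hasSum_mode_sq (hu : Continuous u) (r : ℝ) :
    HasSum (fun i : ℤ => mode (fun θ => Real.cos (i.natAbs * θ)) u r ^ 2
      + mode (fun θ => Real.sin (i.natAbs * θ)) u r ^ 2)
      (2 * Real.pi * ∫ θ in (-Real.pi)..Real.pi, u (r • er θ) ^ 2) :=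
  hasSum_sq_integral_cos_sin (hu.comp (continuous_er.const_smul r))

/-- Parseval's identity for the gradient on the circle of radius `r`. -/
lemma hasSum_modeDirichlet (hu : ContDiff ℝ 1 u) {r : ℝ} (hr : 0 < r) :
    HasSum (fun i : ℤ => modeDirichlet i.natAbs (fun θ => Real.cos (i.natAbs * θ)) u r
      + modeDirichlet i.natAbs (fun θ => Real.sin (i.natAbs * θ)) u r)
      (2 * Real.pi * ∫ θ in (-Real.pi)..Real.pi, r * ‖gradient u (r • er θ)‖ ^ 2) := by
  have c1 : Continuous fun θ => fderiv ℝ u (r • er θ) (er θ) :=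
    (continuous_uncurry_fderiv_er hu).comp (continuous_const.prodMk continuous_id)
  have c2 : Continuous fun θ => fderiv ℝ u (r • er θ) (et θ) :=
    (continuous_uncurry_fderiv_et hu).comp (continuous_const.prodMk continuous_id)
  have c3 : Continuous fun θ => r * fderiv ℝ u (r • er θ) (et θ) := continuous_const.mul c2
  have h := ((hasSum_sq_integral_cos_sin c1).mul_left r).add
    ((hasSum_sq_integral_cos_sin c3).mul_left r⁻¹)
  have hval : r * (2 * Real.pi * ∫ θ in (-Real.pi)..Real.pi, fderiv ℝ u (r • er θ) (er θ) ^ 2)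
      + r⁻¹ * (2 * Real.pi * ∫ θ in (-Real.pi)..Real.pi, (r * fderiv ℝ u (r • er θ) (et θ)) ^ 2)
      = 2 * Real.pi * ∫ θ in (-Real.pi)..Real.pi, r * ‖gradient u (r • er θ)‖ ^ 2 := by
    have d1 : Continuous fun θ => r * fderiv ℝ u (r • er θ) (er θ) ^ 2 :=
      continuous_const.mul (c1.pow 2)
    have d2 : Continuous fun θ => r * fderiv ℝ u (r • er θ) (et θ) ^ 2 :=
      continuous_const.mul (c2.pow 2)
    have d3 : (fun θ => r * ‖gradient u (r • er θ)‖ ^ 2) = fun θ =>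
        r * fderiv ℝ u (r • er θ) (er θ) ^ 2 + r * fderiv ℝ u (r • er θ) (et θ) ^ 2 := by
      ext θ; rw [gradient_norm_sq_eq_polar u _ θ, mul_add]
    rw [d3, intervalIntegral.integral_add (d1.intervalIntegrable _ _)
      (d2.intervalIntegrable _ _)]
    simp_rw [mul_pow]
    rw [intervalIntegral.integral_const_mul, intervalIntegral.integral_const_mul,
      intervalIntegral.integral_const_mul]
    field_simp
  rw [hval] at h
  refine h.congr_fun fun i => ?_
  have e1 := mode_angular hu (isAngular_cos i.natAbs) r
  have e2 := mode_angular hu (isAngular_sin i.natAbs) r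
  have m1 : mode (fun θ => -((i.natAbs : ℝ) * Real.sin (i.natAbs * θ))) u r
      = -(i.natAbs * mode (fun θ => Real.sin (i.natAbs * θ)) u r) := by
    rw [mode, mode, ← intervalIntegral.integral_const_mul, ← intervalIntegral.integral_neg]
    congr 1; ext θ; ring
  have m2 : mode (fun θ => (i.natAbs : ℝ) * Real.cos (i.natAbs * θ)) u r
      = i.natAbs * mode (fun θ => Real.cos (i.natAbs * θ)) u r := by
    rw [mode, mode, ← intervalIntegral.integral_const_mul]
    congr 1; ext θ; ring
  beta_reduce
  rw [e1, e2, m1, m2]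
  simp only [modeDirichlet, modeDeriv]
  field_simp
  ring

end ModeForms

lemma hasCompactSupport_gradient {f : Plane → ℝ} (hc : HasCompactSupport f) :
    HasCompactSupport (gradient f) :=
  (hc.fderiv (𝕜 := ℝ)).comp_left (g := (InnerProductSpace.toDual ℝ Plane).symm) (by simp)

lemma integrable_gradient_sq {f : Plane → ℝ} (hf : ContDiff ℝ 1 f) (hc : HasCompactSupport f) :
    Integrable fun x => ‖gradient f x‖ ^ 2 := by
  have h : HasCompactSupport fun x => ‖gradient f x‖ := (hasCompactSupport_gradient hc).norm
  have h2 : HasCompactSupport fun x => ‖gradient f x‖ * ‖gradient f x‖ := h.mul_right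
  simp_rw [sq]
  exact ((continuous_gradient hf).norm.mul (continuous_gradient hf).norm)
    |>.integrable_of_hasCompactSupport h2

namespace IsStationary

variable {μ M : ℝ} {n c f : Plane → ℝ}

lemma angularMode (hμ : 0 < μ) (hM : 0 < M) (hst : IsStationary M (harmonicPotential μ) n c)
    (hf : ContDiff ℝ 2 f) (hfc : HasCompactSupport f) {k : ℕ} {χ χ' : ℝ → ℝ}
    (hχ : IsAngular k χ χ') (hχ0 : k = 0 → ∀ θ, χ θ = χ 0)
    (he : IntegrableOn (modeDirichlet k χ (invLaplacian fun y => f y * n y)) (Ioi 0)) :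
    AngularMode (fun r => n (r • er 0)) k (mode χ f) (modeDeriv χ f)
      (mode χ (invLaplacian fun y => f y * n y))
      (modeDeriv χ (invLaplacian fun y => f y * n y)) := by
  have hρ : ContDiff ℝ 2 fun y => f y * n y := hf.mul (hst.contDiff_density hM)
  have hρc : HasCompactSupport fun y => f y * n y := hfc.mul_right
  have hψ : ContDiff ℝ 2 (invLaplacian fun y => f y * n y) := by
    exact_mod_cast contDiff_invLaplacian (k := 2) (by exact_mod_cast hρ) hρc
  have hf1 : ContDiff ℝ 1 f := hf.of_le (by norm_num)
  have hψ1 : ContDiff ℝ 1 (invLaplacian fun y => f y * n y) := hψ.of_le (by norm_num)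
  have lim : ∀ {g : ℝ → ℝ}, Continuous g → Tendsto g (𝓝[>] 0) (𝓝 (g 0)) := fun hg =>
    (hg.tendsto 0).mono_left nhdsWithin_le_nhds
  refine
    { hasDerivAt_density := fun r _ => hasDerivAt_mode hf1 hχ.continuous r
      hasDerivAt_potential := fun r _ => hasDerivAt_mode hψ1 hχ.continuous r
      poisson := fun r hr => ?_
      limit_density := ⟨_, lim (continuous_mode hf.continuous hχ.continuous), mode_zero f hχ⟩
      limit_potential := ⟨_, lim (continuous_mode hψ.continuous hχ.continuous), mode_zero _ hχ⟩
      limit_deriv := ⟨_, lim (continuous_modeDeriv hψ1 hχ.continuous),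
        fun hk => modeDeriv_zero _ (hχ0 hk)⟩
      support := ?_
      energy := he }
  · refine (hasDerivAt_modeDeriv hψ hχ hr.ne').congr_deriv ?_
    rw [sub_eq_add_neg]
    congr 1
    rw [mode, mode, ← intervalIntegral.integral_const_mul, ← intervalIntegral.integral_neg]
    congr 1; ext θ
    rw [laplacian_invLaplacian hρ hρc, hst.density_eq_of_norm_eq hμ hM
      (show ‖r • er θ‖ = ‖r • er 0‖ by rw [norm_smul_er, norm_smul_er])]
    ring
  · obtain ⟨R, hR⟩ := hfc.isBounded.subset_ball 0
    refine ⟨max R 0, fun r hr => ?_⟩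
    have hr0 : 0 < r := (le_max_right _ _).trans_lt hr
    have : ∀ θ, f (r • er θ) = 0 := fun θ => image_eq_zero_of_notMem_tsupport fun hθ => by
      have := hR hθ
      rw [mem_ball_zero_iff, norm_smul_er, abs_of_pos hr0] at this
      exact absurd ((le_max_left _ _).trans_lt hr) (not_lt.2 this.le)
    simp [mode, this]

lemma gradient_invLaplacian_ae_eq_field (hM : 0 < M)
    (hst : IsStationary M (harmonicPotential μ) n c) (hf : ContDiff ℝ 2 f)
    (hfc : HasCompactSupport f) :
    gradient (invLaplacian fun y => f y * n y) =ᵐ[volume] field fun y => f y * n y := by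
  have hρ : ContDiff ℝ 2 fun y => f y * n y := hf.mul (hst.contDiff_density hM)
  have hρc : HasCompactSupport fun y => f y * n y := hfc.mul_right
  have hψ : ContDiff ℝ 2 (invLaplacian fun y => f y * n y) := by
    exact_mod_cast contDiff_invLaplacian (k := 2) (by exact_mod_cast hρ) hρc
  refine (hasWeakGradient_gradient (hψ.of_le (by norm_num))).ae_unique
    (hasWeakGradient_invLaplacian ?_)
  exact Continuous.integrable_of_hasCompactSupport (by have := hρ.continuous; fun_prop)
    hρc.mul_left

/-- The spectral gap for smooth compactly supported perturbations, mode by mode. -/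
lemma spectral_gap_of_hasCompactSupport (hμ : 0 < μ) (hM : 0 < M)
    (hst : IsStationary M (harmonicPotential μ) n c) (hf : ContDiff ℝ 2 f)
    (hfc : HasCompactSupport f) (hmean : ∫ x, f x * n x = 0) :
    μ * ((∫ x, f x ^ 2 * n x) + ∫ x, ‖field (fun y => f y * n y) x‖ ^ 2) ≤
      ∫ x, ‖gradient f x + field (fun y => f y * n y) x‖ ^ 2 * n x := by
  have hw := hst.isRapidWeight hμ hM
  have hn2 := hst.contDiff_density hM
  have hρ : ContDiff ℝ 2 fun y => f y * n y := hf.mul hn2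
  have hρc : HasCompactSupport fun y => f y * n y := hfc.mul_right
  set ψ := invLaplacian fun y => f y * n y with hψdef
  have hψ : ContDiff ℝ 2 ψ := by
    exact_mod_cast contDiff_invLaplacian (k := 2) (by exact_mod_cast hρ) hρc
  have hf1 : ContDiff ℝ 1 f := hf.of_le (by norm_num)
  have hψ1 : ContDiff ℝ 1 ψ := hψ.of_le (by norm_num)
  have hfield : gradient ψ =ᵐ[volume] field fun y => f y * n y :=
    hst.gradient_invLaplacian_ae_eq_field hM hf hfc
  have hg1 : ContDiff ℝ 1 fun x => f x + ψ x := hf1.add hψ1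
  have hgrad : ∀ x, gradient (fun x => f x + ψ x) x = gradient f x + gradient ψ x := fun x => by
    rw [gradient, fderiv_fun_add (hf1.differentiable one_ne_zero x)
      (hψ1.differentiable one_ne_zero x), map_add]; rfl
  -- replace the field by the classical gradient
  have r1 : ∫ x, ‖field (fun y => f y * n y) x‖ ^ 2 = ∫ x, ‖gradient ψ x‖ ^ 2 :=
    integral_congr_ae (hfield.mono fun x hx => by simp only [hx])
  have r2 : ∫ x, ‖gradient f x + field (fun y => f y * n y) x‖ ^ 2 * n x
      = ∫ x, ‖gradient (fun x => f x + ψ x) x‖ ^ 2 * n x :=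
    integral_congr_ae (hfield.mono fun x hx => by simp only [hgrad, hx])
  have i1 : Integrable fun x => f x ^ 2 * n x :=
    Continuous.integrable_of_hasCompactSupport ((hf.continuous.pow 2).mul hw.continuous)
      ((hfc.comp_left (g := fun t : ℝ => t ^ 2) (by simp)).mul_right)
  have i2 : Integrable fun x => ‖gradient ψ x‖ ^ 2 :=
    (hw.integrable_field_sq hf.continuous.aestronglyMeasurable i1 hmean).congr
      (hfield.mono fun x hx => by simp only [hx])
  have cf := continuous_gradient hf1
  have cψ := continuous_gradient hψ1
  have cg := continuous_gradient hg1
  have i3 : Integrable fun x => ‖gradient (fun x => f x + ψ x) x‖ ^ 2 * n x := by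
    refine hw.integrable_mul_of_bounded ?_
    have hfi : Integrable fun x => ‖gradient f x‖ ^ 2 :=
      integrable_gradient_sq hf1 hfc
    refine ((hfi.const_mul 2).add (i2.const_mul 2)).mono' (cg.norm.pow 2).aestronglyMeasurable
      (Eventually.of_forall fun x => ?_)
    rw [Real.norm_of_nonneg (by positivity), hgrad, Pi.add_apply]
    have h1 := norm_add_le (gradient f x) (gradient ψ x)
    have h2 := norm_nonneg (gradient f x + gradient ψ x)
    nlinarith [sq_nonneg (‖gradient f x‖ - ‖gradient ψ x‖)]
  rw [r1, r2, ← integral_add i1 i2]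
  set F₁ : Plane → ℝ := fun x => f x ^ 2 * n x + ‖gradient ψ x‖ ^ 2
  set F₂ : Plane → ℝ := fun x => ‖gradient (fun x => f x + ψ x) x‖ ^ 2 * n x
  have hn0 : ∀ x, 0 ≤ n x := fun x => (hw.pos x).le
  have hF₁c : Continuous F₁ := ((hf.continuous.pow 2).mul hw.continuous).add (cψ.norm.pow 2)
  have hF₂c : Continuous F₂ := (cg.norm.pow 2).mul hw.continuous
  have hF₁0 : ∀ x, 0 ≤ F₁ x := fun x => by have := hn0 x; positivity
  have hF₂0 : ∀ x, 0 ≤ F₂ x := fun x => by have := hn0 x; positivity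
  -- the contributions of a mode to the two forms
  set nr : ℝ → ℝ := fun r => n (r • er 0)
  have hnr : Measurable nr := (hw.continuous.comp (continuous_id.smul continuous_const)).measurable
  have hnrad : ∀ r θ, n (r • er θ) = nr r := fun r θ =>
    hst.density_eq_of_norm_eq hμ hM (by rw [norm_smul_er, norm_smul_er])
  have hnr0 : ∀ r, 0 ≤ nr r := fun r => hn0 _
  set E₁ : ℕ → (ℝ → ℝ) → ℝ → ℝ := fun k χ r =>
    mode χ f r ^ 2 * (nr r * r) + modeDirichlet k χ ψ r with hE₁
  set E₂ : ℕ → (ℝ → ℝ) → ℝ → ℝ := fun k χ r =>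
    nr r * modeDirichlet k χ (fun x => f x + ψ x) r with hE₂
  have hE₁0 : ∀ k χ r, 0 < r → 0 ≤ E₁ k χ r := fun k χ r hr =>
    add_nonneg (mul_nonneg (sq_nonneg _) (mul_nonneg (hnr0 r) hr.le))
      (modeDirichlet_nonneg k χ ψ hr)
  have hE₂0 : ∀ k χ r, 0 < r → 0 ≤ E₂ k χ r := fun k χ r hr =>
    mul_nonneg (hnr0 r) (modeDirichlet_nonneg k χ _ hr)
  have hE₁m : ∀ k χ, Continuous χ → Measurable (E₁ k χ) := fun k χ hχ =>
    (((continuous_mode hf.continuous hχ).measurable.pow_const 2).mul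
      (hnr.mul measurable_id)).add (measurable_modeDirichlet hψ1 hχ)
  have hE₂m : ∀ k χ, Continuous χ → Measurable (E₂ k χ) := fun k χ hχ =>
    hnr.mul (measurable_modeDirichlet hg1 hχ)
  -- the one-dimensional inequality
  have gap : ∀ {k χ χ'}, IsAngular k χ χ' → (k = 0 → ∀ θ, χ θ = χ 0) →
      IntegrableOn (E₁ k χ) (Ioi 0) → IntegrableOn (E₂ k χ) (Ioi 0) →
      ENNReal.ofReal μ * ∫⁻ r in Ioi (0 : ℝ), ENNReal.ofReal (E₁ k χ r)
        ≤ ∫⁻ r in Ioi (0 : ℝ), ENNReal.ofReal (E₂ k χ r) := by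
    intro k χ χ' hχ hχ0 h1 h2
    have he : IntegrableOn (modeDirichlet k χ ψ) (Ioi 0) := by
      refine Integrable.mono' h1 (measurable_modeDirichlet hψ1 hχ.continuous).aestronglyMeasurable
        ((ae_restrict_iff' measurableSet_Ioi).2 (Eventually.of_forall fun r hr => ?_))
      rw [Real.norm_of_nonneg (modeDirichlet_nonneg k χ ψ hr)]
      exact le_add_of_nonneg_left (mul_nonneg (sq_nonneg _) (mul_nonneg (hnr0 r) (le_of_lt hr)))
    have hmode := hst.angularMode hμ hM hf hfc hχ hχ0 he
    have hE₂' : E₂ k χ = fun r => nr r * (r * (modeDeriv χ f r + modeDeriv χ ψ r) ^ 2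
        + k ^ 2 * (mode χ f r + mode χ ψ r) ^ 2 / r) := by
      ext r
      simp only [hE₂, modeDirichlet, modeDeriv_add hf1 hψ1 hχ.continuous,
        mode_add hf.continuous hψ.continuous hχ.continuous]
    have := hmode.spectral_gap hμ (hst.radialProfile hμ hM) h1 (by rw [← hE₂']; exact h2)
    have hle : μ * ∫ r in Ioi 0, E₁ k χ r ≤ ∫ r in Ioi 0, E₂ k χ r := by
      rw [hE₂']; exact this
    rw [← ofReal_integral_eq_lintegral_ofReal h1 ((ae_restrict_iff' measurableSet_Ioi).2
        (Eventually.of_forall fun r hr => hE₁0 k χ r hr)),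
      ← ofReal_integral_eq_lintegral_ofReal h2 ((ae_restrict_iff' measurableSet_Ioi).2
        (Eventually.of_forall fun r hr => hE₂0 k χ r hr)), ← ENNReal.ofReal_mul hμ.le]
    exact ENNReal.ofReal_le_ofReal hle
  -- Parseval
  have ccos : ∀ i : ℤ, Continuous fun θ : ℝ => Real.cos (i.natAbs * θ) := fun i => by fun_prop
  have csin : ∀ i : ℤ, Continuous fun θ : ℝ => Real.sin (i.natAbs * θ) := fun i => by fun_prop
  have s1 := tsum_lintegral_of_hasSum hF₁c hF₁0
    (e := fun i r => E₁ i.natAbs (fun θ => Real.cos (i.natAbs * θ)) r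
      + E₁ i.natAbs (fun θ => Real.sin (i.natAbs * θ)) r)
    (fun i => (hE₁m _ _ (ccos i)).add (hE₁m _ _ (csin i)))
    (fun i r hr => add_nonneg (hE₁0 _ _ r hr) (hE₁0 _ _ r hr)) (fun r hr => by
      have h := ((hasSum_mode_sq hf.continuous r).mul_left (nr r * r)).add
        (hasSum_modeDirichlet hψ1 hr)
      have c1 : Continuous fun θ => r * (f (r • er θ) ^ 2 * n (r • er θ)) :=
        continuous_const.mul (((hf.continuous.pow 2).mul hw.continuous).comp
          (continuous_er.const_smul r))
      have c2 : Continuous fun θ => r * ‖gradient ψ (r • er θ)‖ ^ 2 :=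
        continuous_const.mul ((cψ.norm.pow 2).comp (continuous_er.const_smul r))
      have hv : 2 * Real.pi * ∫ θ in (-Real.pi)..Real.pi, r * F₁ (r • er θ)
          = nr r * r * (2 * Real.pi * ∫ θ in (-Real.pi)..Real.pi, f (r • er θ) ^ 2)
            + 2 * Real.pi * ∫ θ in (-Real.pi)..Real.pi, r * ‖gradient ψ (r • er θ)‖ ^ 2 := by
        simp only [F₁, mul_add]
        rw [intervalIntegral.integral_add (c1.intervalIntegrable _ _) (c2.intervalIntegrable _ _),
          mul_add]
        congr 1
        simp_rw [hnrad]
        rw [intervalIntegral.integral_const_mul, intervalIntegral.integral_mul_const]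
        ring
      rw [hv]
      refine h.congr_fun fun i => ?_
      simp only [hE₁]; ring)
  have s2 := tsum_lintegral_of_hasSum hF₂c hF₂0
    (e := fun i r => E₂ i.natAbs (fun θ => Real.cos (i.natAbs * θ)) r
      + E₂ i.natAbs (fun θ => Real.sin (i.natAbs * θ)) r)
    (fun i => (hE₂m _ _ (ccos i)).add (hE₂m _ _ (csin i)))
    (fun i r hr => add_nonneg (hE₂0 _ _ r hr) (hE₂0 _ _ r hr)) (fun r hr => by
      have h := (hasSum_modeDirichlet hg1 hr).mul_left (nr r)
      have hv : 2 * Real.pi * ∫ θ in (-Real.pi)..Real.pi, r * F₂ (r • er θ)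
          = nr r * (2 * Real.pi * ∫ θ in (-Real.pi)..Real.pi,
            r * ‖gradient (fun x => f x + ψ x) (r • er θ)‖ ^ 2) := by
        simp only [F₂, hnrad, ← mul_assoc]
        rw [intervalIntegral.integral_mul_const]
        ring
      rw [hv]
      refine h.congr_fun fun i => ?_
      simp only [hE₂]; ring)
  have lint_add₁ : ∀ i : ℤ, ∫⁻ r in Ioi (0 : ℝ), ENNReal.ofReal
      (E₁ i.natAbs (fun θ => Real.cos (i.natAbs * θ)) r
        + E₁ i.natAbs (fun θ => Real.sin (i.natAbs * θ)) r)
      = (∫⁻ r in Ioi (0 : ℝ), ENNReal.ofReal (E₁ i.natAbs (fun θ => Real.cos (i.natAbs * θ)) r))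
        + ∫⁻ r in Ioi (0 : ℝ), ENNReal.ofReal (E₁ i.natAbs (fun θ => Real.sin (i.natAbs * θ)) r) :=
    fun i => by
      rw [← lintegral_add_left (hE₁m _ _ (ccos i)).ennreal_ofReal]
      exact setLIntegral_congr_fun measurableSet_Ioi fun r hr =>
        ENNReal.ofReal_add (hE₁0 _ _ r hr) (hE₁0 _ _ r hr)
  have lint_add₂ : ∀ i : ℤ, ∫⁻ r in Ioi (0 : ℝ), ENNReal.ofReal
      (E₂ i.natAbs (fun θ => Real.cos (i.natAbs * θ)) r
        + E₂ i.natAbs (fun θ => Real.sin (i.natAbs * θ)) r)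
      = (∫⁻ r in Ioi (0 : ℝ), ENNReal.ofReal (E₂ i.natAbs (fun θ => Real.cos (i.natAbs * θ)) r))
        + ∫⁻ r in Ioi (0 : ℝ), ENNReal.ofReal (E₂ i.natAbs (fun θ => Real.sin (i.natAbs * θ)) r) :=
    fun i => by
      rw [← lintegral_add_left (hE₂m _ _ (ccos i)).ennreal_ofReal]
      exact setLIntegral_congr_fun measurableSet_Ioi fun r hr =>
        ENNReal.ofReal_add (hE₂0 _ _ r hr) (hE₂0 _ _ r hr)
  have iF₁ : Integrable F₁ := i1.add i2
  have f1 : ENNReal.ofReal (2 * Real.pi) * ∫⁻ x, ENNReal.ofReal (F₁ x) ≠ ⊤ := by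
    rw [← ofReal_integral_eq_lintegral_ofReal iF₁ (Eventually.of_forall hF₁0)]
    exact ENNReal.mul_ne_top ENNReal.ofReal_ne_top ENNReal.ofReal_ne_top
  have f2 : ENNReal.ofReal (2 * Real.pi) * ∫⁻ x, ENNReal.ofReal (F₂ x) ≠ ⊤ := by
    rw [← ofReal_integral_eq_lintegral_ofReal i3 (Eventually.of_forall hF₂0)]
    exact ENNReal.mul_ne_top ENNReal.ofReal_ne_top ENNReal.ofReal_ne_top
  have finite : ∀ {e : ℝ → ℝ}, Measurable e → (∀ r, 0 < r → 0 ≤ e r) →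
      ∫⁻ r in Ioi (0 : ℝ), ENNReal.ofReal (e r) ≠ ⊤ → IntegrableOn e (Ioi 0) := by
    intro e he h0 h
    refine ⟨he.aestronglyMeasurable, ?_⟩
    rw [hasFiniteIntegral_iff_ofReal ((ae_restrict_iff' measurableSet_Ioi).2
      (Eventually.of_forall fun r hr => h0 r hr))]
    exact h.lt_top
  have key : ENNReal.ofReal μ * (ENNReal.ofReal (2 * Real.pi) * ∫⁻ x, ENNReal.ofReal (F₁ x))
      ≤ ENNReal.ofReal (2 * Real.pi) * ∫⁻ x, ENNReal.ofReal (F₂ x) := by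
    have t1 := ENNReal.ne_top_of_tsum_ne_top (s1 ▸ f1)
    have t2 := ENNReal.ne_top_of_tsum_ne_top (s2 ▸ f2)
    rw [← s1, ← s2, ← ENNReal.tsum_mul_left]
    refine ENNReal.tsum_le_tsum fun i => ?_
    have u1 := t1 i
    have u2 := t2 i
    simp only [lint_add₁] at u1
    simp only [lint_add₂] at u2
    rw [lint_add₁, lint_add₂, mul_add]
    rw [ENNReal.add_ne_top] at u1 u2
    refine add_le_add (gap (isAngular_cos _) (fun h θ => by simp [h])
      (finite (hE₁m _ _ (ccos i)) (hE₁0 _ _) u1.1) (finite (hE₂m _ _ (ccos i)) (hE₂0 _ _) u2.1))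
      (gap (isAngular_sin _) (fun h θ => by simp [h])
      (finite (hE₁m _ _ (csin i)) (hE₁0 _ _) u1.2) (finite (hE₂m _ _ (csin i)) (hE₂0 _ _) u2.2))
  rw [← ofReal_integral_eq_lintegral_ofReal iF₁ (Eventually.of_forall hF₁0),
    ← ofReal_integral_eq_lintegral_ofReal i3 (Eventually.of_forall hF₂0),
    ← ENNReal.ofReal_mul (by positivity), ← ENNReal.ofReal_mul hμ.le,
    ← ENNReal.ofReal_mul (by positivity), ENNReal.ofReal_le_ofReal_iff
      (mul_nonneg (by positivity) (integral_nonneg hF₂0))] at key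
  have hpi := Real.pi_pos
  refine le_of_mul_le_mul_left (a := 2 * Real.pi) ?_ (by positivity)
  linarith

end IsStationary

end

/-! ### Mollification and weak gradients -/

section

section Mollification

open scoped Convolution
open ContinuousLinearMap (lsmul)

variable {E : Type*} [NormedAddCommGroup E] [NormedSpace ℝ E]

/-- Convolution with a probability density is a contraction of `L²`. -/
lemma eLpNorm_convolution_le {φ : Plane → ℝ} (hφ : Continuous φ) (h0 : ∀ x, 0 ≤ φ x)
    (hi : Integrable φ) (h1 : ∫ x, φ x = 1) {g : Plane → E} (hg : AEStronglyMeasurable g) :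
    eLpNorm (φ ⋆[lsmul ℝ ℝ] g) 2 volume ≤ eLpNorm g 2 volume := by
  have hφm : Measurable fun x => ENNReal.ofReal (φ x) := hφ.measurable.ennreal_ofReal
  have hmass : ∫⁻ x, ENNReal.ofReal (φ x) = 1 := by
    rw [← ofReal_integral_eq_lintegral_ofReal hi (Eventually.of_forall h0), h1, ENNReal.ofReal_one]
  have hpt : ∀ x, ‖(φ ⋆[lsmul ℝ ℝ] g) x‖ₑ ^ 2
      ≤ ∫⁻ t, ENNReal.ofReal (φ t) * ‖g (x - t)‖ₑ ^ 2 := by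
    intro x
    have hgx : AEMeasurable (fun t => ‖g (x - t)‖ₑ) :=
      (hg.comp_quasiMeasurePreserving
        (quasiMeasurePreserving_sub_left_of_right_invariant volume x)).enorm
    have hs : Measurable fun t => ENNReal.ofReal (√(φ t)) := (hφ.sqrt).measurable.ennreal_ofReal
    have hss : ∀ t, ENNReal.ofReal (√(φ t)) * ENNReal.ofReal (√(φ t)) = ENNReal.ofReal (φ t) :=
      fun t => by rw [← ENNReal.ofReal_mul (Real.sqrt_nonneg _), Real.mul_self_sqrt (h0 t)]
    calc ‖(φ ⋆[lsmul ℝ ℝ] g) x‖ₑ ^ 2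
        ≤ (∫⁻ t, ENNReal.ofReal (√(φ t)) * (ENNReal.ofReal (√(φ t)) * ‖g (x - t)‖ₑ)) ^ 2 := by
          gcongr
          rw [convolution_def]
          refine (enorm_integral_le_lintegral_enorm _).trans
            (le_of_eq (lintegral_congr fun t => ?_))
          rw [← mul_assoc, hss, ContinuousLinearMap.lsmul_apply, enorm_smul,
            Real.enorm_of_nonneg (h0 t)]
      _ ≤ (∫⁻ t, ENNReal.ofReal (√(φ t)) ^ 2) *
          ∫⁻ t, (ENNReal.ofReal (√(φ t)) * ‖g (x - t)‖ₑ) ^ 2 :=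
          lintegral_mul_sq_le hs.aemeasurable (hs.aemeasurable.mul hgx)
      _ = _ := by
          simp_rw [mul_pow, sq (ENNReal.ofReal _), hss, hmass, one_mul]
  have hsq : ∫⁻ x, ‖(φ ⋆[lsmul ℝ ℝ] g) x‖ₑ ^ 2 ≤ ∫⁻ x, ‖g x‖ₑ ^ 2 := by
    have hprod : AEMeasurable (Function.uncurry fun x t : Plane =>
        ENNReal.ofReal (φ t) * ‖g (x - t)‖ₑ ^ 2) (volume.prod volume) := by
      refine (hφm.comp measurable_snd).aemeasurable.mul (AEMeasurable.pow_const ?_ 2)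
      exact (hg.comp_quasiMeasurePreserving
        (quasiMeasurePreserving_sub_of_right_invariant volume volume)).enorm
    calc ∫⁻ x, ‖(φ ⋆[lsmul ℝ ℝ] g) x‖ₑ ^ 2
        ≤ ∫⁻ x, ∫⁻ t, ENNReal.ofReal (φ t) * ‖g (x - t)‖ₑ ^ 2 := lintegral_mono hpt
      _ = ∫⁻ t, ∫⁻ x, ENNReal.ofReal (φ t) * ‖g (x - t)‖ₑ ^ 2 := lintegral_lintegral_swap hprod
      _ = ∫⁻ t, ENNReal.ofReal (φ t) * ∫⁻ x, ‖g x‖ₑ ^ 2 := by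
          refine lintegral_congr fun t => ?_
          rw [lintegral_const_mul' _ _ ENNReal.ofReal_ne_top,
            lintegral_sub_right_eq_self (fun x => ‖g x‖ₑ ^ 2) t]
      _ = ∫⁻ x, ‖g x‖ₑ ^ 2 := by rw [lintegral_mul_const _ hφm, hmass, one_mul]
  rw [eLpNorm_eq_lintegral_rpow_enorm_toReal two_ne_zero ENNReal.ofNat_ne_top,
    eLpNorm_eq_lintegral_rpow_enorm_toReal two_ne_zero ENNReal.ofNat_ne_top]
  gcongr ?_ ^ _
  simpa using hsq

/-- Mollification converges in `L²`. -/
lemma exists_forall_eLpNorm_mollify_sub_le [CompleteSpace E] {g : Plane → E}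
    (hg : MemLp g 2 volume) {δ : ℝ≥0∞} (hδ : δ ≠ 0) :
    ∃ ε > 0, ∀ φ : ContDiffBump (0 : Plane), φ.rOut ≤ ε →
      eLpNorm ((φ.normed volume ⋆[lsmul ℝ ℝ] g) - g) 2 volume ≤ δ := by
  have hδ3 : δ / 3 ≠ 0 := by simpa using hδ
  obtain ⟨h, hhc, hgh, hh, hhL⟩ :=
    hg.exists_hasCompactSupport_eLpNorm_sub_le ENNReal.ofNat_ne_top hδ3
  obtain ⟨R, hR⟩ := hhc.isBounded.subset_ball 0
  set B : Set Plane := Metric.ball 0 (R + 1)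
  have hB : volume B ≠ ⊤ := measure_ball_lt_top.ne
  obtain ⟨η, hη, hηB⟩ : ∃ η : ℝ, 0 < η ∧ ENNReal.ofReal η * (volume B) ^ (1 / 2 : ℝ) ≤ δ / 3 := by
    have ht : Tendsto (fun η : ℝ => ENNReal.ofReal η * (volume B) ^ (1 / 2 : ℝ)) (𝓝[>] 0)
        (𝓝 0) := by
      have := ENNReal.Tendsto.mul_const (b := (volume B) ^ (1 / 2 : ℝ))
        ((ENNReal.continuous_ofReal.tendsto (0 : ℝ)).mono_left (nhdsWithin_le_nhds (s := Ioi 0)))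
        (Or.inr (ENNReal.rpow_ne_top_of_nonneg (by norm_num) hB))
      simpa using this
    obtain ⟨η, h1, h2⟩ := ((ht.eventually (Iic_mem_nhds (pos_iff_ne_zero.2 hδ3))).and
      self_mem_nhdsWithin).exists
    exact ⟨η, h2, h1⟩
  obtain ⟨ε, hε, hεh⟩ := Metric.uniformContinuous_iff.1
    (hhc.uniformContinuous_of_continuous hh) η hη
  refine ⟨min ε 1, by positivity, fun φ hφ => ?_⟩
  have hφε : φ.rOut ≤ ε := hφ.trans (min_le_left _ _)
  have hφ1 : φ.rOut ≤ 1 := hφ.trans (min_le_right _ _)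
  have hφc : Continuous (φ.normed volume) := φ.continuous_normed
  have hgl : LocallyIntegrable g := hg.locallyIntegrable one_le_two
  have hhl : LocallyIntegrable h := hh.locallyIntegrable
  have hex : ∀ {w : Plane → E}, LocallyIntegrable w → ConvolutionExists (φ.normed volume) w
      (lsmul ℝ ℝ) volume := fun hw => φ.hasCompactSupport_normed.convolutionExists_left _ hφc hw
  have hcm : ∀ {w : Plane → E}, LocallyIntegrable w →
      AEStronglyMeasurable (φ.normed volume ⋆[lsmul ℝ ℝ] w) := fun hw =>
    (φ.hasCompactSupport_normed.continuous_convolution_left _ hφc hw).aestronglyMeasurable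
  have split : (φ.normed volume ⋆[lsmul ℝ ℝ] g) - g =
      (φ.normed volume ⋆[lsmul ℝ ℝ] (g - h)) +
        (((φ.normed volume ⋆[lsmul ℝ ℝ] h) - h) + (h - g)) := by
    have : φ.normed volume ⋆[lsmul ℝ ℝ] g =
        (φ.normed volume ⋆[lsmul ℝ ℝ] (g - h)) + (φ.normed volume ⋆[lsmul ℝ ℝ] h) := by
      rw [← ConvolutionExists.distrib_add (hex (hgl.sub hhl)) (hex hhl), sub_add_cancel]
    rw [this]; abel
  have b1 : eLpNorm (φ.normed volume ⋆[lsmul ℝ ℝ] (g - h)) 2 volume ≤ δ / 3 :=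
    (eLpNorm_convolution_le hφc φ.nonneg_normed φ.integrable_normed φ.integral_normed
      (hg.1.sub hhL.1)).trans hgh
  have b3 : eLpNorm (h - g) 2 volume ≤ δ / 3 := by rwa [eLpNorm_sub_comm]
  have b2 : eLpNorm ((φ.normed volume ⋆[lsmul ℝ ℝ] h) - h) 2 volume ≤ δ / 3 := by
    have hclose : ∀ x, ‖((φ.normed volume ⋆[lsmul ℝ ℝ] h) - h) x‖ ≤ η := fun x => by
      rw [Pi.sub_apply, ← dist_eq_norm]
      exact φ.dist_normed_convolution_le hh.aestronglyMeasurable fun y hy =>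
        (hεh (lt_of_lt_of_le hy hφε)).le
    have hzero : ∀ x, x ∉ B → ((φ.normed volume ⋆[lsmul ℝ ℝ] h) - h) x = 0 := by
      intro x hx
      have hx0 : ∀ y ∈ Metric.ball x φ.rOut, h y = 0 := fun y hy =>
        image_eq_zero_of_notMem_tsupport fun hy' => hx (by
          have h1 := hR hy'
          rw [mem_ball_zero_iff] at h1 ⊢
          have h2 : ‖x‖ ≤ ‖y‖ + dist y x := by
            rw [dist_eq_norm, norm_sub_rev]; simpa using norm_add_le y (x - y)
          have h3 : dist y x < φ.rOut := hy
          linarith)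
      have hxx : h x = 0 := hx0 x (Metric.mem_ball_self φ.rOut_pos)
      rw [Pi.sub_apply, φ.normed_convolution_eq_right fun y hy => by rw [hx0 y hy, hxx], sub_self]
    have : ((φ.normed volume ⋆[lsmul ℝ ℝ] h) - h) =
        B.indicator ((φ.normed volume ⋆[lsmul ℝ ℝ] h) - h) := by
      refine (indicator_eq_self.2 fun x hx => ?_).symm
      by_contra hxB
      exact hx (hzero x hxB)
    rw [this, eLpNorm_indicator_eq_eLpNorm_restrict measurableSet_ball]
    refine (eLpNorm_le_of_ae_bound (Eventually.of_forall hclose)).trans ?_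
    rw [Measure.restrict_apply_univ, mul_comm]
    rw [mul_comm] at hηB
    simpa only [ENNReal.toReal_ofNat, one_div, mul_comm] using hηB
  rw [split]
  refine (eLpNorm_add_le (hcm (hgl.sub hhl)) (((hcm hhl).sub hhL.1).add (hhL.1.sub hg.1))
    one_le_two).trans ?_
  refine (add_le_add b1 ((eLpNorm_add_le ((hcm hhl).sub hhL.1) (hhL.1.sub hg.1)
    one_le_two).trans (add_le_add b2 b3))).trans (le_of_eq ?_)
  rw [← add_assoc, ENNReal.add_thirds]

/-- Mollification commutes with weak differentiation. -/
lemma HasWeakGradient.gradient_convolution {u : Plane → ℝ} {v : Plane → Plane}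
    (h : HasWeakGradient u v) {φ : Plane → ℝ} (hφ : ContDiff ℝ ∞ φ) (hc : HasCompactSupport φ)
    (x : Plane) :
    gradient (φ ⋆[lsmul ℝ ℝ] u) x = (φ ⋆[lsmul ℝ ℝ] v) x := by
  have hφ1 : ContDiff ℝ 1 φ := hφ.of_le (by exact_mod_cast le_top)
  have hcomm : (φ ⋆[lsmul ℝ ℝ] u) = (u ⋆[lsmul ℝ ℝ] φ) := by
    ext y
    rw [convolution_lsmul_swap, convolution_def]
    simp [mul_comm]
  refine ext_inner_right ℝ fun e => ?_
  rw [inner_gradient_left, hcomm,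
    (hc.hasFDerivAt_convolution_right _ h.locallyIntegrable hφ1 x).fderiv,
    convolution_precompR_apply _ h.locallyIntegrable (hc.fderiv (𝕜 := ℝ))
      (hφ1.continuous_fderiv one_ne_zero) x e, convolution_def, convolution_lsmul_swap]
  have hη : ContDiff ℝ ∞ fun t => φ (x - t) := hφ.comp (contDiff_const.sub contDiff_id)
  have hηc : HasCompactSupport fun t => φ (x - t) := hc.comp_homeomorph (Homeomorph.subLeft x)
  have hfd : ∀ t, fderiv ℝ (fun t => φ (x - t)) t e = -fderiv ℝ φ (x - t) e := by
    intro t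
    have h1 : HasFDerivAt (fun t => φ (x - t)) ((fderiv ℝ φ (x - t)).comp
        (-ContinuousLinearMap.id ℝ Plane)) t :=
      ((hφ1.differentiable one_ne_zero (x - t)).hasFDerivAt).comp t ((hasFDerivAt_id t).const_sub x)
    rw [h1.fderiv]; simp
  have key := h.integral_fderiv hη hηc e
  simp_rw [hfd, mul_neg, integral_neg, neg_inj] at key
  have hint : Integrable fun t => φ (x - t) • v t :=
    h.locallyIntegrable_grad.integrable_smul_left_of_hasCompactSupport hη.continuous hηc
  have h2 := integral_inner (𝕜 := ℝ) hint e
  rw [real_inner_comm, ← h2]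
  simp only [ContinuousLinearMap.lsmul_apply, smul_eq_mul]
  rw [key]
  congr 1; ext t
  rw [inner_smul_right, real_inner_comm, mul_comm]

/-- The product rule for weak gradients. -/
lemma HasWeakGradient.smooth_mul {u : Plane → ℝ} {v : Plane → Plane}
    (h : HasWeakGradient u v) {χ : Plane → ℝ} (hχ : ContDiff ℝ ∞ χ) :
    HasWeakGradient (fun x => χ x * u x) (fun x => χ x • v x + u x • gradient χ x) := by
  have hχ1 : ContDiff ℝ 1 χ := hχ.of_le (by exact_mod_cast le_top)
  have cg := continuous_gradient hχ1
  have l1 : LocallyIntegrable fun x => χ x * u x := locallyIntegrable_iff.2 fun K hK =>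
    (h.locallyIntegrable.integrableOn_isCompact hK).continuousOn_mul hχ.continuous.continuousOn hK
  have l2 : LocallyIntegrable fun x => χ x • v x := locallyIntegrable_iff.2 fun K hK =>
    (h.locallyIntegrable_grad.integrableOn_isCompact hK).continuousOn_smul
      hχ.continuous.continuousOn hK
  have l3 : LocallyIntegrable fun x => u x • gradient χ x := locallyIntegrable_iff.2 fun K hK =>
    (h.locallyIntegrable.integrableOn_isCompact hK).smul_continuousOn cg.continuousOn hK
  refine .of_forall_inner l1 (l2.add l3) fun η hη hc e => ?_
  have hη1 : ContDiff ℝ 1 η := hη.of_le (by exact_mod_cast le_top)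
  have key := h.integral_fderiv (η := fun x => χ x * η x) (hχ.mul hη) hc.mul_left e
  have hprod : ∀ x, fderiv ℝ (fun x => χ x * η x) x e
      = χ x * fderiv ℝ η x e + η x * fderiv ℝ χ x e := fun x => by
    rw [fderiv_fun_mul (hχ1.differentiable one_ne_zero x) (hη1.differentiable one_ne_zero x)]
    simp
  have cη : Continuous fun x => fderiv ℝ η x e :=
    (hη1.continuous_fderiv one_ne_zero).clm_apply continuous_const
  have cχ : Continuous fun x => fderiv ℝ χ x e :=
    (hχ1.continuous_fderiv one_ne_zero).clm_apply continuous_const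
  have i1 : Integrable fun x => u x * (χ x * fderiv ℝ η x e) := by
    have := h.locallyIntegrable.integrable_smul_right_of_hasCompactSupport
      (g := fun x => χ x * fderiv ℝ η x e) (hχ.continuous.mul cη)
      (((hc.fderiv (𝕜 := ℝ)).comp_left (g := fun L : Plane →L[ℝ] ℝ => L e) (by simp)).mul_left)
    simpa using this
  have i2 : Integrable fun x => u x * (η x * fderiv ℝ χ x e) := by
    have := h.locallyIntegrable.integrable_smul_right_of_hasCompactSupport
      (g := fun x => η x * fderiv ℝ χ x e) (hη.continuous.mul cχ) hc.mul_right
    simpa using this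
  have i3 : Integrable fun x => inner ℝ (v x) e * (χ x * η x) := by
    have := (h.locallyIntegrable_grad.integrable_smul_left_of_hasCompactSupport
      (g := fun x => χ x * η x) (hχ.continuous.mul hη.continuous)
      hc.mul_left).inner_const (𝕜 := ℝ) e
    refine this.congr (Eventually.of_forall fun x => ?_)
    simp only [real_inner_smul_left]; ring
  simp_rw [hprod, mul_add] at key
  rw [integral_add i1 i2] at key
  have e1 : ∫ x, χ x * u x * fderiv ℝ η x e = ∫ x, u x * (χ x * fderiv ℝ η x e) := by
    congr 1; ext x; ring
  have e2 : ∫ x, inner ℝ (χ x • v x + u x • gradient χ x) e * η x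
      = (∫ x, inner ℝ (v x) e * (χ x * η x)) + ∫ x, u x * (η x * fderiv ℝ χ x e) := by
    rw [← integral_add i3 i2]
    congr 1; ext x
    rw [inner_add_left, real_inner_smul_left, real_inner_smul_left, inner_gradient_left]; ring
  rw [e1, e2]
  linarith

end Mollification

end

/-! ### Density of smooth functions in the weighted Sobolev space -/

section

section SquareNorms

variable {E : Type*} [NormedAddCommGroup E] {ν : Measure Plane}

lemma norm_sq_le_weighted_add {a b : E} {δ : ℝ} (hδ : 0 < δ) :
    ‖a‖ ^ 2 ≤ (1 + δ) * ‖b‖ ^ 2 + (1 + δ⁻¹) * ‖a - b‖ ^ 2 := by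
  have h1 : ‖a‖ ≤ ‖b‖ + ‖a - b‖ := by simpa using norm_add_le b (a - b)
  have h2 : ‖a‖ ^ 2 ≤ (‖b‖ + ‖a - b‖) ^ 2 := pow_le_pow_left₀ (norm_nonneg a) h1 2
  have h3 : 0 ≤ δ⁻¹ * (δ * ‖b‖ - ‖a - b‖) ^ 2 := by positivity
  have h4 : δ⁻¹ * (δ * ‖b‖ - ‖a - b‖) ^ 2
      = δ * ‖b‖ ^ 2 - 2 * ‖b‖ * ‖a - b‖ + δ⁻¹ * ‖a - b‖ ^ 2 := by field_simp; ring
  nlinarith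

lemma integral_norm_sq_le_weighted_add {a b : Plane → E} (ha : MemLp a 2 ν) (hb : MemLp b 2 ν)
    {δ : ℝ} (hδ : 0 < δ) : ∫ x, ‖a x‖ ^ 2 ∂ν ≤
      (1 + δ) * (∫ x, ‖b x‖ ^ 2 ∂ν) + (1 + δ⁻¹) * ∫ x, ‖a x - b x‖ ^ 2 ∂ν := by
  have i1 := ha.integrable_norm_pow two_ne_zero
  have i2 := hb.integrable_norm_pow two_ne_zero
  have i3 := (ha.sub hb).integrable_norm_pow two_ne_zero
  simp only [Pi.sub_apply] at i3
  rw [← integral_const_mul, ← integral_const_mul, ← integral_add (i2.const_mul _) (i3.const_mul _)]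
  exact integral_mono i1 ((i2.const_mul _).add (i3.const_mul _)) fun x =>
    norm_sq_le_weighted_add hδ

lemma integral_norm_sq_le_of_eLpNorm_le {a : Plane → E} (ha : MemLp a 2 ν) {η : ℝ} (hη : 0 ≤ η)
    (h : eLpNorm a 2 ν ≤ ENNReal.ofReal η) : ∫ x, ‖a x‖ ^ 2 ∂ν ≤ η ^ 2 := by
  rw [ha.eLpNorm_eq_integral_rpow_norm two_ne_zero ENNReal.ofNat_ne_top,
    ENNReal.ofReal_le_ofReal_iff hη] at h
  simp only [ENNReal.toReal_ofNat, Real.rpow_ofNat] at h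
  have h0 : 0 ≤ ∫ x, ‖a x‖ ^ 2 ∂ν := integral_nonneg fun x => by positivity
  rw [← one_div, ← Real.sqrt_eq_rpow] at h
  exact (Real.sqrt_le_left hη).1 h

variable {n : Plane → ℝ}

lemma IsRapidWeight.integral_weighted (hn : IsRapidWeight n) (g : Plane → ℝ) :
    ∫ x, g x ∂(weighted n) = ∫ x, g x * n x := by
  rw [weighted, integral_withDensity_eq_integral_toReal_smul hn.measurable_ofReal
    (Eventually.of_forall fun x => ENNReal.ofReal_lt_top)]
  simp_rw [ENNReal.toReal_ofReal (hn.pos _).le, smul_eq_mul, mul_comm]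

lemma IsRapidWeight.memLp_weighted_of_memLp (hn : IsRapidWeight n) {a : Plane → E}
    (ha : MemLp a 2 volume) : MemLp a 2 (weighted n) :=
  hn.memLp_two.2 ⟨ha.1, hn.integrable_mul_of_bounded (ha.integrable_norm_pow two_ne_zero)⟩

lemma IsRapidWeight.exists_integral_weighted_le (hn : IsRapidWeight n) :
    ∃ B : ℝ, 0 < B ∧ ∀ a : Plane → E, MemLp a 2 volume →
      ∫ x, ‖a x‖ ^ 2 ∂(weighted n) ≤ B * ∫ x, ‖a x‖ ^ 2 := by
  obtain ⟨B, hB, h⟩ := hn.bounded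
  refine ⟨B + 1, by linarith, fun a ha => ?_⟩
  have i1 := ha.integrable_norm_pow two_ne_zero
  rw [hn.integral_weighted, ← integral_const_mul]
  refine integral_mono (hn.integrable_mul_of_bounded i1) (i1.const_mul _) fun x => ?_
  have := h x
  have h2 : 0 ≤ ‖a x‖ ^ 2 := by positivity
  simp only
  nlinarith

/-- On a compact set the weight is bounded below. -/
lemma IsRapidWeight.memLp_volume_of_eq_zero (hn : IsRapidWeight n) {a : Plane → E}
    (ha : MemLp a 2 (weighted n)) {K : Set Plane} (hK : IsCompact K) (h0 : ∀ x, x ∉ K → a x = 0) :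
    MemLp a 2 volume := by
  obtain ⟨ham, hai⟩ := hn.memLp_two.1 ha
  rcases K.eq_empty_or_nonempty with rfl | hne
  · have : a = 0 := funext fun x => h0 x (notMem_empty x)
    rw [this]; exact MemLp.zero
  obtain ⟨x₀, -, hx₀⟩ := hK.exists_isMinOn hne hn.continuous.continuousOn
  refine (memLp_two_iff_integrable_sq_norm ham).2
    ((hai.const_mul (n x₀)⁻¹).mono' (ham.norm.pow 2) (Eventually.of_forall fun x => ?_))
  have hp := hn.pos x₀
  rw [Real.norm_of_nonneg (by positivity)]
  by_cases hx : x ∈ K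
  · have h1 : n x₀ ≤ n x := hx₀ hx
    rw [inv_mul_eq_div, le_div_iff₀ hp]
    gcongr
  · simp [h0 x hx]

end SquareNorms

section Density

variable {n f : Plane → ℝ} {v : Plane → Plane}

lemma gradient_comp_smul {χ : Plane → ℝ} (t : ℝ) (x : Plane) :
    gradient (fun y => χ (t • y)) x = t • gradient χ (t • x) := by
  refine ext_inner_right ℝ fun e => ?_
  rw [real_inner_smul_left, inner_gradient_left, inner_gradient_left, fderiv_comp_smul]
  simp

lemma tendsto_integral_cutoff {E : Type*} [NormedAddCommGroup E] [NormedSpace ℝ E]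
    {ν : Measure Plane} {a : Plane → E} (ha : MemLp a 2 ν) {χ : Plane → ℝ} (hχ : Continuous χ)
    (h1 : ∀ x, ‖x‖ ≤ 1 → χ x = 1) (h01 : ∀ x, 0 ≤ χ x ∧ χ x ≤ 1) :
    Tendsto (fun k : ℕ => ∫ x, ‖a x - χ ((k + 1 : ℝ)⁻¹ • x) • a x‖ ^ 2 ∂ν) atTop (𝓝 0) := by
  have hlim : ∫ x, (0 : ℝ) ∂ν = 0 := by simp
  rw [← hlim]
  refine tendsto_integral_of_dominated_convergence (fun x => ‖a x‖ ^ 2) (fun k => ?_)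
    (ha.integrable_norm_pow two_ne_zero) (fun k => Eventually.of_forall fun x => ?_)
    (Eventually.of_forall fun x => ?_)
  · exact ((ha.1.sub
      ((hχ.comp (continuous_const_smul _)).aestronglyMeasurable.smul ha.1)).norm).pow 2
  · rw [Real.norm_of_nonneg (by positivity)]
    obtain ⟨h2, h3⟩ := h01 ((k + 1 : ℝ)⁻¹ • x)
    have : a x - χ ((k + 1 : ℝ)⁻¹ • x) • a x = (1 - χ ((k + 1 : ℝ)⁻¹ • x)) • a x := by
      rw [sub_smul, one_smul]
    rw [this, norm_smul, Real.norm_of_nonneg (by linarith)]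
    gcongr
    exact mul_le_of_le_one_left (norm_nonneg _) (by linarith)
  · refine tendsto_const_nhds.congr' ?_
    obtain ⟨N, hN⟩ := exists_nat_ge ‖x‖
    filter_upwards [eventually_ge_atTop N] with k hk
    have hk' : (N : ℝ) ≤ k := by exact_mod_cast hk
    rw [h1, one_smul, sub_self, norm_zero, zero_pow two_ne_zero]
    rw [norm_smul, Real.norm_of_nonneg (by positivity), inv_mul_le_iff₀ (by positivity)]
    linarith

open scoped Convolution in
/-- Smooth compactly supported functions are dense in the weighted Sobolev space: cut off, then
mollify. -/
lemma IsRapidWeight.exists_smooth_approx (hn : IsRapidWeight n) (h : HasWeakGradient f v)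
    (hf : MemLp f 2 (weighted n)) (hv : MemLp v 2 (weighted n)) {δ : ℝ} (hδ : 0 < δ) :
    ∃ g : Plane → ℝ, ContDiff ℝ ∞ g ∧ HasCompactSupport g ∧
      ∫ x, ‖f x - g x‖ ^ 2 ∂(weighted n) ≤ δ ∧ ∫ x, ‖v x - gradient g x‖ ^ 2 ∂(weighted n) ≤ δ := by
  obtain ⟨χ, hχ, ⟨hχc, hχ1⟩, hχ01⟩ := exists_contDiff_hasCompactSupport_eq_one 1
  have hχd : ContDiff ℝ 1 χ := hχ.of_le (by exact_mod_cast le_top)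
  obtain ⟨D, hD⟩ := (hasCompactSupport_gradient hχc).exists_bound_of_continuous
    (continuous_gradient hχd)
  set S := ∫ x, ‖f x‖ ^ 2 ∂(weighted n)
  have hS : 0 ≤ S := integral_nonneg fun x => by positivity
  have hinv : Tendsto (fun k : ℕ => ((k + 1 : ℝ)⁻¹ * D) ^ 2 * S) atTop (𝓝 0) := by
    have h0 : Tendsto (fun k : ℕ => (k + 1 : ℝ)⁻¹) atTop (𝓝 0) := by
      simpa using tendsto_one_div_add_atTop_nhds_zero_nat (𝕜 := ℝ)
    simpa using (((h0.mul_const D).pow 2).mul_const S)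
  obtain ⟨k, hk1, hk2, hk3⟩ := ((((tendsto_integral_cutoff hf hχ.continuous hχ1 hχ01).eventually
    (Iic_mem_nhds (show 0 < δ / 16 by positivity))).and
    (((tendsto_integral_cutoff hv hχ.continuous hχ1 hχ01).eventually
    (Iic_mem_nhds (show 0 < δ / 16 by positivity))).and
    (hinv.eventually (Iic_mem_nhds (show 0 < δ / 16 by positivity)))))).exists
  set t : ℝ := (k + 1 : ℝ)⁻¹
  have ht : 0 < t := by positivity
  have hsm : ContDiff ℝ ∞ fun x : Plane => χ (t • x) := hχ.comp (contDiff_const_smul t)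
  have hsc : HasCompactSupport fun x : Plane => χ (t • x) :=
    hχc.comp_smul ht.ne'
  have hsd : ContDiff ℝ 1 fun x : Plane => χ (t • x) := hsm.of_le (by exact_mod_cast le_top)
  -- the cut-off function and its weak gradient
  set f₁ : Plane → ℝ := fun x => χ (t • x) * f x
  set v₁ : Plane → Plane := fun x => χ (t • x) • v x + f x • gradient (fun y => χ (t • y)) x
  have hw₁ : HasWeakGradient f₁ v₁ := h.smooth_mul hsm
  have hgb : ∀ x, ‖gradient (fun y => χ (t • y)) x‖ ≤ t * D := fun x => by
    rw [gradient_comp_smul, norm_smul, Real.norm_of_nonneg ht.le]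
    exact mul_le_mul_of_nonneg_left (hD _) ht.le
  have hχb : ∀ x, ‖χ (t • x)‖ ≤ 1 := fun x => by
    rw [Real.norm_of_nonneg (hχ01 _).1]; exact (hχ01 _).2
  have m1 : MemLp f₁ 2 (weighted n) :=
    hf.of_le (hsm.continuous.aestronglyMeasurable.mul hf.1) (Eventually.of_forall fun x => by
      rw [norm_mul]; exact mul_le_of_le_one_left (norm_nonneg _) (hχb x))
  have m2 : MemLp (fun x => χ (t • x) • v x) 2 (weighted n) :=
    hv.of_le (hsm.continuous.aestronglyMeasurable.smul hv.1) (Eventually.of_forall fun x => by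
      rw [norm_smul]; exact mul_le_of_le_one_left (norm_nonneg _) (hχb x))
  have m3 : MemLp (fun x => f x • gradient (fun y => χ (t • y)) x) 2 (weighted n) :=
    hf.of_le_mul (c := t * D) (hf.1.smul (continuous_gradient hsd).aestronglyMeasurable)
      (Eventually.of_forall fun x => by
        rw [norm_smul, mul_comm]; exact mul_le_mul_of_nonneg_right (hgb x) (norm_nonneg _))
  have m4 : MemLp v₁ 2 (weighted n) := m2.add m3
  have hK := hsc.isCompact
  have z1 : ∀ x, x ∉ tsupport (fun x : Plane => χ (t • x)) → f₁ x = 0 := fun x hx => by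
    simp [f₁, image_eq_zero_of_notMem_tsupport hx]
  have z2 : ∀ x, x ∉ tsupport (fun x : Plane => χ (t • x)) → v₁ x = 0 := fun x hx => by
    have : gradient (fun y => χ (t • y)) x = 0 := by
      rw [gradient, image_eq_zero_of_notMem_tsupport fun h => hx (tsupport_fderiv_subset ℝ h),
        map_zero]
    simp [v₁, image_eq_zero_of_notMem_tsupport hx, this]
  have M1 : MemLp f₁ 2 volume := hn.memLp_volume_of_eq_zero m1 hK z1
  have M2 : MemLp v₁ 2 volume := hn.memLp_volume_of_eq_zero m4 hK z2
  have hf₁c : HasCompactSupport f₁ := hsc.mul_right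
  -- mollification
  obtain ⟨B, hB, hBn⟩ := hn.exists_integral_weighted_le (E := ℝ)
  obtain ⟨B', hB', hBn'⟩ := hn.exists_integral_weighted_le (E := Plane)
  set η := √(δ / (8 * (B + B')))
  have hη : 0 < η := by positivity
  have hη2 : η ^ 2 = δ / (8 * (B + B')) := Real.sq_sqrt (by positivity)
  have hη0 : ENNReal.ofReal η ≠ 0 := by simpa using hη
  obtain ⟨ε₁, hε₁, h1⟩ := exists_forall_eLpNorm_mollify_sub_le M1 hη0
  obtain ⟨ε₂, hε₂, h2⟩ := exists_forall_eLpNorm_mollify_sub_le M2 hη0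
  have hε : 0 < min ε₁ ε₂ := lt_min hε₁ hε₂
  let φ : ContDiffBump (0 : Plane) := ⟨min ε₁ ε₂ / 2, min ε₁ ε₂, by linarith, by linarith⟩
  have e1 := h1 φ (min_le_left _ _)
  have e2 := h2 φ (min_le_right _ _)
  have hφc := φ.hasCompactSupport_normed (μ := volume)
  set g := φ.normed volume ⋆[ContinuousLinearMap.lsmul ℝ ℝ] f₁ with hg
  have hgs : ContDiff ℝ ∞ g :=
    hφc.contDiff_convolution_left (n := ⊤) _ φ.contDiff_normed hw₁.locallyIntegrable
  have hgc : HasCompactSupport g := HasCompactSupport.convolution _ hφc hf₁c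
  have hgg : gradient g = φ.normed volume ⋆[ContinuousLinearMap.lsmul ℝ ℝ] v₁ :=
    funext fun x => hw₁.gradient_convolution φ.contDiff_normed hφc x
  have hgd : ContDiff ℝ 1 g := hgs.of_le (by exact_mod_cast le_top)
  have L1 : MemLp g 2 volume := hgs.continuous.memLp_of_hasCompactSupport hgc
  have L2 : MemLp (gradient g) 2 volume :=
    (continuous_gradient hgd).memLp_of_hasCompactSupport (hasCompactSupport_gradient hgc)
  rw [← hgg] at e2
  have d1 := integral_norm_sq_le_of_eLpNorm_le (L1.sub M1) hη.le e1
  have d2 := integral_norm_sq_le_of_eLpNorm_le (L2.sub M2) hη.le e2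
  have c1 := (hBn _ (L1.sub M1)).trans (mul_le_mul_of_nonneg_left d1 hB.le)
  have c2 := (hBn' _ (L2.sub M2)).trans (mul_le_mul_of_nonneg_left d2 hB'.le)
  have q1 : B * η ^ 2 ≤ δ / 8 := by
    rw [hη2, ← mul_div_assoc, div_le_div_iff₀ (by positivity) (by positivity)]
    nlinarith [mul_pos hδ hB']
  have q2 : B' * η ^ 2 ≤ δ / 8 := by
    rw [hη2, ← mul_div_assoc, div_le_div_iff₀ (by positivity) (by positivity)]
    nlinarith [mul_pos hδ hB]
  have W1 := hn.memLp_weighted_of_memLp L1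
  have W2 := hn.memLp_weighted_of_memLp L2
  simp only [Pi.sub_apply] at c1 c2
  refine ⟨g, hgs, hgc, ?_, ?_⟩
  · have := integral_norm_sq_le_weighted_add (hf.sub W1) (hf.sub m1) one_pos
    simp only [Pi.sub_apply, inv_one, sub_sub_sub_cancel_left, smul_eq_mul] at this hk1
    have s : ∫ x, ‖f₁ x - g x‖ ^ 2 ∂(weighted n) = ∫ x, ‖g x - f₁ x‖ ^ 2 ∂(weighted n) := by
      simp_rw [norm_sub_rev]
    simp only [f₁] at this s c1
    linarith
  · have A1 := integral_norm_sq_le_weighted_add (hv.sub W2) (hv.sub m4) one_pos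
    have A2 := integral_norm_sq_le_weighted_add (hv.sub m4) (hv.sub m2) one_pos
    simp only [Pi.sub_apply, inv_one, sub_sub_sub_cancel_left] at A1 A2
    have s : ∫ x, ‖v₁ x - gradient g x‖ ^ 2 ∂(weighted n)
        = ∫ x, ‖gradient g x - v₁ x‖ ^ 2 ∂(weighted n) := by
      simp_rw [norm_sub_rev]
    have s2 : ∫ x, ‖χ (t • x) • v x - v₁ x‖ ^ 2 ∂(weighted n) ≤ (t * D) ^ 2 * S := by
      rw [← integral_const_mul]
      refine integral_mono ((m2.sub m4).integrable_norm_pow two_ne_zero)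
        ((hf.integrable_norm_pow two_ne_zero).const_mul _) fun x => ?_
      simp only [v₁, sub_add_cancel_left, norm_neg, norm_smul]
      rw [mul_pow, mul_comm]
      gcongr
      exact hgb x
    linarith

end Density

end

/-! ### The spectral gap on the weighted Sobolev space -/

section

/-- `f` is a mean-zero perturbation in the weighted Sobolev space, with weak gradient `v`. -/
structure IsPerturbation (n f : Plane → ℝ) (v : Plane → Plane) : Prop where
  hasWeakGradient : HasWeakGradient f v
  memLp : MemLp f 2 (weighted n)
  memLp_grad : MemLp v 2 (weighted n)
  mean : ∫ x, f x * n x = 0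

variable {n f g : Plane → ℝ} {v w : Plane → Plane}

namespace IsPerturbation

lemma aestronglyMeasurable (h : IsPerturbation n f v) : AEStronglyMeasurable f :=
  h.hasWeakGradient.locallyIntegrable.aestronglyMeasurable

lemma integrable_sq (h : IsPerturbation n f v) (hn : IsRapidWeight n) :
    Integrable fun x => f x ^ 2 * n x := by
  simpa using (hn.memLp_two.1 h.memLp).2

lemma integrable_mul_weight (h : IsPerturbation n f v) (hn : IsRapidWeight n) :
    Integrable fun x => f x * n x :=
  hn.integrable_mul_weight h.aestronglyMeasurable (h.integrable_sq hn)

lemma hasWeakGradient_potential (h : IsPerturbation n f v) (hn : IsRapidWeight n) :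
    HasWeakGradient (perturbedPotential n f) (field fun y => f y * n y) :=
  hasWeakGradient_invLaplacian (hn.integrable_moment h.aestronglyMeasurable (h.integrable_sq hn))

lemma memLp_field (h : IsPerturbation n f v) (hn : IsRapidWeight n) :
    MemLp (field fun y => f y * n y) 2 volume :=
  (memLp_two_iff_integrable_sq_norm (aestronglyMeasurable_field
    (hn.integrable_moment h.aestronglyMeasurable (h.integrable_sq hn)))).2
    (hn.integrable_field_sq h.aestronglyMeasurable (h.integrable_sq hn) h.mean)

lemma sub (h : IsPerturbation n f v) (h' : IsPerturbation n g w) (hn : IsRapidWeight n) :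
    IsPerturbation n (fun x => f x - g x) (fun x => v x - w x) where
  hasWeakGradient := h.hasWeakGradient.sub h'.hasWeakGradient
  memLp := h.memLp.sub h'.memLp
  memLp_grad := h.memLp_grad.sub h'.memLp_grad
  mean := by
    simp_rw [sub_mul]
    rw [integral_sub (h.integrable_mul_weight hn) (h'.integrable_mul_weight hn), h.mean, h'.mean,
      sub_zero]

lemma field_sub (h : IsPerturbation n f v) (h' : IsPerturbation n g w) (hn : IsRapidWeight n) :
    (field fun y => (f y - g y) * n y) =ᵐ[volume]
      fun x => field (fun y => f y * n y) x - field (fun y => g y * n y) x := by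
  refine ((h.sub h' hn).hasWeakGradient_potential hn).ae_unique
    (((h.hasWeakGradient_potential hn).sub (h'.hasWeakGradient_potential hn)).congr_ae
      (Eventually.of_forall fun x => ?_) EventuallyEq.rfl)
  simp only [perturbedPotential, invLaplacian]
  rw [← integral_sub (hn.integrable_green_mul h.aestronglyMeasurable (h.integrable_sq hn) x)
    (hn.integrable_green_mul h'.aestronglyMeasurable (h'.integrable_sq hn) x)]
  congr 1; ext y; ring

end IsPerturbation

/-- Cauchy–Schwarz for the mean of a square integrable function. -/
lemma IsRapidWeight.sq_integral_le (hn : IsRapidWeight n) (hf : MemLp f 2 (weighted n)) :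
    (∫ x, f x * n x) ^ 2 ≤ (∫ x, n x) * ∫ x, f x ^ 2 * n x := by
  obtain ⟨hfm, hf2⟩ := hn.memLp_two.1 hf
  simp only [Real.norm_eq_abs, sq_abs] at hf2
  have hf1 := hn.integrable_mul_weight hfm hf2
  have hn1 := hn.integrable
  set N := ∫ x, n x
  set m := ∫ x, f x * n x
  have hN : 0 < N := by
    refine (integral_pos_iff_support_of_nonneg (fun x => (hn.pos x).le) hn1).2 ?_
    rw [Function.support_eq_univ fun x => (hn.pos x).ne']
    exact NeZero.pos _
  have h0 : 0 ≤ ∫ x, (N * f x - m) ^ 2 * n x :=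
    integral_nonneg fun x => mul_nonneg (sq_nonneg _) (hn.pos x).le
  have h1 : ∫ x, (N * f x - m) ^ 2 * n x
      = N ^ 2 * (∫ x, f x ^ 2 * n x) - 2 * N * m * m + m ^ 2 * N := by
    have : ∀ x, (N * f x - m) ^ 2 * n x
        = N ^ 2 * (f x ^ 2 * n x) - 2 * N * m * (f x * n x) + m ^ 2 * n x := fun x => by ring
    have i1 : Integrable fun x => N ^ 2 * (f x ^ 2 * n x) - 2 * N * m * (f x * n x) :=
      (hf2.const_mul _).sub (hf1.const_mul _)
    simp_rw [this]
    rw [integral_add i1 (hn1.const_mul _),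
      integral_sub (hf2.const_mul _) (hf1.const_mul _), integral_const_mul, integral_const_mul,
      integral_const_mul]
  rw [h1] at h0
  have h2 : 0 ≤ N * (N * (∫ x, f x ^ 2 * n x) - m ^ 2) := by nlinarith
  have := (mul_nonneg_iff_of_pos_left hN).1 h2
  linarith

/-- The smooth approximation can be chosen with mean zero: subtract a multiple of a fixed bump. -/
lemma IsPerturbation.exists_smooth_approx (h : IsPerturbation n f v) (hn : IsRapidWeight n)
    {δ : ℝ} (hδ : 0 < δ) :
    ∃ g : Plane → ℝ, ContDiff ℝ ∞ g ∧ HasCompactSupport g ∧ IsPerturbation n g (gradient g) ∧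
      ∫ x, ‖f x - g x‖ ^ 2 ∂(weighted n) ≤ δ ∧ ∫ x, ‖v x - gradient g x‖ ^ 2 ∂(weighted n) ≤ δ := by
  obtain ⟨χ, hχ, ⟨hχc, hχ1⟩, hχ01⟩ := exists_contDiff_hasCompactSupport_eq_one 1
  have memLp : ∀ {g : Plane → ℝ}, ContDiff ℝ ∞ g → HasCompactSupport g →
      MemLp g 2 (weighted n) := fun hg hgc =>
    hn.memLp_weighted_of_memLp (hg.continuous.memLp_of_hasCompactSupport hgc)
  have memLp_grad : ∀ {g : Plane → ℝ}, ContDiff ℝ ∞ g → HasCompactSupport g →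
      MemLp (gradient g) 2 (weighted n) := fun hg hgc =>
    hn.memLp_weighted_of_memLp ((continuous_gradient (hg.of_le (by exact_mod_cast le_top)))
      |>.memLp_of_hasCompactSupport (hasCompactSupport_gradient hgc))
  have hint : ∀ {g : Plane → ℝ}, ContDiff ℝ ∞ g → HasCompactSupport g →
      Integrable fun x => g x * n x := fun hg hgc =>
    (hg.continuous.mul hn.continuous).integrable_of_hasCompactSupport hgc.mul_right
  set c := ∫ x, χ x * n x
  have hc : 0 < c := by
    refine (hχ.continuous.mul hn.continuous).integral_pos_of_hasCompactSupport_nonneg_nonzero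
      hχc.mul_right (fun x => mul_nonneg (hχ01 x).1 (hn.pos x).le) (x := 0) ?_
    rw [hχ1 0 (by simp), one_mul]
    exact (hn.pos 0).ne'
  set A := ∫ x, ‖χ x‖ ^ 2 ∂(weighted n)
  set A' := ∫ x, ‖gradient χ x‖ ^ 2 ∂(weighted n)
  set N := ∫ x, n x
  have hA : 0 ≤ A := integral_nonneg fun x => by positivity
  have hA' : 0 ≤ A' := integral_nonneg fun x => by positivity
  have hN : 0 ≤ N := integral_nonneg fun x => (hn.pos x).le
  set K := 2 + 2 * N * (A + A') / c ^ 2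
  have hK : 0 < K := by positivity
  obtain ⟨g, hg, hgc, h1, h2⟩ := hn.exists_smooth_approx h.hasWeakGradient h.memLp h.memLp_grad
    (show 0 < δ / K by positivity)
  -- the mean of the approximation is small
  set s := (∫ x, g x * n x) / c with hs
  have hs2 : s ^ 2 ≤ N * (δ / K) / c ^ 2 := by
    have h3 := hn.sq_integral_le ((memLp hg hgc).sub h.memLp)
    have h4 : ∫ x, (g - f) x * n x = ∫ x, g x * n x := by
      simp_rw [Pi.sub_apply, sub_mul]
      rw [integral_sub (hint hg hgc) (h.integrable_mul_weight hn), h.mean, sub_zero]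
    have h5 : ∫ x, (g - f) x ^ 2 * n x = ∫ x, ‖f x - g x‖ ^ 2 ∂(weighted n) := by
      rw [hn.integral_weighted]
      congr 1; ext x
      rw [Real.norm_eq_abs, sq_abs, Pi.sub_apply]; ring
    rw [h4, h5] at h3
    rw [hs, div_pow]
    gcongr
    exact h3.trans (mul_le_mul_of_nonneg_left h1 hN)
  have hg' : ContDiff ℝ ∞ fun x => g x - s * χ x := hg.sub (contDiff_const.mul hχ)
  have hgc' : HasCompactSupport fun x => g x - s * χ x := by
    have h3 : HasCompactSupport fun x => (-s) * χ x := hχc.mul_left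
    have h4 : (fun x => g x - s * χ x) = g + fun x => (-s) * χ x := by
      ext x; simp [sub_eq_add_neg]
    rw [h4]
    exact hgc.add h3
  have hgrad : ∀ x, gradient (fun x => g x - s * χ x) x = gradient g x - s • gradient χ x := by
    intro x
    refine ext_inner_right ℝ fun e => ?_
    rw [inner_sub_left, real_inner_smul_left]
    simp only [inner_gradient_left]
    rw [fderiv_fun_sub (hg.differentiable (by simp) x)
      ((hχ.differentiable (by simp) x).const_mul s),
      fderiv_const_mul (hχ.differentiable (by simp) x)]
    simp
  have hbudget : ∀ {a : ℝ}, a ≤ A + A' → 2 * (δ / K) + 2 * (s ^ 2 * a) ≤ δ := by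
    intro a ha
    have h3 : s ^ 2 * a ≤ N * (δ / K) / c ^ 2 * (A + A') :=
      (mul_le_mul_of_nonneg_left ha (sq_nonneg s)).trans
        (mul_le_mul_of_nonneg_right hs2 (by positivity))
    have h4 : 2 * (δ / K) + 2 * (N * (δ / K) / c ^ 2 * (A + A')) = δ / K * K := by
      simp only [K]; ring
    rw [div_mul_cancel₀ _ hK.ne'] at h4
    linarith
  refine ⟨fun x => g x - s * χ x, hg', hgc', ?_, ?_, ?_⟩
  · refine ⟨hasWeakGradient_gradient (hg'.of_le (by exact_mod_cast le_top)), memLp hg' hgc',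
      memLp_grad hg' hgc', ?_⟩
    simp_rw [sub_mul, mul_assoc]
    rw [integral_sub (hint hg hgc) ((hint hχ hχc).const_mul s), integral_const_mul, hs,
      div_mul_cancel₀ _ hc.ne', sub_self]
  · have h3 := integral_norm_sq_le_weighted_add (h.memLp.sub (memLp hg' hgc'))
      (h.memLp.sub (memLp hg hgc)) one_pos
    have h4 : ∫ x, ‖g x - (g x - s * χ x)‖ ^ 2 ∂(weighted n) = s ^ 2 * A := by
      simp_rw [sub_sub_cancel, norm_mul, mul_pow]
      rw [integral_const_mul, Real.norm_eq_abs, sq_abs]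
    simp only [Pi.sub_apply, inv_one, sub_sub_sub_cancel_left] at h3
    rw [h4] at h3
    have := hbudget (a := A) (by linarith)
    linarith
  · have h3 := integral_norm_sq_le_weighted_add (h.memLp_grad.sub (memLp_grad hg' hgc'))
      (h.memLp_grad.sub (memLp_grad hg hgc)) one_pos
    have h4 : ∫ x, ‖gradient g x - gradient (fun x => g x - s * χ x) x‖ ^ 2 ∂(weighted n)
        = s ^ 2 * A' := by
      simp_rw [hgrad, sub_sub_cancel, norm_smul, mul_pow]
      rw [integral_const_mul, Real.norm_eq_abs, sq_abs]
    simp only [Pi.sub_apply, inv_one, sub_sub_sub_cancel_left] at h3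
    rw [h4] at h3
    have := hbudget (a := A') (by linarith)
    linarith

/-- The spectral gap inequality on the whole weighted Sobolev space. -/
lemma IsStationary.spectral_gap {μ M : ℝ} {c : Plane → ℝ} (hμ : 0 < μ) (hM : 0 < M)
    (hst : IsStationary M (harmonicPotential μ) n c) (h : IsPerturbation n f v) :
    μ * ((∫ x, f x ^ 2 * n x) + ∫ x, ‖field (fun y => f y * n y) x‖ ^ 2) ≤
      ∫ x, ‖v x + field (fun y => f y * n y) x‖ ^ 2 * n x := by
  have hn := hst.isRapidWeight hμ hM
  obtain ⟨C, hC, hCf⟩ := hn.exists_integral_field_le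
  obtain ⟨B, hB, hBn⟩ := hn.exists_integral_weighted_le (E := Plane)
  have toν : ∀ u : Plane → ℝ, ∫ x, u x ^ 2 * n x = ∫ x, ‖u x‖ ^ 2 ∂(weighted n) := fun u => by
    rw [hn.integral_weighted]; simp
  set F := field fun y => f y * n y
  rw [toν f, ← hn.integral_weighted fun x => ‖v x + F x‖ ^ 2]
  set X₁ := ∫ x, ‖f x‖ ^ 2 ∂(weighted n)
  set X₂ := ∫ x, ‖F x‖ ^ 2
  set Y := ∫ x, ‖v x + F x‖ ^ 2 ∂(weighted n)
  set K := 2 * (2 + 2 * B * C) + 2 * μ * (1 + C)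
  have key : ∀ ε : ℝ, 0 < ε → μ * (X₁ + X₂) ≤ (1 + ε) ^ 2 * Y + ε * (1 + ε) ^ 2 * K := by
    intro ε hε
    have hε2 : 0 < ε ^ 2 := by positivity
    obtain ⟨g, hg, hgc, hgp, h1, h2⟩ := h.exists_smooth_approx hn hε2
    set G := field fun y => g y * n y
    have hsub := h.sub hgp hn
    have hfs := h.field_sub hgp hn
    have hgap := hst.spectral_gap_of_hasCompactSupport hμ hM
      (by exact_mod_cast contDiff_infty.1 hg 2)
      hgc hgp.mean
    rw [toν g, ← hn.integral_weighted fun x => ‖gradient g x + G x‖ ^ 2] at hgap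
    have hFm : MemLp F 2 volume := h.memLp_field hn
    have hGm : MemLp G 2 volume := hgp.memLp_field hn
    have hFG : ∫ x, ‖F x - G x‖ ^ 2 ≤ C * ε ^ 2 := by
      have h3 := hCf _ hsub.aestronglyMeasurable (hsub.integrable_sq hn) hsub.mean
      rw [integral_congr_ae (hfs.mono fun x hx => by simp only [hx]; rfl :
        (fun x => ‖field (fun y => (f y - g y) * n y) x‖ ^ 2) =ᵐ[volume]
          fun x => ‖F x - G x‖ ^ 2), toν fun x => f x - g x] at h3
      exact h3.trans (mul_le_mul_of_nonneg_left h1 hC)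
    have a1 := integral_norm_sq_le_weighted_add h.memLp hgp.memLp hε
    have a2 := integral_norm_sq_le_weighted_add hFm hGm hε
    have hFw := hn.memLp_weighted_of_memLp hFm
    have hGw := hn.memLp_weighted_of_memLp hGm
    have a3 := integral_norm_sq_le_weighted_add (hgp.memLp_grad.add hGw) (h.memLp_grad.add hFw) hε
    have a4 := integral_norm_sq_le_weighted_add
      ((hgp.memLp_grad.add hGw).sub (h.memLp_grad.add hFw)) (hgp.memLp_grad.sub h.memLp_grad)
      one_pos
    have a5 : ∫ x, ‖F x - G x‖ ^ 2 ∂(weighted n) ≤ B * (C * ε ^ 2) :=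
      (hBn _ (hFm.sub hGm)).trans (mul_le_mul_of_nonneg_left hFG hB.le)
    simp only [Pi.sub_apply, Pi.add_apply, inv_one] at a3 a4
    have e1 : ∀ x, gradient g x + G x - (v x + F x) - (gradient g x - v x) = -(F x - G x) :=
      fun x => by abel
    simp only [e1, norm_neg] at a4
    have e2 : ∫ x, ‖gradient g x - v x‖ ^ 2 ∂(weighted n)
        = ∫ x, ‖v x - gradient g x‖ ^ 2 ∂(weighted n) := by simp_rw [norm_sub_rev]
    rw [e2] at a4
    set T := ∫ x, ‖gradient g x + G x - (v x + F x)‖ ^ 2 ∂(weighted n)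
    set G₁ := ∫ x, ‖g x‖ ^ 2 ∂(weighted n)
    set G₂ := ∫ x, ‖G x‖ ^ 2
    set Yg := ∫ x, ‖gradient g x + G x‖ ^ 2 ∂(weighted n)
    have hT : T ≤ (2 + 2 * B * C) * ε ^ 2 := by linarith
    have i1 : (1 + ε⁻¹) * ε ^ 2 = ε * (1 + ε) := by field_simp; ring
    have b1 : X₁ + X₂ ≤ (1 + ε) * (G₁ + G₂) + ε * (1 + ε) * (1 + C) := by
      have : (1 + ε⁻¹) * ((∫ x, ‖f x - g x‖ ^ 2 ∂(weighted n)) + ∫ x, ‖F x - G x‖ ^ 2)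
          ≤ (1 + ε⁻¹) * (ε ^ 2 * (1 + C)) :=
        mul_le_mul_of_nonneg_left (by linarith) (by positivity)
      rw [← mul_assoc, i1] at this
      linarith
    have b2 : Yg ≤ (1 + ε) * Y + ε * (1 + ε) * (2 + 2 * B * C) := by
      have : (1 + ε⁻¹) * T ≤ (1 + ε⁻¹) * (ε ^ 2 * (2 + 2 * B * C)) :=
        mul_le_mul_of_nonneg_left (by linarith) (by positivity)
      rw [← mul_assoc, i1] at this
      linarith
    have b3 := mul_le_mul_of_nonneg_left b1 hμ.le
    have b4 := mul_le_mul_of_nonneg_left (hgap.trans b2) (show 0 ≤ 1 + ε by positivity)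
    have b5 : μ * (ε * (1 + ε) * (1 + C)) ≤ ε * (1 + ε) ^ 2 * (2 * μ * (1 + C)) := by
      have : 0 ≤ μ * (ε * (1 + ε) * (1 + C)) * (1 + 2 * ε) := by positivity
      nlinarith
    have b6 : 0 ≤ ε * (1 + ε) ^ 2 * (2 + 2 * B * C) := by positivity
    simp only [K]
    nlinarith
  have hlim : Tendsto (fun ε : ℝ => (1 + ε) ^ 2 * Y + ε * (1 + ε) ^ 2 * K) (𝓝[>] 0) (𝓝 Y) := by
    have hc : Continuous fun ε : ℝ => (1 + ε) ^ 2 * Y + ε * (1 + ε) ^ 2 * K := by fun_prop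
    have := (hc.tendsto 0).mono_left (nhdsWithin_le_nhds (s := Ioi 0))
    simpa using this
  exact ge_of_tendsto hlim (eventually_nhdsWithin_of_forall fun ε hε => key ε hε)

end

/-! ### The optimal perturbations -/

section

/-- Integration by parts against the Green function, for a rapidly decaying density. -/
lemma IsRapidWeight.integral_green_mul_fderiv {n : Plane → ℝ} (hn : IsRapidWeight n)
    (hn1 : ContDiff ℝ 1 n) (x e : Plane) (hG : Integrable fun y => green (x - y) * n y)
    (hGd : Integrable fun y => green (x - y) * fderiv ℝ n y e) :
    ∫ y, green (x - y) * fderiv ℝ n y e = inner ℝ (field n x) e := by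
  obtain ⟨χ, hχ, ⟨hχc, hχ1⟩, hχ01⟩ := exists_contDiff_hasCompactSupport_eq_one 1
  have hχd : ContDiff ℝ 1 χ := hχ.of_le (by exact_mod_cast le_top)
  have hdc : Continuous fun y => fderiv ℝ χ y e :=
    (hχd.continuous_fderiv one_ne_zero).clm_apply continuous_const
  obtain ⟨D, hD⟩ := ((hχc.fderiv (𝕜 := ℝ)).comp_left (g := fun L : Plane →L[ℝ] ℝ => L e)
    (by simp)).exists_bound_of_continuous hdc
  have hD0 : 0 ≤ D := (norm_nonneg _).trans (hD 0)
  set t : ℕ → ℝ := fun k => (k + 1 : ℝ)⁻¹ with ht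
  have ht0 : ∀ k, 0 < t k := fun k => by positivity
  have ht1 : ∀ k, t k ≤ 1 := fun k => inv_le_one_of_one_le₀ (by linarith [k.cast_nonneg (α := ℝ)])
  have htlim : Tendsto t atTop (𝓝 0) := by
    simpa [ht] using tendsto_one_div_add_atTop_nhds_zero_nat (𝕜 := ℝ)
  have hχlim : ∀ y, ∀ᶠ k in atTop, χ (t k • y) = 1 := by
    intro y
    obtain ⟨N, hN⟩ := exists_nat_ge ‖y‖
    filter_upwards [eventually_ge_atTop N] with k hk
    have hk' : (N : ℝ) ≤ k := by exact_mod_cast hk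
    refine hχ1 _ ?_
    rw [norm_smul, Real.norm_of_nonneg (ht0 k).le, inv_mul_le_iff₀ (by positivity)]
    linarith
  have hsd : ∀ k, ContDiff ℝ 1 fun y : Plane => χ (t k • y) := fun k =>
    hχd.comp (contDiff_const_smul (t k))
  have hfd : ∀ k y, fderiv ℝ (fun y => χ (t k • y) * n y) y e
      = χ (t k • y) * fderiv ℝ n y e + n y * (t k * fderiv ℝ χ (t k • y) e) := by
    intro k y
    rw [fderiv_fun_mul ((hsd k).differentiable one_ne_zero y) (hn1.differentiable one_ne_zero y),
      fderiv_comp_smul]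
    simp
  have hgm : AEStronglyMeasurable fun y => green (x - y) :=
    (measurable_green.comp (measurable_const.sub measurable_id)).aestronglyMeasurable
  have hkm : AEStronglyMeasurable fun y => inner ℝ (greenGrad (x - y)) e :=
    ((measurable_greenGrad.comp
      (measurable_const.sub measurable_id)).inner_const).aestronglyMeasurable
  have hKn : Integrable fun y => n y • greenGrad (x - y) := by
    obtain ⟨C, hC, h⟩ := hn.decay 1
    refine ((integrable_japanese_div x).const_mul C).mono' (hn.continuous.aestronglyMeasurable.smul
      (measurable_greenGrad.comp (measurable_const.sub measurable_id)).aestronglyMeasurable)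
      (Eventually.of_forall fun y => ?_)
    rw [norm_smul, Real.norm_of_nonneg (hn.pos y).le, ← mul_assoc]
    have := h y
    rw [pow_one] at this
    exact mul_le_mul this (norm_greenGrad_le _) (norm_nonneg _) ((hn.pos y).le.trans this)
  have hKi : Integrable fun y => inner ℝ (greenGrad (x - y)) e * n y := by
    refine (hKn.inner_const (𝕜 := ℝ) e).congr (Eventually.of_forall fun y => ?_)
    simp only [real_inner_smul_left]; ring
  -- the compactly supported case, reflected and translated
  have hk : ∀ k, ∫ y, green (x - y) * fderiv ℝ (fun y => χ (t k • y) * n y) y e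
      = ∫ y, inner ℝ (greenGrad (x - y)) e * (χ (t k • y) * n y) := by
    intro k
    set u : Plane → ℝ := fun y => χ (t k • y) * n y with hu
    have hu1 : ContDiff ℝ 1 u := (hsd k).mul hn1
    have huc : HasCompactSupport u := (hχc.comp_smul (ht0 k).ne').mul_right
    have h := PNP.integral_green_mul_fderiv (η := fun z => u (x - z))
      (hu1.comp (contDiff_const.sub contDiff_id)) (huc.comp_homeomorph (Homeomorph.subLeft x)) e
    have h2 : ∀ z, fderiv ℝ (fun z => u (x - z)) z e = -fderiv ℝ u (x - z) e := by
      intro z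
      have h1 : HasFDerivAt (fun z => u (x - z)) ((fderiv ℝ u (x - z)).comp
          (-ContinuousLinearMap.id ℝ Plane)) z :=
        ((hu1.differentiable one_ne_zero (x - z)).hasFDerivAt).comp z
          ((hasFDerivAt_id z).const_sub x)
      rw [h1.fderiv]; simp
    simp_rw [h2, mul_neg, integral_neg, neg_inj] at h
    rw [← integral_sub_left_eq_self (fun y => green (x - y) * fderiv ℝ u y e) volume x,
      ← integral_sub_left_eq_self (fun y => inner ℝ (greenGrad (x - y)) e * u y) volume x]
    simpa using h
  have l1 : Tendsto (fun k => ∫ y, green (x - y) * fderiv ℝ (fun y => χ (t k • y) * n y) y e)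
      atTop (𝓝 (∫ y, green (x - y) * fderiv ℝ n y e)) := by
    refine tendsto_integral_of_dominated_convergence
      (fun y => ‖green (x - y) * fderiv ℝ n y e‖ + D * ‖green (x - y) * n y‖) (fun k => ?_)
      (hGd.norm.add (hG.norm.const_mul D)) (fun k => Eventually.of_forall fun y => ?_)
      (Eventually.of_forall fun y => ?_)
    · exact hgm.mul (((((hsd k).mul hn1).continuous_fderiv one_ne_zero).clm_apply
        continuous_const).aestronglyMeasurable)
    · rw [hfd]
      have e1 : green (x - y) * (χ (t k • y) * fderiv ℝ n y e
          + n y * (t k * fderiv ℝ χ (t k • y) e))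
          = χ (t k • y) * (green (x - y) * fderiv ℝ n y e)
            + (t k * fderiv ℝ χ (t k • y) e) * (green (x - y) * n y) := by ring
      rw [e1]
      refine (norm_add_le _ _).trans (add_le_add ?_ ?_)
      · rw [norm_mul, Real.norm_of_nonneg (hχ01 _).1]
        exact mul_le_of_le_one_left (norm_nonneg _) (hχ01 _).2
      · rw [norm_mul]
        refine mul_le_mul_of_nonneg_right ?_ (norm_nonneg _)
        rw [norm_mul, Real.norm_of_nonneg (ht0 k).le]
        exact (mul_le_mul (ht1 k) (hD _) (norm_nonneg _) zero_le_one).trans (one_mul D).le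
    · have hz : Tendsto (fun k => t k * fderiv ℝ χ (t k • y) e) atTop (𝓝 0) := by
        refine squeeze_zero_norm (fun k => ?_) (by simpa using htlim.mul_const D)
        rw [norm_mul, Real.norm_of_nonneg (ht0 k).le]
        exact mul_le_mul_of_nonneg_left (hD _) (ht0 k).le
      have h2 : Tendsto (fun k => green (x - y) * (1 * fderiv ℝ n y e
          + n y * (t k * fderiv ℝ χ (t k • y) e))) atTop (𝓝 (green (x - y) * fderiv ℝ n y e)) := by
        simpa using ((hz.const_mul (n y)).const_add (1 * fderiv ℝ n y e)).const_mul (green (x - y))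
      refine h2.congr' ?_
      filter_upwards [hχlim y] with k hk
      rw [hfd, hk]
  have l2 : Tendsto (fun k => ∫ y, inner ℝ (greenGrad (x - y)) e * (χ (t k • y) * n y))
      atTop (𝓝 (∫ y, inner ℝ (greenGrad (x - y)) e * n y)) := by
    refine tendsto_integral_of_dominated_convergence
      (fun y => ‖inner ℝ (greenGrad (x - y)) e * n y‖) (fun k => ?_)
      hKi.norm (fun k => Eventually.of_forall fun y => ?_) (Eventually.of_forall fun y => ?_)
    · exact hkm.mul ((hsd k).mul hn1).continuous.aestronglyMeasurable
    · rw [mul_left_comm, norm_mul, Real.norm_of_nonneg (hχ01 _).1]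
      exact mul_le_of_le_one_left (norm_nonneg _) (hχ01 _).2
    · refine tendsto_const_nhds.congr' ?_
      filter_upwards [hχlim y] with k hk
      rw [hk, one_mul]
  simp_rw [hk] at l1
  rw [tendsto_nhds_unique l1 l2, field, real_inner_comm, ← integral_inner (𝕜 := ℝ) hKn e]
  congr 1; ext y
  rw [real_inner_smul_right, real_inner_comm]; ring

/-- The directional derivatives `∂ₑ log n = -∂ₑ c - μ ⟨x, e⟩` of the logarithm of the density, which
span the optimal perturbations. -/
noncomputable def logDeriv (μ : ℝ) (c : Plane → ℝ) (e x : Plane) : ℝ :=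
  -(fderiv ℝ c x e + μ * inner ℝ x e)

namespace IsStationary

variable {μ M : ℝ} {n c : Plane → ℝ}

lemma logDeriv_mul (hM : 0 < M) (hst : IsStationary M (harmonicPotential μ) n c) (e x : Plane) :
    logDeriv μ c e x * n x = fderiv ℝ n x e :=
  (hst.fderiv_density hM x e).symm

lemma fderiv_potential_polar (hμ : 0 < μ) (hM : 0 < M)
    (hst : IsStationary M (harmonicPotential μ) n c) {r : ℝ} (hr : 0 < r) (θ : ℝ) (v : Plane) :
    fderiv ℝ c (r • er θ) v = -(mass c r / r) * inner ℝ (er θ) v := by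
  have h0 : r • er θ ≠ 0 := by
    rw [← norm_pos_iff, norm_smul_er]; positivity
  rw [← inner_gradient_left, hst.gradient_potential hμ hM h0, norm_smul_er, abs_of_pos hr,
    real_inner_smul_left, real_inner_smul_left]
  field_simp

/-- The Hessian of the potential, radial direction. -/
lemma fderiv_fderiv_potential_er (hμ : 0 < μ) (hM : 0 < M)
    (hst : IsStationary M (harmonicPotential μ) n c) {r : ℝ} (hr : 0 < r) (θ : ℝ) (v : Plane) :
    fderiv ℝ (fderiv ℝ c) (r • er θ) (er θ) v
      = (mass c r / r ^ 2 - n (r • er θ)) * inner ℝ (er θ) v := by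
  have h1 := hasDerivAt_fderiv_line hst.contDiff 0 (er θ) v r
  simp only [zero_add] at h1
  have h2 : HasDerivAt (fun s => -(mass c s / s) * inner ℝ (er θ) v)
      ((mass c r / r ^ 2 - n (r • er θ)) * inner ℝ (er θ) v) r := by
    refine (((hst.hasDerivAt_mass hμ hM hr.ne').div (hasDerivAt_id r) hr.ne').neg.mul_const
      (inner ℝ (er θ) v)).congr_deriv ?_
    rw [hst.density_eq_of_norm_eq hμ hM
      (show ‖r • er θ‖ = ‖r • er 0‖ by rw [norm_smul_er, norm_smul_er])]
    simp only [id]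
    field_simp
    ring
  refine h1.unique (h2.congr_of_eventuallyEq ?_)
  filter_upwards [Ioi_mem_nhds hr] with s hs
  exact hst.fderiv_potential_polar hμ hM hs θ v

/-- The Hessian of the potential, tangential direction. -/
lemma fderiv_fderiv_potential_et (hμ : 0 < μ) (hM : 0 < M)
    (hst : IsStationary M (harmonicPotential μ) n c) {r : ℝ} (hr : 0 < r) (θ : ℝ) (v : Plane) :
    fderiv ℝ (fderiv ℝ c) (r • er θ) (et θ) v = -(mass c r / r ^ 2) * inner ℝ (et θ) v := by
  have h1 : HasDerivAt (fun s => fderiv ℝ c (r • er s) v)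
      (fderiv ℝ (fderiv ℝ c) (r • er θ) (r • et θ) v) θ := by
    have h := (hasFDerivAt_fderiv hst.contDiff (r • er θ)).comp_hasDerivAt θ
      ((hasDerivAt_er θ).const_smul r)
    exact (ContinuousLinearMap.apply ℝ ℝ v).hasFDerivAt.comp_hasDerivAt θ h
  have h2 : HasDerivAt (fun s => -(mass c r / r) * inner ℝ (er s) v)
      (-(mass c r / r) * inner ℝ (et θ) v) θ := by
    refine HasDerivAt.const_mul _ ?_
    simpa using (hasDerivAt_er θ).inner ℝ (hasDerivAt_const θ v)
  have h3 := h1.unique (h2.congr_of_eventuallyEq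
    (Eventually.of_forall fun s => hst.fderiv_potential_polar hμ hM hr s v))
  rw [map_smul, smul_apply, smul_eq_mul] at h3
  have h4 : fderiv ℝ (fderiv ℝ c) (r • er θ) (et θ) v
      = r * fderiv ℝ (fderiv ℝ c) (r • er θ) (et θ) v / r := by field_simp
  rw [h4, h3]
  field_simp

lemma fderiv_fderiv_apply (hst : IsStationary M (harmonicPotential μ) n c) (x e v : Plane) :
    fderiv ℝ (fun y => fderiv ℝ c y e) x v = fderiv ℝ (fderiv ℝ c) x v e := by
  have h := (ContinuousLinearMap.apply ℝ ℝ e).hasFDerivAt.comp x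
    (hasFDerivAt_fderiv hst.contDiff x)
  have h2 : fderiv ℝ (fun y => fderiv ℝ c y e) x = _ := h.fderiv
  rw [h2]; rfl

lemma norm_gradient_fderiv_sq (hμ : 0 < μ) (hM : 0 < M)
    (hst : IsStationary M (harmonicPotential μ) n c) {r : ℝ} (hr : 0 < r) (θ : ℝ) (e : Plane) :
    ‖gradient (fun y => fderiv ℝ c y e) (r • er θ)‖ ^ 2
      = (mass c r / r ^ 2 - n (r • er θ)) ^ 2 * inner ℝ (er θ) e ^ 2
        + (mass c r / r ^ 2) ^ 2 * inner ℝ (et θ) e ^ 2 := by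
  rw [gradient_norm_sq_eq_polar _ _ θ, hst.fderiv_fderiv_apply, hst.fderiv_fderiv_apply,
    hst.fderiv_fderiv_potential_er hμ hM hr, hst.fderiv_fderiv_potential_et hμ hM hr]
  ring

lemma mass_div_nonneg_le (hμ : 0 < μ) (hM : 0 < M)
    (hst : IsStationary M (harmonicPotential μ) n c) {r : ℝ} (hr : 0 < r) :
    0 ≤ mass c r / r ^ 2 ∧ mass c r / r ^ 2 ≤ μ := by
  have hp := hst.radialProfile hμ hM
  have h1 := hp.mass_pos r hr
  refine ⟨by positivity, ?_⟩
  rw [div_le_iff₀ (by positivity)]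
  exact hp.mass_le r hr

lemma contDiff_fderiv_apply (hst : IsStationary M (harmonicPotential μ) n c) (e : Plane) :
    ContDiff ℝ 1 fun y => fderiv ℝ c y e :=
  (hst.contDiff.fderiv_right (m := 1) (by norm_num)).clm_apply contDiff_const

lemma contDiff_logDeriv (hst : IsStationary M (harmonicPotential μ) n c) (e : Plane) :
    ContDiff ℝ 1 (logDeriv μ c e) :=
  ((hst.contDiff_fderiv_apply e).add
    (contDiff_const.mul (contDiff_id.inner ℝ contDiff_const))).neg

lemma gradient_logDeriv (hst : IsStationary M (harmonicPotential μ) n c) (e x : Plane) :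
    gradient (logDeriv μ c e) x = -(gradient (fun y => fderiv ℝ c y e) x + μ • e) := by
  refine ext_inner_right ℝ fun v => ?_
  have h1 := ((hst.contDiff_fderiv_apply e).differentiable one_ne_zero x).hasFDerivAt
  have h2 : HasFDerivAt (fun y : Plane => inner ℝ y e) ((innerSL ℝ).flip e) x :=
    ((innerSL ℝ).flip e).hasFDerivAt
  have h3 : HasFDerivAt (logDeriv μ c e) _ x := (h1.add (h2.const_mul μ)).neg
  rw [inner_gradient_left, h3.fderiv, inner_neg_left, inner_add_left, inner_gradient_left,
    real_inner_smul_left]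
  simp
  exact Or.inl rfl

lemma inner_frame_sq (θ : ℝ) (e : Plane) :
    inner ℝ (er θ) e ^ 2 + inner ℝ (et θ) e ^ 2 = ‖e‖ ^ 2 := by
  rw [norm_sq_eq_polar e θ, real_inner_comm, real_inner_comm (et θ)]

lemma norm_gradient_fderiv_le (hμ : 0 < μ) (hM : 0 < M)
    (hst : IsStationary M (harmonicPotential μ) n c) (e : Plane) {x : Plane} (hx : x ≠ 0) :
    ‖gradient (fun y => fderiv ℝ c y e) x‖ ≤ 2 * μ * ‖e‖ := by
  obtain ⟨θ, hθ⟩ := exists_polar x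
  have hr : 0 < ‖x‖ := norm_pos_iff.2 hx
  refine (sq_le_sq₀ (norm_nonneg _) (by positivity)).1 ?_
  rw [hθ, hst.norm_gradient_fderiv_sq hμ hM hr θ e, mul_pow, ← inner_frame_sq θ e, mul_add]
  obtain ⟨h1, h2⟩ := hst.mass_div_nonneg_le hμ hM hr
  have h3 := hst.density_le hμ hM (‖x‖ • er θ)
  have h4 := hst.pos hM (‖x‖ • er θ)
  gcongr ?_ * _ + ?_ * _
  · exact sq_le_sq' (by linarith) (by linarith)
  · exact sq_le_sq' (by linarith) (by linarith)

lemma abs_logDeriv_le (hμ : 0 < μ) (hM : 0 < M)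
    (hst : IsStationary M (harmonicPotential μ) n c) (e : Plane) {x : Plane} (hx : x ≠ 0) :
    ‖logDeriv μ c e x‖ ≤ μ * ‖e‖ * ‖x‖ := by
  have hr : 0 < ‖x‖ := norm_pos_iff.2 hx
  have h : logDeriv μ c e x = (mass c ‖x‖ / ‖x‖ ^ 2 - μ) * inner ℝ x e := by
    rw [logDeriv, ← inner_gradient_left, hst.gradient_potential hμ hM hx, real_inner_smul_left]
    ring
  obtain ⟨h1, h2⟩ := hst.mass_div_nonneg_le hμ hM hr
  rw [h, norm_mul, Real.norm_eq_abs, abs_of_nonpos (by linarith)]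
  have h3 : ‖inner ℝ x e‖ ≤ ‖x‖ * ‖e‖ := norm_inner_le_norm x e
  calc -(mass c ‖x‖ / ‖x‖ ^ 2 - μ) * ‖inner ℝ x e‖ ≤ μ * (‖x‖ * ‖e‖) :=
        mul_le_mul (by linarith) h3 (norm_nonneg _) hμ.le
    _ = _ := by ring

lemma ae_ne_zero : ∀ᵐ x : Plane, x ≠ 0 := by
  simp [ae_iff]

lemma isPerturbation_logDeriv (hμ : 0 < μ) (hM : 0 < M)
    (hst : IsStationary M (harmonicPotential μ) n c) (e : Plane) :
    IsPerturbation n (logDeriv μ c e) (gradient (logDeriv μ c e)) := by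
  have hn := hst.isRapidWeight hμ hM
  have hc1 := hst.contDiff_logDeriv e
  have hae : ∀ᵐ x ∂(weighted n), x ≠ 0 := (weighted_absolutelyContinuous n) ae_ne_zero
  refine ⟨hasWeakGradient_gradient hc1, ?_, ?_, ?_⟩
  · have hx : MemLp (fun x : Plane => ‖x‖) 2 (weighted n) := by
      refine hn.memLp_two.2 ⟨continuous_norm.aestronglyMeasurable, ?_⟩
      refine (hn.integrable_pow 1).mono'
        ((continuous_norm.norm.pow 2).mul hn.continuous).aestronglyMeasurable
        (Eventually.of_forall fun x => ?_)
      have := (hn.pos x).le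
      rw [norm_norm, Real.norm_of_nonneg (by positivity), pow_one]
      gcongr
      linarith
    refine hx.of_le_mul (c := μ * ‖e‖) hc1.continuous.aestronglyMeasurable ?_
    filter_upwards [hae] with x hx
    rw [norm_norm]
    exact hst.abs_logDeriv_le hμ hM e hx
  · have h1 : MemLp (fun _ : Plane => (1 : ℝ)) 2 (weighted n) :=
      hn.memLp_two.2 ⟨aestronglyMeasurable_const, by simpa using hn.integrable⟩
    refine h1.of_le_mul (c := 3 * μ * ‖e‖) (continuous_gradient hc1).aestronglyMeasurable ?_
    filter_upwards [hae] with x hx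
    rw [hst.gradient_logDeriv, norm_neg, norm_one, mul_one]
    have h2 := norm_add_le (gradient (fun y => fderiv ℝ c y e) x) (μ • e)
    have h3 := hst.norm_gradient_fderiv_le hμ hM e hx
    rw [norm_smul, Real.norm_of_nonneg hμ.le] at h2
    linarith
  · -- the integrand is odd
    have hodd : ∀ x, logDeriv μ c e (-x) * n (-x) = -(logDeriv μ c e x * n x) := by
      intro x
      have hceven : (fun y => c (-y)) = c :=
        funext fun y => hst.potential_eq_of_norm_eq hμ hM (norm_neg y)
      have h1 : fderiv ℝ c x e = -fderiv ℝ c (-x) e := by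
        have h2 : HasFDerivAt (fun y => c (-y)) ((fderiv ℝ c (-x)).comp
            (-ContinuousLinearMap.id ℝ Plane)) x :=
          ((hst.contDiff.differentiable two_ne_zero (-x)).hasFDerivAt).comp x (hasFDerivAt_id x).neg
        rw [hceven] at h2
        rw [h2.fderiv]; simp
      rw [hst.density_eq_of_norm_eq hμ hM (norm_neg x), logDeriv, logDeriv, h1, inner_neg_left]
      ring
    have h := integral_neg_eq_self (fun x => logDeriv μ c e x * n x) (volume : Measure Plane)
    simp_rw [hodd, integral_neg] at h
    linarith

/-- The field of `(∂ₑ log n) n = ∂ₑ n` is the gradient of `∂ₑ c`. -/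
lemma field_logDeriv (hμ : 0 < μ) (hM : 0 < M)
    (hst : IsStationary M (harmonicPotential μ) n c) (e : Plane) :
    (field fun y => logDeriv μ c e y * n y) =ᵐ[volume] gradient fun y => fderiv ℝ c y e := by
  have hn := hst.isRapidWeight hμ hM
  have hp := hst.isPerturbation_logDeriv hμ hM e
  have hmom : Integrable fun y => (1 + ‖y‖) * n y := by
    simpa using hn.integrable_moment (f := fun _ => 1) aestronglyMeasurable_const
      (by simpa using hn.integrable)
  have hfield : field n =ᵐ[volume] gradient c := by
    have h1 := hasWeakGradient_invLaplacian hmom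
    rw [← hst.eq_invLaplacian] at h1
    exact h1.ae_unique (hasWeakGradient_gradient (hst.contDiff.of_le (by norm_num)))
  have hpot : perturbedPotential n (logDeriv μ c e) =ᵐ[volume] fun y => fderiv ℝ c y e := by
    filter_upwards [hfield] with x hx
    have h1 := hn.integrable_green_mul hp.aestronglyMeasurable (hp.integrable_sq hn) x
    simp only [hst.logDeriv_mul hM] at h1
    rw [← inner_gradient_left, ← hx, ← hn.integral_green_mul_fderiv
      ((hst.contDiff_density hM).of_le (by norm_num)) x e (hst.integrable_green x) h1]
    simp only [perturbedPotential, invLaplacian, hst.logDeriv_mul hM]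
  exact ((hp.hasWeakGradient_potential hn).congr_ae hpot EventuallyEq.rfl).ae_unique
    (hasWeakGradient_gradient (hst.contDiff_fderiv_apply e))

/-- The Fisher information of the optimal perturbations. -/
lemma integral_fisher_logDeriv (hμ : 0 < μ) (hM : 0 < M)
    (hst : IsStationary M (harmonicPotential μ) n c) {e : Plane} (he : ‖e‖ = 1) :
    ∫ x, ‖gradient (logDeriv μ c e) x + field (fun y => logDeriv μ c e y * n y) x‖ ^ 2 * n x
      = μ ^ 2 * M := by
  rw [← hst.integral_density, ← integral_const_mul]
  refine integral_congr_ae ?_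
  filter_upwards [hst.field_logDeriv hμ hM e] with x hx
  rw [hx, hst.gradient_logDeriv, neg_add_rev, neg_add_cancel_right, norm_neg, norm_smul, he,
    mul_one, Real.norm_eq_abs, sq_abs]

end IsStationary

end

/-! ### The energy of the optimal perturbations and the conclusion -/

section

namespace IsStationary

variable {μ M : ℝ} {n c : Plane → ℝ}

/-- Sum over the two coordinate directions of the integrand of `Q₁` at the optimal perturbations. -/
lemma sum_integrand_logDeriv (hμ : 0 < μ) (hM : 0 < M)
    (hst : IsStationary M (harmonicPotential μ) n c) {r : ℝ} (hr : 0 < r) (θ : ℝ) :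
    (logDeriv μ c (er 0) (r • er θ) ^ 2 * n (r • er θ)
        + ‖gradient (fun y => fderiv ℝ c y (er 0)) (r • er θ)‖ ^ 2)
      + (logDeriv μ c (et 0) (r • er θ) ^ 2 * n (r • er θ)
        + ‖gradient (fun y => fderiv ℝ c y (et 0)) (r • er θ)‖ ^ 2)
      = (μ * r - mass c r / r) ^ 2 * n (r • er 0)
        + ((mass c r / r ^ 2 - n (r • er 0)) ^ 2 + (mass c r / r ^ 2) ^ 2) := by
  have hl : ∀ e, logDeriv μ c e (r • er θ) = (mass c r / r - μ * r) * inner ℝ (er θ) e := by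
    intro e
    rw [logDeriv, hst.fderiv_potential_polar hμ hM hr, real_inner_smul_left]; ring
  have h1 : inner ℝ (er θ) (er 0) ^ 2 + inner ℝ (er θ) (et 0) ^ 2 = 1 := by
    rw [← norm_sq_eq_polar, norm_er, one_pow]
  have h2 : inner ℝ (et θ) (er 0) ^ 2 + inner ℝ (et θ) (et 0) ^ 2 = 1 := by
    rw [← norm_sq_eq_polar, norm_et, one_pow]
  rw [hst.norm_gradient_fderiv_sq hμ hM hr, hst.norm_gradient_fderiv_sq hμ hM hr, hl, hl,
    hst.density_eq_of_norm_eq hμ hM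
      (show ‖r • er θ‖ = ‖r • er 0‖ by rw [norm_smul_er, norm_smul_er])]
  linear_combination ((mass c r / r - μ * r) ^ 2 * n (r • er 0)
    + (mass c r / r ^ 2 - n (r • er 0)) ^ 2) * h1 + (mass c r / r ^ 2) ^ 2 * h2

lemma integral_polar_density (hμ : 0 < μ) (hM : 0 < M)
    (hst : IsStationary M (harmonicPotential μ) n c) :
    IntegrableOn (fun r => n (r • er 0) * r) (Ioi 0) ∧
      2 * Real.pi * ∫ r in Ioi 0, n (r • er 0) * r = M := by
  have hn := hst.isRapidWeight hμ hM
  obtain ⟨h1, h2⟩ := integral_polar hn.integrable hn.continuous.measurable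
  have h3 : ∀ r : ℝ, ∫ θ in (-Real.pi)..Real.pi, r * n (r • er θ)
      = 2 * Real.pi * (n (r • er 0) * r) := fun r => by
    simp_rw [fun θ => hst.density_eq_of_norm_eq hμ hM
      (show ‖r • er θ‖ = ‖r • er 0‖ by rw [norm_smul_er, norm_smul_er])]
    rw [intervalIntegral.integral_const, smul_eq_mul]; ring
  simp_rw [h3] at h1 h2
  rw [hst.integral_density, integral_const_mul] at h2
  refine ⟨?_, h2.symm⟩
  refine (h1.const_mul (2 * Real.pi)⁻¹).congr (Eventually.of_forall fun r => ?_)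
  have := Real.pi_pos
  field_simp

lemma tendsto_mass (hμ : 0 < μ) (hM : 0 < M)
    (hst : IsStationary M (harmonicPotential μ) n c) :
    Tendsto (mass c) atTop (𝓝 (∫ r in Ioi 0, n (r • er 0) * r)) := by
  have hn := hst.isRapidWeight hμ hM
  have h := intervalIntegral_tendsto_integral_Ioi 0 (hst.integral_polar_density hμ hM).1 tendsto_id
  refine h.congr' ?_
  filter_upwards [eventually_gt_atTop 0] with r hr
  have hc : Continuous fun r : ℝ => n (r • er 0) * r :=
    (hn.continuous.comp (continuous_id.smul continuous_const)).mul continuous_id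
  rw [id, intervalIntegral.integral_eq_sub_of_hasDeriv_right_of_le hr.le
    hst.continuous_mass.continuousOn (fun s hs => (hst.hasDerivAt_mass hμ hM
      (ne_of_gt hs.1)).hasDerivWithinAt) (hc.intervalIntegrable _ _)]
  simp [mass]

/-- The sum of `Q₁` over the two optimal perturbations: the radial integrand differs from
`2 μ n r` by the derivative of `-n (μ r² - m) - (m / r)²`, which vanishes at both ends. -/
lemma integral_logDeriv (hμ : 0 < μ) (hM : 0 < M)
    (hst : IsStationary M (harmonicPotential μ) n c) :
    ((∫ x, logDeriv μ c (er 0) x ^ 2 * n x)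
        + ∫ x, ‖field (fun y => logDeriv μ c (er 0) y * n y) x‖ ^ 2)
      + ((∫ x, logDeriv μ c (et 0) x ^ 2 * n x)
        + ∫ x, ‖field (fun y => logDeriv μ c (et 0) y * n y) x‖ ^ 2) = 2 * μ * M := by
  have hn := hst.isRapidWeight hμ hM
  have hp := hst.radialProfile hμ hM
  obtain ⟨hni, hnM⟩ := hst.integral_polar_density hμ hM
  have i1 : ∀ e, Integrable fun x => logDeriv μ c e x ^ 2 * n x := fun e =>
    (hst.isPerturbation_logDeriv hμ hM e).integrable_sq hn
  have hfe : ∀ e, (fun x => ‖field (fun y => logDeriv μ c e y * n y) x‖ ^ 2) =ᵐ[volume]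
      fun x => ‖gradient (fun y => fderiv ℝ c y e) x‖ ^ 2 := fun e =>
    (hst.field_logDeriv hμ hM e).mono fun x hx => by simp only [hx]
  have i2 : ∀ e, Integrable fun x => ‖gradient (fun y => fderiv ℝ c y e) x‖ ^ 2 := fun e =>
    (((hst.isPerturbation_logDeriv hμ hM e).memLp_field hn).integrable_norm_pow
      two_ne_zero).congr (hfe e)
  have i12 : ∀ e, Integrable fun x => logDeriv μ c e x ^ 2 * n x
      + ‖gradient (fun y => fderiv ℝ c y e) x‖ ^ 2 := fun e => (i1 e).add (i2 e)
  rw [integral_congr_ae (hfe (er 0)), integral_congr_ae (hfe (et 0)),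
    ← integral_add (i1 _) (i2 _), ← integral_add (i1 _) (i2 _), ← integral_add (i12 _) (i12 _)]
  set W : Plane → ℝ := fun x => (logDeriv μ c (er 0) x ^ 2 * n x
      + ‖gradient (fun y => fderiv ℝ c y (er 0)) x‖ ^ 2)
    + (logDeriv μ c (et 0) x ^ 2 * n x + ‖gradient (fun y => fderiv ℝ c y (et 0)) x‖ ^ 2)
  have hWi : Integrable W := (i12 _).add (i12 _)
  have hWm : Measurable W := by
    have h1 : ∀ e, Continuous (logDeriv μ c e) := fun e => (hst.contDiff_logDeriv e).continuous
    have h2 : ∀ e, Continuous (gradient fun y => fderiv ℝ c y e) := fun e =>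
      continuous_gradient (hst.contDiff_fderiv_apply e)
    exact (((((h1 _).pow 2).mul hn.continuous).add ((h2 _).norm.pow 2)).add
      ((((h1 _).pow 2).mul hn.continuous).add ((h2 _).norm.pow 2))).measurable
  set D : ℝ → ℝ := fun r => r * ((μ * r - mass c r / r) ^ 2 * n (r • er 0)
    + ((mass c r / r ^ 2 - n (r • er 0)) ^ 2 + (mass c r / r ^ 2) ^ 2)) with hD
  obtain ⟨hI, hW⟩ := integral_polar hWi hWm
  have hcirc : ∀ r ∈ Ioi (0 : ℝ), ∫ θ in (-Real.pi)..Real.pi, r * W (r • er θ)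
      = 2 * Real.pi * D r := by
    intro r hr
    have : ∀ θ, r * W (r • er θ) = D r := fun θ => by
      simp only [hD, W]
      rw [hst.sum_integrand_logDeriv hμ hM hr θ]
    simp_rw [this]
    rw [intervalIntegral.integral_const, smul_eq_mul]; ring
  have hpi := Real.pi_pos
  have hDi : IntegrableOn D (Ioi 0) := by
    refine ((hI.congr_fun hcirc measurableSet_Ioi).const_mul (2 * Real.pi)⁻¹).congr
      (Eventually.of_forall fun r => ?_)
    field_simp
  rw [hW, setIntegral_congr_fun measurableSet_Ioi hcirc, integral_const_mul]
  -- the total derivative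
  set nr : ℝ → ℝ := fun r => n (r • er 0)
  set P : ℝ → ℝ := fun r => -(nr r * (μ * r ^ 2 - mass c r)) - (mass c r / r) ^ 2
  have hP : ∀ r ∈ Ioi (0 : ℝ), HasDerivAt P (D r - 2 * μ * (nr r * r)) r := by
    intro r hr
    have hr0 : 0 < r := hr
    have d1 := (hp.hasDerivAt r hr0).mul
      (((hasDerivAt_pow 2 r).const_mul μ).sub (hp.hasDerivAt_mass r hr0))
    have d2 := ((hp.hasDerivAt_mass r hr0).div (hasDerivAt_id r) hr0.ne').pow 2
    refine (d1.neg.sub d2).congr_deriv ?_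
    simp only [hD, id, Pi.div_apply, Pi.sub_apply]
    push_cast
    field_simp
    ring
  have hnr : Continuous nr := hn.continuous.comp (continuous_id.smul continuous_const)
  have h0 : Tendsto P (𝓝[>] 0) (𝓝 0) := by
    obtain ⟨ρ, -, hρ⟩ := hp.limit_mass
    have hid : Tendsto (fun r : ℝ => r) (𝓝[>] 0) (𝓝 0) := tendsto_id.mono_left nhdsWithin_le_nhds
    have hc : Continuous fun r => -(nr r * (μ * r ^ 2 - mass c r)) := by
      have := hst.continuous_mass
      fun_prop
    have hm0 : mass c 0 = 0 := by simp [mass]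
    have t1 := (hc.tendsto 0).mono_left (nhdsWithin_le_nhds (s := Ioi 0))
    have t2 := t1.sub ((hρ.mul hid).pow 2)
    simp only [hm0, mul_zero, sub_zero, ne_eq, OfNat.ofNat_ne_zero, not_false_eq_true, zero_pow,
      neg_zero] at t2
    refine t2.congr' ?_
    filter_upwards [self_mem_nhdsWithin] with r hr
    have : r ≠ 0 := ne_of_gt hr
    simp only [P]
    field_simp
  have h1 : Tendsto P atTop (𝓝 0) := by
    have hm := hst.tendsto_mass hμ hM
    have hinv := tendsto_inv_atTop_zero (𝕜 := ℝ)
    obtain ⟨C, hC, hdec⟩ := hn.decay 2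
    -- `r² n → 0` since `n` decays like `r⁻⁴`
    have hrn : Tendsto (fun r => nr r * r ^ 2) atTop (𝓝 0) := by
      have hb : Tendsto (fun r : ℝ => C * (r⁻¹) ^ 2) atTop (𝓝 0) := by
        simpa using (hinv.pow 2).const_mul C
      refine squeeze_zero' (Eventually.of_forall fun r =>
        mul_nonneg (hn.pos _).le (sq_nonneg r)) ?_ hb
      filter_upwards [eventually_gt_atTop 0] with r hr
      have h2 := hdec (r • er 0)
      rw [norm_smul_er, abs_of_pos hr] at h2
      calc nr r * r ^ 2 ≤ C * ((1 + r ^ 2)⁻¹) ^ 2 * r ^ 2 :=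
            mul_le_mul_of_nonneg_right h2 (sq_nonneg r)
        _ ≤ C * ((r ^ 2)⁻¹) ^ 2 * r ^ 2 := by gcongr; linarith
        _ = C * (r⁻¹) ^ 2 := by field_simp
    have hn0 : Tendsto nr atTop (𝓝 0) := by
      have := hrn.mul (hinv.pow 2)
      simp only [ne_eq, OfNat.ofNat_ne_zero, not_false_eq_true, zero_pow, mul_zero] at this
      refine this.congr' ?_
      filter_upwards [eventually_gt_atTop 0] with r hr
      field_simp
    have t := (((hrn.const_mul μ).sub (hn0.mul hm)).neg).sub ((hm.mul hinv).pow 2)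
    simp only [mul_zero, zero_mul, sub_zero, neg_zero, ne_eq, OfNat.ofNat_ne_zero,
      not_false_eq_true, zero_pow] at t
    refine t.congr fun r => ?_
    simp only [P, div_eq_mul_inv]
    ring
  have hint : IntegrableOn (fun r => D r - 2 * μ * (nr r * r)) (Ioi 0) :=
    hDi.sub (hni.const_mul (2 * μ))
  -- here `(mass c 0 / 0) ^ 2 = 0`, which is also the limit at the origin
  have hP0 : P 0 = 0 := by simp [P, mass]
  have hfin : ∫ r in Ioi 0, (D r - 2 * μ * (nr r * r)) = 0 - P 0 := by
    refine integral_Ioi_of_hasDerivAt_of_tendsto ?_ hP hint h1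
    rw [← continuousWithinAt_Ioi_iff_Ici, ContinuousWithinAt, hP0]
    exact h0
  rw [integral_sub hDi (hni.const_mul (2 * μ)), integral_const_mul, hP0, sub_zero] at hfin
  have : ∫ r in Ioi 0, D r = 2 * μ * ∫ r in Ioi 0, n (r • er 0) * r := by linarith
  rw [this, ← hnM]
  ring

end IsStationary

variable {n f : Plane → ℝ} {v : Plane → Plane}

lemma Admissible.isPerturbation (h : Admissible n f) : IsPerturbation n f (weakGradient f) :=
  ⟨hasWeakGradient_weakGradient h.1.2.1, h.1.1, h.1.2.2, h.2⟩

lemma IsPerturbation.admissible (h : IsPerturbation n f v) : Admissible n f :=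
  have hv : v =ᵐ[weighted n] weakGradient f :=
    (weighted_absolutelyContinuous n).ae_eq h.hasWeakGradient.weakGradient_ae_eq.symm
  ⟨⟨h.memLp, ⟨v, h.hasWeakGradient⟩, h.memLp_grad.ae_eq hv⟩, h.mean⟩

lemma IsPerturbation.Q₁_eq (h : IsPerturbation n f v) (hn : IsRapidWeight n) :
    Q₁ n f = (∫ x, f x ^ 2 * n x) + ∫ x, ‖field (fun y => f y * n y) x‖ ^ 2 := by
  rw [Q₁]
  congr 1
  exact integral_congr_ae ((h.hasWeakGradient_potential hn).weakGradient_ae_eq.mono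
    fun x hx => by simp only [hx])

lemma IsPerturbation.Q₂_eq (h : IsPerturbation n f v) (hn : IsRapidWeight n) :
    Q₂ n f = ∫ x, ‖v x + field (fun y => f y * n y) x‖ ^ 2 * n x :=
  integral_congr_ae
    ((h.hasWeakGradient.add (h.hasWeakGradient_potential hn)).weakGradient_ae_eq.mono
    fun x hx => by simp only [hx])

lemma IsPerturbation.wellDefined (h : IsPerturbation n f v) (hn : IsRapidWeight n) :
    WellDefined n f where
  integrable_green := hn.integrable_green_mul h.aestronglyMeasurable (h.integrable_sq hn)
  exists_grad_potential := ⟨_, h.hasWeakGradient_potential hn⟩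
  exists_grad_sum := ⟨_, h.hasWeakGradient.add (h.hasWeakGradient_potential hn)⟩
  integrable_sq := h.integrable_sq hn
  integrable_field := ((h.memLp_field hn).integrable_norm_pow two_ne_zero).congr
    ((h.hasWeakGradient_potential hn).weakGradient_ae_eq.mono fun x hx => by simp only [hx])
  integrable_fisher :=
    (hn.memLp_two.1 (h.memLp_grad.add (hn.memLp_weighted_of_memLp (h.memLp_field hn)))).2.congr
      ((h.hasWeakGradient.add (h.hasWeakGradient_potential hn)).weakGradient_ae_eq.mono
        fun x hx => by simp only [hx, Pi.add_apply])

end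

end PNP

theorem mainTheorem3 (μ M : ℝ) (hμ : 0 < μ) (hM : 0 < M) (n c : PNP.Plane → ℝ)
    (hst : PNP.IsStationary M (PNP.harmonicPotential μ) n c) :
    (∀ f : PNP.Plane → ℝ, PNP.Admissible n f →
      PNP.WellDefined n f ∧ μ * PNP.Q₁ n f ≤ PNP.Q₂ n f) ∧
    IsGreatest {C : ℝ | ∀ f : PNP.Plane → ℝ, PNP.Admissible n f → C * PNP.Q₁ n f ≤ PNP.Q₂ n f} μ := by
  have hn := hst.isRapidWeight hμ hM
  have hgap : ∀ f : PNP.Plane → ℝ, PNP.Admissible n f → μ * PNP.Q₁ n f ≤ PNP.Q₂ n f := by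
    intro f hf
    rw [hf.isPerturbation.Q₁_eq hn, hf.isPerturbation.Q₂_eq hn]
    exact hst.spectral_gap hμ hM hf.isPerturbation
  refine ⟨fun f hf => ⟨hf.isPerturbation.wellDefined hn, hgap f hf⟩, hgap, fun C hC => ?_⟩
  -- `∂ₑ log n`, for `e` in an orthonormal basis: `Q₂ = μ² M` for each of the two functions, while
  -- the two values of `Q₁` add up to `2 μ M`
  have hp := hst.isPerturbation_logDeriv hμ hM
  have h1 := hC _ (hp (PNP.er 0)).admissible
  have h2 := hC _ (hp (PNP.et 0)).admissible
  rw [(hp _).Q₁_eq hn, (hp _).Q₂_eq hn, hst.integral_fisher_logDeriv hμ hM (PNP.norm_er 0)] at h1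
  rw [(hp _).Q₁_eq hn, (hp _).Q₂_eq hn, hst.integral_fisher_logDeriv hμ hM (PNP.norm_et 0)] at h2
  have h3 := hst.integral_logDeriv hμ hM
  have h4 : C * (2 * μ * M) ≤ μ * (2 * μ * M) := by
    calc C * (2 * μ * M) ≤ μ ^ 2 * M + μ ^ 2 * M := by
          rw [← h3, mul_add]; exact add_le_add h1 h2
      _ = μ * (2 * μ * M) := by ring
  exact le_of_mul_le_mul_right h4 (by positivity)
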